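/- **Definitions.** Let $n\ge 2$. A *spherical $n$-gon* is a bordered surface $T$ homeomorphic to the closed unit disc, with $n$ distinct marked boundary points $x_1,\dots,x_n$ (vertices) and a metric of constant curvature $1$, such that the boundary is geodesic away from the vertices and has inner angle $\pi\vartheta_i>0$ at $x_i$. Explicitly: the distance of $T$ is a length distance inducing the topology of the disc; every interior point has a small ball isometric to a ball of the unit sphere $\mathbb{S}^2$; every boundary point other than a vertex has a small ball isometric to a half-disc of $\mathbb{S}^2$; and $x_i$ has a small ball isometric to a spherical sector of angle $\pi\vartheta_i$, boundary corresponding to boundary. It is *convex* if $\vartheta_i\le 1$ for all $i$. It is *angle-deformable* if there are a neighbourhood $\mathcal N$ of $\vartheta=(\vartheta_1,\dots,\vartheta_n)$ in $\mathbb{R}^n$ and a family $(d_\nu)_{\nu\in\mathcal N}$ of such metrics on the same disc with the same vertices, where $d_\nu$ has inner angles $\pi\nu_1,\dots,\pi\nu_n$, where $d_\vartheta$ is the given metric, and which is continuous in the sense that for all $\nu_0\in\mathcal N$ and $\varepsilon>0$ one has $(1+\varepsilon)^{-1}d_{\nu_0}\le d_\nu\le(1+\varepsilon)d_{\nu_0}$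 for all $\nu\in\mathcal N$ close enough to $\nu_0$. It is *non-coaxial* if its double $DT$ (two copies of $T$ glued isometrically along their boundary) has non-coaxial holonomy, that is, the image of the holonomy representation $\pi_1(DT\setminus\{x_1,\dots,x_n\})\to\mathrm{SO}(3,\mathbb{R})$ does not consist of rotations about one common axis. **Lemma (Existence of convex triangles).** Let $\vartheta=(\vartheta_1,\vartheta_2,\vartheta_3)\in(0,1)^3$. A convex spherical triangle ($3$-gon) with inner angles $\pi\vartheta_1,\pi\vartheta_2,\pi\vartheta_3$ exists if and only if both of the following conditions hold: (i) the numbers $1-\vartheta_1$, $1-\vartheta_2$, $1-\vartheta_3$ satisfy the strict triangle inequalities, i.e. $1-\vartheta_i<(1-\vartheta_j)+(1-\vartheta_k)$ whenever $\{i,j,k\}=\{1,2,3\}$; (ii) $\vartheta_1+\vartheta_2+\vartheta_3-1>0$. Moreover, every convex spherical triangle with these angles is angle-deformable and non-coaxial. -/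

import Mathlib

/-- Euclidean 3-space, which contains the unit sphere. -/
abbrev E3 : Type := EuclideanSpace ℝ (Fin 3)

/-- The closed unit disc. -/
abbrev Disc : Type := Metric.closedBall (0 : ℂ) 1

/-- The boundary circle of the closed unit disc. -/
def Disc.boundary : Set Disc := {z | ‖(z : ℂ)‖ = 1}

/-! ### Local geometry of curvature one -/

/-- `f` restricts to an isometry of the ball `B(p, r)` of `X` onto the ball of radius `r` about
`f p` in the unit sphere with its Riemannian (angular) distance. -/
structure IsSphericalChartAt {X : Type*} [MetricSpace X] (f : X → E3) (p : X) (r : ℝ) : Prop where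
  pos : 0 < r
  norm_eq : ∀ q ∈ Metric.ball p r, ‖f q‖ = 1
  angle_eq : ∀ q ∈ Metric.ball p r, ∀ q' ∈ Metric.ball p r,
    InnerProductGeometry.angle (f q) (f q') = dist q q'
  surj : ∀ v : E3, ‖v‖ = 1 → InnerProductGeometry.angle (f p) v < r →
    ∃ q ∈ Metric.ball p r, f q = v

/-- The intrinsic distance, in a spherical sector of radius at most `π / 2`, between the points
with polar coordinates `(φ, ψ)` and `(φ', ψ')`; here `φ` is the distance to the vertex of the
sector and `ψ` the angular coordinate. If `|ψ - ψ'| ≥ π` the shortest path runs through the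
vertex and the distance is `φ + φ'`. -/
noncomputable def sectorDist (φ ψ φ' ψ' : ℝ) : ℝ :=
  Real.arccos (Real.cos φ * Real.cos φ' +
    Real.sin φ * Real.sin φ' * Real.cos (min |ψ - ψ'| Real.pi))

/-- For some `0 < r ≤ π / 2`, the ball `B(p, r)` of `X` is isometric to the standard spherical
sector `{(φ, ψ) | 0 ≤ φ < r, 0 ≤ ψ ≤ π α}` of angle `π α`, in such a way that `p` corresponds to
the vertex of the sector and the part of the boundary `bd` inside the ball corresponds to the two
geodesic sides of the sector. For `α = 1` this is a half-disc with geodesic boundary. -/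
def HasSectorNhd {X : Type*} [MetricSpace X] (bd : Set X) (p : X) (α : ℝ) : Prop :=
  ∃ r : ℝ, 0 < r ∧ r ≤ Real.pi / 2 ∧ ∃ F : ℝ → ℝ → X,
    F 0 0 = p ∧
    (∀ φ ∈ Set.Ico 0 r, ∀ ψ ∈ Set.Icc 0 (Real.pi * α),
      ∀ φ' ∈ Set.Ico 0 r, ∀ ψ' ∈ Set.Icc 0 (Real.pi * α),
        dist (F φ ψ) (F φ' ψ') = sectorDist φ ψ φ' ψ') ∧
    (∀ q ∈ Metric.ball p r,
      ∃ φ ∈ Set.Ico 0 r, ∃ ψ ∈ Set.Icc 0 (Real.pi * α), F φ ψ = q) ∧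
    (∀ φ ∈ Set.Ico 0 r, ∀ ψ ∈ Set.Icc 0 (Real.pi * α),
      F φ ψ ∈ bd ↔ φ = 0 ∨ ψ = 0 ∨ ψ = Real.pi * α)

/-- The distance of `X` is the infimum of the lengths of the paths joining two points. -/
def IsLengthSpace (X : Type*) [MetricSpace X] : Prop :=
  ∀ p q : X, ∀ ε : ℝ, 0 < ε →
    ∃ γ : Path p q, eVariationOn (γ : unitInterval → X) Set.univ ≤ ENNReal.ofReal (dist p q + ε)

/-! ### Spherical polygons -/

/-- A distance on the closed disc that induces its usual topology. -/
structure DiscMetric where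
  toMetricSpace : MetricSpace Disc
  topology_eq : toMetricSpace.toPseudoMetricSpace.toUniformSpace.toTopologicalSpace =
    (instTopologicalSpaceSubtype : TopologicalSpace Disc)

/-- The closed disc, endowed with the distance `g` (instead of the Euclidean one). -/
def DiscMetric.Space (_g : DiscMetric) : Type := Disc

instance DiscMetric.instMetricSpace (g : DiscMetric) : MetricSpace g.Space := g.toMetricSpace

/-- The boundary of the disc, as a subset of the disc with the distance `g`. -/
def DiscMetric.boundary (g : DiscMetric) : Set g.Space := Disc.boundary

/-- The `g`-distance between two points of the disc. -/
def DiscMetric.d (g : DiscMetric) (p q : Disc) : ℝ := @dist g.Space _ p q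

/-- A spherical `n`-gon: the closed disc with `n` marked boundary points (the vertices) and a
metric of constant curvature `1`, i.e. a length distance locally isometric to the unit sphere in
the interior, such that the boundary is geodesic away from the vertices and has inner angle
`π * angle i` at the vertex number `i`. -/
structure SphericalPolygon (n : ℕ) where
  two_le : 2 ≤ n
  metric : DiscMetric
  vertex : Fin n → metric.Space
  angle : Fin n → ℝ
  vertex_injective : Function.Injective vertex
  vertex_mem : ∀ i, vertex i ∈ metric.boundary
  angle_pos : ∀ i, 0 < angle i
  isLengthSpace : IsLengthSpace metric.Space
  interior_chart : ∀ p ∉ metric.boundary, ∃ (f : metric.Space → E3) (r : ℝ),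
    IsSphericalChartAt f p r
  edge_chart : ∀ p ∈ metric.boundary, p ∉ Set.range vertex → HasSectorNhd metric.boundary p 1
  vertex_chart : ∀ i, HasSectorNhd metric.boundary (vertex i) (angle i)

namespace SphericalPolygon

variable {n : ℕ}

/-- A polygon is convex if all its inner angles are at most `π`. -/
def IsConvex (T : SphericalPolygon n) : Prop := ∀ i, T.angle i ≤ 1

/-- The vertices, as points of the closed disc. -/
def discVertex (T : SphericalPolygon n) (i : Fin n) : Disc := T.vertex i

/-- `T` is angle-deformable: over a neighbourhood `N` of its vector of angles there is a
continuous family of spherical metrics on the same topological polygon (the disc with the same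
marked points), the metric over `ν` having inner angles `π ν`, which gives back `T` over
its own angles. Continuity of the family is meant for the Lipschitz topology: for `ν` close to
`ν₀`, the ratio of the two distances is uniformly close to `1`. -/
def AngleDeformable (T : SphericalPolygon n) : Prop :=
  ∃ N ∈ nhds T.angle, ∃ P : (Fin n → ℝ) → SphericalPolygon n,
    P T.angle = T ∧
    (∀ ν ∈ N, (P ν).angle = ν ∧ (P ν).discVertex = T.discVertex) ∧
    ∀ ν₀ ∈ N, ∀ ε : ℝ, 0 < ε → ∀ᶠ ν in nhdsWithin ν₀ N, ∀ p q : Disc,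
      (P ν).metric.d p q ≤ (1 + ε) * (P ν₀).metric.d p q ∧
      (P ν₀).metric.d p q ≤ (1 + ε) * (P ν).metric.d p q

end SphericalPolygon

/-! ### Holonomy and doubles -/

/-- A continuation along the path `γ` of spherical charts: a chart `f t` at every point `γ t`,
such that the germs of these charts are locally constant in `t`. -/
def IsDevelopmentAlong {X : Type*} [MetricSpace X] {p q : X} (γ : Path p q)
    (f : unitInterval → X → E3) : Prop :=
  (∀ t, ∃ r, IsSphericalChartAt (f t) (γ t) r) ∧
  ∀ t, ∀ᶠ s in nhds t, f s =ᶠ[nhds (γ s)] f t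

/-- The image of the holonomy representation of the fundamental group of `X \ sing`, based at `p`
and normalized by the chart `f₀` at `p`: the isometries `A` of the sphere such that continuation
of `f₀` along some loop in `X \ sing` based at `p` ends with `A ∘ f₀`. -/
def holonomyImage {X : Type*} [MetricSpace X] (sing : Set X) (p : X) (f₀ : X → E3) :
    Set (E3 ≃ₗᵢ[ℝ] E3) :=
  {A | ∃ γ : Path p p, (∀ t, γ t ∉ sing) ∧ ∃ f : unitInterval → X → E3,
    IsDevelopmentAlong γ f ∧ f 0 =ᶠ[nhds p] f₀ ∧ f 1 =ᶠ[nhds p] fun q => A (f₀ q)}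

/-- The holonomy of the spherical surface `X` with conical points `sing` is coaxial if all its
elements fix a common point of the sphere. (If `X` is orientable, they are elements of `SO(3)`,
and this says that they are rotations about a common axis.) -/
def HasCoaxialHolonomy (X : Type*) [MetricSpace X] (sing : Set X) : Prop :=
  ∀ p ∉ sing, ∀ (f₀ : X → E3) (r : ℝ), IsSphericalChartAt f₀ p r →
    ∃ v : E3, ‖v‖ = 1 ∧ ∀ A ∈ holonomyImage sing p f₀, A v = v

namespace SphericalPolygon

variable {n : ℕ}

instance (T : SphericalPolygon n) : Nonempty T.metric.boundary :=
  ⟨⟨T.vertex ⟨0, by have := T.two_le; omega⟩, T.vertex_mem _⟩⟩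

/-- The double of a polygon: two copies of it, glued along their boundaries. -/
abbrev Double (T : SphericalPolygon n) : Type :=
  Metric.GlueSpace (isometry_subtype_coe (s := T.metric.boundary))
    (isometry_subtype_coe (s := T.metric.boundary))

/-- The conical points of the double. -/
def doubleSing (T : SphericalPolygon n) : Set T.Double :=
  Set.range fun i => Metric.toGlueL (isometry_subtype_coe (s := T.metric.boundary))
    (isometry_subtype_coe (s := T.metric.boundary)) (T.vertex i)

/-- A polygon is non-coaxial if its double has non-coaxial holonomy. -/
def NonCoaxial (T : SphericalPolygon n) : Prop := ¬ HasCoaxialHolonomy T.Double T.doubleSing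

end SphericalPolygon

/-! The whole argument reduces to one rigidity statement: a spherical triangle with all angles less
than `π` is isometric to a region of the unit sphere cut out by three half-spaces with linearly
independent inward normals (`exists_isTriangleModel`, with `IsTriangleModel` as the normal form).
After that every claim is linear algebra on the triple of normals.

Rigidity. Since all angles are at most `π`, the disc can be developed into the sphere near every
point, boundary included, and since the disc is simply connected the local maps glue to a global map
`e` (`exists_global_developing`). A compact length space is geodesic, and propagating the cosine
formula along shortest paths shows `⟪e p, e q⟫ = cos (dist p q)` globally (`inner_eq_cos_dist`).
Points at distance `π` are excluded, because all the rest of the disc would then lie on shortest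
paths between them, whereas such paths avoid vertices (`dist_lt_pi_of_vertices`). Hence `e` is an
isometric embedding whose image spans a convex cone in an open half-space. A slice of this cone is
compact and convex, and any point of the disc that is not a vertex is the midpoint of a geodesic, so
by Krein–Milman the cone is generated by the three vertices (`exists_cone_coefficients`). The dual
basis gives the normals.

Existence. At a vertex of such a model the angle `π α` satisfies `⟪n j, n k⟫ = -cos (π α)`, and an
angle at most `π` is determined by the metric (`sector_angle_unique`). The angles therefore
prescribe the Gram matrix of the normals. Independent vectors have positive Gram determinant, and
this determinant factors so that its positivity is exactly conditions (i) and (ii) (`gram_pos_iff`).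
Conversely, on that region explicit normals can be written down (`hasAngles_normals`), and a
homeomorphism of the disc with a flat triangle carries the resulting metric to the disc.

Deformation. The numbers `⟪n i, e p⟫` are homogeneous coordinates on the disc. Keeping them fixed
while the normals vary with the angles changes the triangle by linear maps close to the identity,
which distort angular distances by factors close to one (`angle_map_le_of_near_one`,
`eventually_distortion`).

Non-coaxiality. Unfolding the double across its sides, a loop that leaves a copy through one side
and returns through another has as holonomy a product of two reflections in the planes of these
sides. A vector fixed by all such products is orthogonal to the three independent normals, hence
zero (`IsTriangleModel.nonCoaxial`). -/

namespace SphericalGeometry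

open InnerProductGeometry
open scoped RealInnerProductSpace Topology

/-! ### Vectors and angles in Euclidean 3-space -/

/-- A family of vectors with the same inner products as a spanning family is its image under a
linear isometry. -/
theorem exists_isometry_of_inner_eq {ι : Type*} {f g : ι → E3}
    (h : ∀ i j, ⟪f i, f j⟫ = ⟪g i, g j⟫) (hg : Submodule.span ℝ (Set.range g) = ⊤) :
    ∃ A : E3 ≃ₗᵢ[ℝ] E3, ∀ i, A (g i) = f i := by
  set Lf := Finsupp.linearCombination ℝ f with hLf
  set Lg := Finsupp.linearCombination ℝ g with hLg
  have hin : ∀ c, ⟪Lf c, Lf c⟫ = ⟪Lg c, Lg c⟫ := by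
    intro c
    simp only [hLf, hLg, Finsupp.linearCombination_apply, Finsupp.sum, sum_inner, inner_sum,
      real_inner_smul_left, real_inner_smul_right, h]
  have hnorm : ∀ c, ‖Lf c‖ = ‖Lg c‖ := by
    intro c
    have := hin c
    rw [real_inner_self_eq_norm_sq, real_inner_self_eq_norm_sq] at this
    exact (sq_eq_sq₀ (norm_nonneg _) (norm_nonneg _)).1 this
  have hsurj : LinearMap.range Lg = ⊤ := by
    rw [hLg, Finsupp.range_linearCombination, hg]
  obtain ⟨s, hs⟩ := Lg.exists_rightInverse_of_surjective hsurj
  have hs' : ∀ v, Lg (s v) = v := fun v => by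
    simpa using LinearMap.congr_fun hs v
  -- A vector is expanded in the `g i` by an arbitrary linear section `s`, and the same combination
  -- of the `f i` is taken. Equal Gram matrices give `Lf` and `Lg` the same kernel, so the choice of
  -- section is immaterial.
  let A₀ : E3 →ₗᵢ[ℝ] E3 :=
    { toLinearMap := Lf.comp s
      norm_map' := fun v => by
        change ‖Lf (s v)‖ = ‖v‖
        rw [hnorm, hs'] }
  refine ⟨A₀.toLinearIsometryEquiv rfl, fun i => ?_⟩
  change Lf (s (g i)) = f i
  have h1 : Lg (Finsupp.single i 1) = g i := by simp [hLg]
  have h2 : Lf (Finsupp.single i 1) = f i := by simp [hLf]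
  have h3 : ‖Lf (s (g i) - Finsupp.single i 1)‖ = 0 := by
    rw [hnorm, map_sub, hs', h1]; simp
  rw [norm_eq_zero, map_sub, h2, sub_eq_zero] at h3
  exact h3

theorem eq_of_inner_eq_on_span {u v : E3} {S : Set E3} (hS : Submodule.span ℝ S = ⊤)
    (h : ∀ x ∈ S, ⟪x, u⟫ = ⟪x, v⟫) : u = v := by
  have key : ∀ x ∈ Submodule.span ℝ S, ⟪x, u - v⟫ = 0 := by
    intro x hx
    induction hx using Submodule.span_induction with
    | mem x hx => rw [inner_sub_right, h x hx, sub_self]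
    | zero => simp
    | add x y _ _ hx hy => rw [inner_add_left, hx, hy, add_zero]
    | smul a x _ hx => rw [real_inner_smul_left, hx, mul_zero]
  have := key (u - v) (hS ▸ Submodule.mem_top)
  rw [inner_self_eq_zero, sub_eq_zero] at this
  exact this

theorem isometryEquiv_eq_of_eqOn_span {A B : E3 ≃ₗᵢ[ℝ] E3} {S : Set E3}
    (hS : Submodule.span ℝ S = ⊤) (h : ∀ x ∈ S, A x = B x) : A = B := by
  have : A.toLinearEquiv.toLinearMap = B.toLinearEquiv.toLinearMap :=
    LinearMap.ext_on hS fun x hx => h x hx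
  ext1 x
  exact LinearMap.congr_fun this x

theorem exists_unit_orthogonal (x y : E3) : ∃ w : E3, ‖w‖ = 1 ∧ ⟪x, w⟫ = 0 ∧ ⟪y, w⟫ = 0 := by
  have hfin : Module.finrank ℝ (Submodule.span ℝ ({x, y} : Set E3)) ≤ 2 := by
    have := finrank_span_finset_le_card (R := ℝ) ({x, y} : Finset E3)
    simp only [Finset.coe_insert, Finset.coe_singleton] at this
    exact this.trans Finset.card_le_two
  have hne : (Submodule.span ℝ ({x, y} : Set E3))ᗮ ≠ ⊥ := by
    intro hbot
    have := Submodule.finrank_add_finrank_orthogonal (Submodule.span ℝ ({x, y} : Set E3))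
    rw [hbot, finrank_bot, finrank_euclideanSpace, Fintype.card_fin] at this
    omega
  obtain ⟨w, hw, hw0⟩ := Submodule.exists_mem_ne_zero_of_ne_bot hne
  refine ⟨‖w‖⁻¹ • w, norm_smul_inv_norm hw0, ?_, ?_⟩ <;> rw [real_inner_smul_right]
  · rw [hw x (Submodule.subset_span (by simp)), mul_zero]
  · rw [hw y (Submodule.subset_span (by simp)), mul_zero]

theorem angle_eq_of_inner_eq_cos {x y : E3} (hx : ‖x‖ = 1) (hy : ‖y‖ = 1) {t : ℝ} (h0 : 0 ≤ t)
    (hπ : t ≤ Real.pi) (h : ⟪x, y⟫ = Real.cos t) : angle x y = t := by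
  rw [angle, hx, hy, h, mul_one, div_one, Real.arccos_cos h0 hπ]

theorem inner_self_of_unit {x : E3} (hx : ‖x‖ = 1) : ⟪x, x⟫ = 1 := by
  rw [real_inner_self_eq_norm_sq, hx, one_pow]

theorem norm_eq_one_of_inner_self {x : E3} (hx : ⟪x, x⟫ = 1) : ‖x‖ = 1 := by
  rw [real_inner_self_eq_norm_sq] at hx
  nlinarith [norm_nonneg x]

/-- Every unit vector is the endpoint of a great circle arc issuing from a given one. -/
theorem exists_arc {u v : E3} (hu : ‖u‖ = 1) (hv : ‖v‖ = 1) :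
    ∃ w : E3, ‖w‖ = 1 ∧ ⟪u, w⟫ = 0 ∧
      v = Real.cos (angle u v) • u + Real.sin (angle u v) • w := by
  have hcos : ⟪u, v⟫ = Real.cos (angle u v) := inner_eq_cos_angle_of_norm_eq_one hu hv
  have hsq := Real.sin_sq_add_cos_sq (angle u v)
  have huu := inner_self_of_unit hu
  have hvv := inner_self_of_unit hv
  have hnorm : ⟪v - Real.cos (angle u v) • u, v - Real.cos (angle u v) • u⟫ =
      Real.sin (angle u v) ^ 2 := by
    simp only [inner_sub_left, inner_sub_right, real_inner_smul_left, real_inner_smul_right,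
      huu, hvv, real_inner_comm u v, hcos]
    linarith
  by_cases h0 : Real.sin (angle u v) = 0
  · obtain ⟨w, hw, huw, -⟩ := exists_unit_orthogonal u u
    refine ⟨w, hw, huw, ?_⟩
    rw [h0, sq, mul_zero, inner_self_eq_zero, sub_eq_zero] at hnorm
    rw [h0, zero_smul, add_zero]
    exact hnorm
  · refine ⟨(Real.sin (angle u v))⁻¹ • (v - Real.cos (angle u v) • u), ?_, ?_, ?_⟩
    · apply norm_eq_one_of_inner_self
      rw [real_inner_smul_left, real_inner_smul_right, hnorm]
      field_simp
    · rw [real_inner_smul_right, inner_sub_right, real_inner_smul_right, huu, hcos]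
      ring
    · rw [smul_smul, mul_inv_cancel₀ h0, one_smul]
      abel

theorem inner_arc {u w : E3} (hu : ‖u‖ = 1) (hw : ‖w‖ = 1) (huw : ⟪u, w⟫ = 0) (s t : ℝ) :
    ⟪Real.cos s • u + Real.sin s • w, Real.cos t • u + Real.sin t • w⟫ = Real.cos (s - t) := by
  have hwu : ⟪w, u⟫ = 0 := by rw [real_inner_comm, huw]
  simp only [inner_add_left, inner_add_right, real_inner_smul_left, real_inner_smul_right,
    inner_self_of_unit hu, inner_self_of_unit hw, huw, hwu, Real.cos_sub]
  ring

theorem norm_arc {u w : E3} (hu : ‖u‖ = 1) (hw : ‖w‖ = 1) (huw : ⟪u, w⟫ = 0) (t : ℝ) :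
    ‖Real.cos t • u + Real.sin t • w‖ = 1 :=
  norm_eq_one_of_inner_self (by rw [inner_arc hu hw huw, sub_self, Real.cos_zero])

theorem angle_arc {u w : E3} (hu : ‖u‖ = 1) (hw : ‖w‖ = 1) (huw : ⟪u, w⟫ = 0) {s t : ℝ}
    (hst : |s - t| ≤ Real.pi) :
    angle (Real.cos s • u + Real.sin s • w) (Real.cos t • u + Real.sin t • w) = |s - t| :=
  angle_eq_of_inner_eq_cos (norm_arc hu hw huw s) (norm_arc hu hw huw t) (abs_nonneg _) hst
    (by rw [inner_arc hu hw huw, Real.cos_abs])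

/-! ### Polar coordinates on the unit sphere -/

/-- Three orthonormal vectors of Euclidean 3-space. -/
structure IsFrame (x u w : E3) : Prop where
  norm_x : ‖x‖ = 1
  norm_u : ‖u‖ = 1
  norm_w : ‖w‖ = 1
  inner_xu : ⟪x, u⟫ = 0
  inner_xw : ⟪x, w⟫ = 0
  inner_uw : ⟪u, w⟫ = 0

namespace IsFrame

variable {x u w : E3}

theorem expansion (h : IsFrame x u w) (v : E3) :
    v = ⟪x, v⟫ • x + ⟪u, v⟫ • u + ⟪w, v⟫ • w := by
  have horth : Orthonormal ℝ ![x, u, w] := by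
    have h1 := h.inner_xu
    have h2 := h.inner_xw
    have h3 := h.inner_uw
    refine ⟨fun i => by fin_cases i <;> simp [h.norm_x, h.norm_u, h.norm_w], fun i j hij => ?_⟩
    fin_cases i <;> fin_cases j <;> first | exact absurd rfl hij | skip
    · exact h1
    · exact h2
    · exact (real_inner_comm _ _).trans h1
    · exact h3
    · exact (real_inner_comm _ _).trans h2
    · exact (real_inner_comm _ _).trans h3
  obtain ⟨b, hb⟩ := Orthonormal.exists_orthonormalBasis_extension_of_card_eq (𝕜 := ℝ)
    (v := ![x, u, w]) (s := Set.univ) (by simp) (horth.comp _ Subtype.val_injective)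
  have := (b.sum_repr' v).symm
  simpa [Fin.sum_univ_three, hb] using this

/-- The point of the unit sphere with polar coordinates `(φ, ψ)` in a frame. -/
noncomputable def _root_.SphericalGeometry.polarPoint (x u w : E3) (φ ψ : ℝ) : E3 :=
  Real.cos φ • x + Real.sin φ • (Real.cos ψ • u + Real.sin ψ • w)

theorem inner_polarPoint (h : IsFrame x u w) (φ ψ φ' ψ' : ℝ) :
    ⟪polarPoint x u w φ ψ, polarPoint x u w φ' ψ'⟫ =
      Real.cos φ * Real.cos φ' + Real.sin φ * Real.sin φ' * Real.cos (ψ - ψ') := by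
  have h1 : ⟪u, x⟫ = 0 := by rw [real_inner_comm, h.inner_xu]
  have h2 : ⟪w, x⟫ = 0 := by rw [real_inner_comm, h.inner_xw]
  have h3 : ⟪w, u⟫ = 0 := by rw [real_inner_comm, h.inner_uw]
  simp only [polarPoint, inner_add_left, inner_add_right, real_inner_smul_left,
    real_inner_smul_right, inner_self_of_unit h.norm_x, inner_self_of_unit h.norm_u,
    inner_self_of_unit h.norm_w, h.inner_xu, h.inner_xw, h.inner_uw, h1, h2, h3, Real.cos_sub]
  ring

theorem norm_polarPoint (h : IsFrame x u w) (φ ψ : ℝ) : ‖polarPoint x u w φ ψ‖ = 1 :=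
  norm_eq_one_of_inner_self (by
    rw [h.inner_polarPoint, sub_self, Real.cos_zero, mul_one, ← sq, ← sq, Real.cos_sq_add_sin_sq])

theorem inner_u_polarPoint (h : IsFrame x u w) (φ ψ : ℝ) :
    ⟪u, polarPoint x u w φ ψ⟫ = Real.sin φ * Real.cos ψ := by
  have h1 : ⟪u, x⟫ = 0 := by rw [real_inner_comm, h.inner_xu]
  simp only [polarPoint, inner_add_right, real_inner_smul_right, inner_self_of_unit h.norm_u,
    h.inner_uw, h1]
  ring

theorem inner_w_polarPoint (h : IsFrame x u w) (φ ψ : ℝ) :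
    ⟪w, polarPoint x u w φ ψ⟫ = Real.sin φ * Real.sin ψ := by
  have h1 : ⟪w, x⟫ = 0 := by rw [real_inner_comm, h.inner_xw]
  have h2 : ⟪w, u⟫ = 0 := by rw [real_inner_comm, h.inner_uw]
  simp only [polarPoint, inner_add_right, real_inner_smul_right, inner_self_of_unit h.norm_w, h2,
    h1]
  ring

theorem inner_x_polarPoint (h : IsFrame x u w) (φ ψ : ℝ) :
    ⟪x, polarPoint x u w φ ψ⟫ = Real.cos φ := by
  simp only [polarPoint, inner_add_right, real_inner_smul_right, inner_self_of_unit h.norm_x,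
    h.inner_xu, h.inner_xw]
  ring

theorem angle_x_polarPoint (h : IsFrame x u w) {φ : ℝ} (h0 : 0 ≤ φ) (hπ : φ ≤ Real.pi) (ψ : ℝ) :
    angle x (polarPoint x u w φ ψ) = φ :=
  angle_eq_of_inner_eq_cos h.norm_x (h.norm_polarPoint φ ψ) h0 hπ (h.inner_x_polarPoint φ ψ)

theorem angle_polarPoint (h : IsFrame x u w) {φ ψ φ' ψ' : ℝ} (hψ : |ψ - ψ'| ≤ Real.pi) :
    angle (polarPoint x u w φ ψ) (polarPoint x u w φ' ψ') = sectorDist φ ψ φ' ψ' := by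
  rw [angle, h.norm_polarPoint, h.norm_polarPoint, mul_one, div_one, h.inner_polarPoint,
    sectorDist, min_eq_left hψ, Real.cos_abs]

/-- Polar coordinates of a point of the sphere. -/
theorem exists_polarPoint_eq (h : IsFrame x u w) {v : E3} (hv : ‖v‖ = 1) :
    ∃ ψ, -Real.pi < ψ ∧ ψ ≤ Real.pi ∧ polarPoint x u w (angle x v) ψ = v := by
  set z : ℂ := ⟨⟪u, v⟫, ⟪w, v⟫⟩ with hz
  have hsum : ⟪x, v⟫ ^ 2 + ⟪u, v⟫ ^ 2 + ⟪w, v⟫ ^ 2 = 1 := by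
    have h1 := inner_self_of_unit hv
    have h2 : ⟪v, v⟫ = ⟪v, ⟪x, v⟫ • x + ⟪u, v⟫ • u + ⟪w, v⟫ • w⟫ := by rw [← h.expansion v]
    rw [h1] at h2
    simp only [inner_add_right, real_inner_smul_right, real_inner_comm v] at h2
    rw [real_inner_comm v x, real_inner_comm v u, real_inner_comm v w]
    linarith
  have hcos : ⟪x, v⟫ = Real.cos (angle x v) := inner_eq_cos_angle_of_norm_eq_one h.norm_x hv
  have hnz : ‖z‖ = Real.sin (angle x v) := by
    have h1 : ‖z‖ ^ 2 = Real.sin (angle x v) ^ 2 := by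
      rw [← Complex.normSq_eq_norm_sq, Complex.normSq_mk, Real.sin_sq, ← hcos]
      linarith
    exact (sq_eq_sq₀ (norm_nonneg _) (sin_angle_nonneg _ _)).1 h1
  refine ⟨z.arg, Complex.neg_pi_lt_arg z, Complex.arg_le_pi z, ?_⟩
  have hre : Real.sin (angle x v) * Real.cos z.arg = ⟪u, v⟫ := by
    rw [← hnz, Complex.norm_mul_cos_arg]
  have him : Real.sin (angle x v) * Real.sin z.arg = ⟪w, v⟫ := by
    rw [← hnz, Complex.norm_mul_sin_arg]
  rw [polarPoint, smul_add, smul_smul, smul_smul, hre, him, ← hcos, ← add_assoc]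
  exact (h.expansion v).symm

end IsFrame


/-! ### Sectors -/

theorem cos_sectorDist (φ ψ φ' ψ' : ℝ) :
    Real.cos (sectorDist φ ψ φ' ψ') = Real.cos φ * Real.cos φ' +
      Real.sin φ * Real.sin φ' * Real.cos (min |ψ - ψ'| Real.pi) := by
  have h1 := Real.cos_sub φ φ'
  have h2 := Real.cos_add φ φ'
  set k := Real.cos (min |ψ - ψ'| Real.pi)
  have hk1 : k ≤ 1 := Real.cos_le_one _
  have hk2 : -1 ≤ k := Real.neg_one_le_cos _
  have h3 := Real.cos_le_one (φ - φ')
  have h4 := Real.neg_one_le_cos (φ - φ')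
  have h5 := Real.cos_le_one (φ + φ')
  have h6 := Real.neg_one_le_cos (φ + φ')
  rw [sectorDist, Real.cos_arccos]
  · nlinarith
  · nlinarith

theorem sectorDist_vertex {φ : ℝ} (h0 : 0 ≤ φ) (hπ : φ ≤ Real.pi) (ψ ψ' : ℝ) :
    sectorDist 0 ψ' φ ψ = φ := by
  rw [sectorDist]
  simp [Real.arccos_cos h0 hπ]

/-- A small circle about `p` is seen in both sectors at the same radius, and the distance of two of
its points determines their angular separation, truncated at `π`. The ends of the `α`-arc are
separated by exactly `π α`, the truncation being harmless for `α ≤ 1`, while points of the `β`-arc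
are never separated by more than `π β`. -/
theorem sector_angle_le {X : Type*} [MetricSpace X] {bd : Set X} {p : X} {α β : ℝ} (hα : 0 < α)
    (hα1 : α ≤ 1) (hβ0 : 0 < β) (h : HasSectorNhd bd p α)
    (h' : HasSectorNhd bd p β) : α ≤ β := by
  have hpi := Real.pi_pos
  obtain ⟨r, hr, hrπ, F, hF0, hFd, -, -⟩ := h
  obtain ⟨r', hr', hrπ', F', hF0', hFd', hFs', -⟩ := h'
  obtain ⟨s, hs0, hsr, hsr'⟩ : ∃ s, 0 < s ∧ s < r ∧ s < r' :=
    ⟨min r r' / 2, by positivity, by linarith [min_le_left r r', lt_min hr hr'],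
      by linarith [min_le_right r r', lt_min hr hr']⟩
  have hsmem : s ∈ Set.Ico 0 r := ⟨hs0.le, hsr⟩
  have h0mem : (0 : ℝ) ∈ Set.Ico 0 r := ⟨le_rfl, hr⟩
  have h0mem' : (0 : ℝ) ∈ Set.Ico 0 r' := ⟨le_rfl, hr'⟩
  have hπα : 0 < Real.pi * α := by positivity
  have hπβ : 0 < Real.pi * β := by positivity
  have ha0 : (0 : ℝ) ∈ Set.Icc 0 (Real.pi * α) := ⟨le_rfl, hπα.le⟩
  have ha1 : Real.pi * α ∈ Set.Icc 0 (Real.pi * α) := ⟨hπα.le, le_rfl⟩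
  have hb0 : (0 : ℝ) ∈ Set.Icc 0 (Real.pi * β) := ⟨le_rfl, hπβ.le⟩
  have key : ∀ ψ ∈ Set.Icc 0 (Real.pi * α), ∃ ψ' ∈ Set.Icc 0 (Real.pi * β),
      F' s ψ' = F s ψ := by
    intro ψ hψ
    have hd : dist p (F s ψ) = s := by
      rw [← hF0, hFd 0 h0mem 0 ha0 s hsmem ψ hψ, sectorDist_vertex hs0.le (by linarith)]
    obtain ⟨φ, hφ, ψ', hψ', he⟩ := hFs' (F s ψ) (by rw [Metric.mem_ball, dist_comm, hd]; exact hsr')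
    have : φ = s := by
      rw [← hd, ← he, ← hF0', hFd' 0 h0mem' 0 hb0 φ hφ ψ' hψ',
        sectorDist_vertex hφ.1 (by linarith [hφ.2])]
    exact ⟨ψ', hψ', this ▸ he⟩
  obtain ⟨a, ha, hFa⟩ := key 0 ha0
  obtain ⟨b, hb, hFb⟩ := key _ ha1
  have h1 := hFd s hsmem 0 ha0 s hsmem _ ha1
  rw [← hFa, ← hFb, hFd' s ⟨hs0.le, hsr'⟩ a ha s ⟨hs0.le, hsr'⟩ b hb] at h1
  have h2 := congrArg Real.cos h1
  rw [cos_sectorDist, cos_sectorDist] at h2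
  have hsin : 0 < Real.sin s := Real.sin_pos_of_pos_of_lt_pi hs0 (by linarith)
  have h3 : Real.cos (min |a - b| Real.pi) = Real.cos (min |0 - Real.pi * α| Real.pi) := by
    have : Real.sin s * Real.sin s ≠ 0 := by positivity
    exact mul_left_cancel₀ this (add_left_cancel h2)
  have h4 := Real.injOn_cos (x₁ := min |a - b| Real.pi) (x₂ := min |0 - Real.pi * α| Real.pi)
    ⟨le_min (abs_nonneg _) hpi.le, min_le_right _ _⟩
    ⟨le_min (abs_nonneg _) hpi.le, min_le_right _ _⟩ h3
  have h5 : min |0 - Real.pi * α| Real.pi = Real.pi * α := by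
    rw [zero_sub, abs_neg, abs_of_pos hπα, min_eq_left]
    nlinarith
  have h6 : |a - b| ≤ Real.pi * β := by
    rw [abs_le]; constructor <;> linarith [ha.1, ha.2, hb.1, hb.2]
  have h7 : Real.pi * α ≤ Real.pi * β := by
    rw [← h5, ← h4]
    exact (min_le_left _ _).trans h6
  exact le_of_mul_le_mul_left h7 hpi

/-- The angle of a convex sector is determined by the germ of the metric. -/
theorem sector_angle_unique {X : Type*} [MetricSpace X] {bd : Set X} {p : X} {α β : ℝ}
    (hα : 0 < α) (hα1 : α ≤ 1) (hβ : 0 < β) (hβ1 : β ≤ 1) (h : HasSectorNhd bd p α)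
    (h' : HasSectorNhd bd p β) : α = β :=
  le_antisymm (sector_angle_le hα hα1 hβ h h') (sector_angle_le hβ hβ1 hα h' h)

/-- A subset of the sphere which is a wedge near one of its points has a sector neighbourhood. -/
theorem hasSectorNhd_of_frame {X : Type*} [MetricSpace X] {bd : Set X} {e : X → E3}
    (he : ∀ p, ‖e p‖ = 1) (hd : ∀ p q, angle (e p) (e q) = dist p q) {p : X} {u w : E3}
    (hf : IsFrame (e p) u w) {α : ℝ} (hα : 0 < α) (hα1 : α ≤ 1) {r : ℝ} (hr : 0 < r)
    (hsurj : ∀ v, ‖v‖ = 1 → angle (e p) v < r → 0 ≤ ⟪w, v⟫ →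
      0 ≤ Real.sin (Real.pi * α) * ⟪u, v⟫ - Real.cos (Real.pi * α) * ⟪w, v⟫ → ∃ q, e q = v)
    (hmem : ∀ q, dist p q < r → 0 ≤ ⟪w, e q⟫ ∧
      0 ≤ Real.sin (Real.pi * α) * ⟪u, e q⟫ - Real.cos (Real.pi * α) * ⟪w, e q⟫)
    (hbd : ∀ q, dist p q < r → (q ∈ bd ↔ ⟪w, e q⟫ = 0 ∨
      Real.sin (Real.pi * α) * ⟪u, e q⟫ - Real.cos (Real.pi * α) * ⟪w, e q⟫ = 0)) :
    HasSectorNhd bd p α := by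
  have hpi := Real.pi_pos
  have hinj : ∀ q q', e q = e q' → q = q' := by
    intro q q' h
    rw [← dist_eq_zero, ← hd, h, angle_self]
    intro h0
    have := he q'
    rw [h0] at this
    simp at this
  have hπα : 0 < Real.pi * α := by positivity
  have hπα1 : Real.pi * α ≤ Real.pi := by nlinarith
  have : Nonempty X := ⟨p⟩
  set F : ℝ → ℝ → X := fun φ ψ => Function.invFun e (polarPoint (e p) u w φ ψ) with hF
  -- The second half-space of the wedge is the one bounded by the ray `ψ = π α`: in polar
  -- coordinates its equation becomes the sign of `sin (π α - ψ)`.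
  have hsec : ∀ φ ψ, Real.sin (Real.pi * α) * ⟪u, polarPoint (e p) u w φ ψ⟫ -
      Real.cos (Real.pi * α) * ⟪w, polarPoint (e p) u w φ ψ⟫ =
        Real.sin φ * Real.sin (Real.pi * α - ψ) := by
    intro φ ψ
    rw [hf.inner_u_polarPoint, hf.inner_w_polarPoint, Real.sin_sub]
    ring
  have hsinφ : ∀ φ ∈ Set.Ico 0 (min r (Real.pi / 2)), 0 ≤ Real.sin φ := fun φ hφ =>
    Real.sin_nonneg_of_nonneg_of_le_pi hφ.1 (by linarith [hφ.2, min_le_right r (Real.pi / 2)])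
  have heF : ∀ φ ∈ Set.Ico 0 (min r (Real.pi / 2)), ∀ ψ ∈ Set.Icc 0 (Real.pi * α),
      e (F φ ψ) = polarPoint (e p) u w φ ψ := by
    intro φ hφ ψ hψ
    apply Function.invFun_eq
    apply hsurj _ (hf.norm_polarPoint φ ψ)
    · rw [hf.angle_x_polarPoint hφ.1 (by linarith [hφ.2, min_le_right r (Real.pi / 2)])]
      exact lt_of_lt_of_le hφ.2 (min_le_left _ _)
    · rw [hf.inner_w_polarPoint]
      exact mul_nonneg (hsinφ φ hφ)
        (Real.sin_nonneg_of_nonneg_of_le_pi hψ.1 (hψ.2.trans hπα1))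
    · rw [hsec]
      exact mul_nonneg (hsinφ φ hφ) (Real.sin_nonneg_of_nonneg_of_le_pi (by linarith [hψ.2])
        (by linarith [hψ.1]))
  have h00 : F 0 0 = p := by
    apply hinj
    rw [heF 0 ⟨le_rfl, by positivity⟩ 0 ⟨le_rfl, hπα.le⟩]
    simp [polarPoint]
  have habs : ∀ ψ ∈ Set.Icc 0 (Real.pi * α), ∀ ψ' ∈ Set.Icc 0 (Real.pi * α),
      |ψ - ψ'| ≤ Real.pi := by
    intro ψ hψ ψ' hψ'
    rw [abs_le]; constructor <;> linarith [hψ.1, hψ.2, hψ'.1, hψ'.2]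
  refine ⟨min r (Real.pi / 2), by positivity, min_le_right _ _, F, h00, ?_, ?_, ?_⟩
  · intro φ hφ ψ hψ φ' hφ' ψ' hψ'
    rw [← hd, heF φ hφ ψ hψ, heF φ' hφ' ψ' hψ', hf.angle_polarPoint (habs ψ hψ ψ' hψ')]
  · intro q hq
    rw [Metric.mem_ball, dist_comm] at hq
    have hqr : dist p q < r := lt_of_lt_of_le hq (min_le_left _ _)
    obtain ⟨ψ, hψ1, hψ2, hψ⟩ := hf.exists_polarPoint_eq (he q)
    rw [hd] at hψ
    rcases eq_or_lt_of_le (dist_nonneg (x := p) (y := q)) with h0 | h0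
    · refine ⟨0, ⟨le_rfl, by positivity⟩, 0, ⟨le_rfl, hπα.le⟩, ?_⟩
      rw [h00]
      exact dist_eq_zero.1 h0.symm
    · have hsin : 0 < Real.sin (dist p q) := Real.sin_pos_of_pos_of_lt_pi h0
        (by linarith [min_le_right r (Real.pi / 2)])
      obtain ⟨h1, h2⟩ := hmem q hqr
      rw [← hψ, hf.inner_w_polarPoint] at h1
      rw [← hψ, hsec] at h2
      have h1' := nonneg_of_mul_nonneg_right h1 hsin
      have h2' := nonneg_of_mul_nonneg_right h2 hsin
      have hψ0 : 0 ≤ ψ := by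
        by_contra! h
        linarith [Real.sin_neg_of_neg_of_neg_pi_lt h hψ1]
      have hψα : ψ ≤ Real.pi * α := by
        by_contra! h
        linarith [Real.sin_neg_of_neg_of_neg_pi_lt (x := Real.pi * α - ψ) (by linarith)
          (by linarith)]
      refine ⟨dist p q, ⟨dist_nonneg, hq⟩, ψ, ⟨hψ0, hψα⟩, hinj _ _ ?_⟩
      rw [heF _ ⟨dist_nonneg, hq⟩ _ ⟨hψ0, hψα⟩, hψ]
  · intro φ hφ ψ hψ
    have hdφ : dist p (F φ ψ) = φ := by
      rw [← hd, heF φ hφ ψ hψ, hf.angle_x_polarPoint hφ.1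
        (by linarith [hφ.2, min_le_right r (Real.pi / 2)])]
    rw [hbd _ (by rw [hdφ]; exact lt_of_lt_of_le hφ.2 (min_le_left _ _)), heF φ hφ ψ hψ, hsec,
      hf.inner_w_polarPoint]
    have hφπ : φ < Real.pi := by linarith [hφ.2, min_le_right r (Real.pi / 2)]
    constructor
    · intro h
      by_cases hφ0 : φ = 0
      · exact Or.inl hφ0
      have hs : 0 < Real.sin φ :=
        Real.sin_pos_of_pos_of_lt_pi (lt_of_le_of_ne hφ.1 (Ne.symm hφ0)) hφπ
      by_contra! hcon
      obtain ⟨-, hc1, hc2⟩ := hcon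
      have hψ0 : 0 < ψ := lt_of_le_of_ne hψ.1 (Ne.symm hc1)
      have hψ1 : ψ < Real.pi * α := lt_of_le_of_ne hψ.2 hc2
      have h1 : 0 < Real.sin ψ := Real.sin_pos_of_pos_of_lt_pi hψ0 (by linarith)
      have h2 : 0 < Real.sin (Real.pi * α - ψ) :=
        Real.sin_pos_of_pos_of_lt_pi (by linarith) (by linarith)
      rcases h with h | h
      · exact (mul_pos hs h1).ne' h
      · exact (mul_pos hs h2).ne' h
    · rintro (rfl | rfl | rfl) <;> simp

/-! ### Spherical triangles cut out by three half-spaces -/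

theorem norm_sub_le_angle {x v : E3} (hx : ‖x‖ = 1) (hv : ‖v‖ = 1) : ‖v - x‖ ≤ angle x v := by
  have h0 := angle_nonneg x v
  have h1 := Real.one_sub_sq_div_two_le_cos (x := angle x v)
  have h2 : ‖v - x‖ ^ 2 = 2 - 2 * Real.cos (angle x v) := by
    rw [norm_sub_sq_real, hx, hv, real_inner_comm, inner_eq_cos_angle_of_norm_eq_one hx hv]
    ring
  nlinarith [norm_nonneg (v - x)]

/-- Pairing with a unit vector is 1-Lipschitz for the angular distance, since a chord is no longer
than its arc. So an inequality `⟪n, x⟫ > 0` persists on the angular ball of radius `⟪n, x⟫`, which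
is how all chart radii below are chosen. -/
theorem inner_sub_angle_le {n x v : E3} (hn : ‖n‖ = 1) (hx : ‖x‖ = 1) (hv : ‖v‖ = 1) :
    ⟪n, x⟫ - angle x v ≤ ⟪n, v⟫ := by
  have h1 := norm_sub_le_angle hx hv
  have h2 := abs_real_inner_le_norm n (v - x)
  rw [hn, one_mul, inner_sub_right] at h2
  linarith [neg_abs_le (⟪n, v⟫ - ⟪n, x⟫)]

/-- On an arc shorter than `π`, an intermediate point is a nonnegative combination of the endpoints,
with weights `sin (θ - s) / sin θ` and `sin s / sin θ`. -/
theorem nonneg_on_arc {n u w : E3} {s θ : ℝ} (hs : 0 ≤ s) (hsθ : s ≤ θ) (hθ : θ < Real.pi)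
    (h0 : 0 ≤ ⟪n, u⟫) (h1 : 0 ≤ ⟪n, Real.cos θ • u + Real.sin θ • w⟫) :
    0 ≤ ⟪n, Real.cos s • u + Real.sin s • w⟫ := by
  rcases eq_or_lt_of_le (hs.trans hsθ) with h | h
  · have : s = 0 := by linarith
    simpa [this] using h0
  · have hsin : 0 < Real.sin θ := Real.sin_pos_of_pos_of_lt_pi h hθ
    rw [inner_add_right, real_inner_smul_right, real_inner_smul_right] at h1 ⊢
    have h2 : 0 ≤ Real.sin (θ - s) := Real.sin_nonneg_of_nonneg_of_le_pi (by linarith)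
      (by linarith)
    have h3 : 0 ≤ Real.sin s := Real.sin_nonneg_of_nonneg_of_le_pi hs (by linarith)
    have h4 : Real.sin θ * (Real.cos s * ⟪n, u⟫ + Real.sin s * ⟪n, w⟫) =
        Real.sin (θ - s) * ⟪n, u⟫ +
          Real.sin s * (Real.cos θ * ⟪n, u⟫ + Real.sin θ * ⟪n, w⟫) := by
      rw [Real.sin_sub]; ring
    refine nonneg_of_mul_nonneg_right ?_ hsin
    rw [h4]
    positivity

theorem pos_on_arc {n u w : E3} {s θ : ℝ} (hs : 0 ≤ s) (hsθ : s ≤ θ) (hθ : θ < Real.pi)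
    (h0 : 0 < ⟪n, u⟫) (h1 : 0 < ⟪n, Real.cos θ • u + Real.sin θ • w⟫) :
    0 < ⟪n, Real.cos s • u + Real.sin s • w⟫ := by
  rcases eq_or_lt_of_le hs with h | h
  · simpa [← h] using h0
  · have hsin : 0 < Real.sin θ := Real.sin_pos_of_pos_of_lt_pi (h.trans_le hsθ) hθ
    rw [inner_add_right, real_inner_smul_right, real_inner_smul_right] at h1 ⊢
    have h2 : 0 ≤ Real.sin (θ - s) := Real.sin_nonneg_of_nonneg_of_le_pi (by linarith)
      (by linarith)
    have h3 : 0 < Real.sin s := Real.sin_pos_of_pos_of_lt_pi h (by linarith)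
    have h4 : Real.sin θ * (Real.cos s * ⟪n, u⟫ + Real.sin s * ⟪n, w⟫) =
        Real.sin (θ - s) * ⟪n, u⟫ +
          Real.sin s * (Real.cos θ * ⟪n, u⟫ + Real.sin θ * ⟪n, w⟫) := by
      rw [Real.sin_sub]; ring
    refine pos_of_mul_pos_right ?_ hsin.le
    rw [h4]
    positivity

theorem exists_ne_ne (i k : Fin 3) : ∃ j, j ≠ i ∧ j ≠ k := by decide +revert

theorem eq_or_eq_or_eq {i j k : Fin 3} (hij : i ≠ j) (hik : i ≠ k) (hjk : j ≠ k) (l : Fin 3) :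
    l = i ∨ l = j ∨ l = k := by decide +revert

/-- An isometry `e` of `X` onto the spherical triangle cut out by the half-spaces with inward unit
normals `n i`; the side opposite to the vertex `i` lies in the plane orthogonal to `n i`. -/
structure IsTriangleModel {X : Type*} [MetricSpace X] (bd : Set X) (vert : Fin 3 → X)
    (n : Fin 3 → E3) (e : X → E3) : Prop where
  norm_normal : ∀ i, ‖n i‖ = 1
  linearIndependent : LinearIndependent ℝ n
  norm_map : ∀ p, ‖e p‖ = 1
  angle_map : ∀ p q, angle (e p) (e q) = dist p q
  nonneg : ∀ p i, 0 ≤ ⟪n i, e p⟫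
  surj : ∀ v, ‖v‖ = 1 → (∀ i, 0 ≤ ⟪n i, v⟫) → ∃ p, e p = v
  mem_bd : ∀ p, p ∈ bd ↔ ∃ i, ⟪n i, e p⟫ = 0
  inner_vert : ∀ i j, j ≠ i → ⟪n j, e (vert i)⟫ = 0

theorem eq_zero_of_inner_normals {n : Fin 3 → E3} (hn : LinearIndependent ℝ n) {v : E3}
    (h : ∀ i, ⟪n i, v⟫ = 0) : v = 0 := by
  apply eq_of_inner_eq_on_span (S := Set.range n)
  · exact hn.span_eq_top_of_card_eq_finrank (by simp)
  · rintro _ ⟨i, rfl⟩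
    rw [h, inner_zero_right]

namespace IsTriangleModel

variable {X : Type*} [MetricSpace X] {bd : Set X} {vert : Fin 3 → X} {n : Fin 3 → E3} {e : X → E3}

theorem injective (h : IsTriangleModel bd vert n e) : Function.Injective e := by
  intro q q' hq
  rw [← dist_eq_zero, ← h.angle_map, hq, angle_self]
  intro h0
  have := h.norm_map q'
  rw [h0] at this
  simp at this

/-- Two antipodal points satisfying the same three inequalities would be orthogonal to all normals,
hence zero. -/
theorem dist_lt_pi (h : IsTriangleModel bd vert n e) (p q : X) : dist p q < Real.pi := by
  rw [← h.angle_map]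
  refine lt_of_le_of_ne (angle_le_pi _ _) fun hπ => ?_
  obtain ⟨h0, r, hr, hq⟩ := angle_eq_pi_iff.1 hπ
  apply h0
  apply eq_zero_of_inner_normals h.linearIndependent
  intro i
  have h1 := h.nonneg p i
  have h2 := h.nonneg q i
  rw [hq, real_inner_smul_right] at h2
  nlinarith

theorem inner_vert_pos (h : IsTriangleModel bd vert n e) (i : Fin 3) : 0 < ⟪n i, e (vert i)⟫ := by
  refine lt_of_le_of_ne (h.nonneg _ _) fun h0 => ?_
  have : e (vert i) = 0 := by
    apply eq_zero_of_inner_normals h.linearIndependent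
    intro j
    by_cases hij : j = i
    · rw [hij, ← h0]
    · exact h.inner_vert i j hij
  have h1 := h.norm_map (vert i)
  rw [this] at h1
  simp at h1

theorem exists_chart (h : IsTriangleModel bd vert n e) {p : X} (hp : p ∉ bd) :
    ∃ r, IsSphericalChartAt e p r := by
  have hpos : ∀ i, 0 < ⟪n i, e p⟫ := fun i =>
    lt_of_le_of_ne (h.nonneg p i) fun h0 => hp ((h.mem_bd p).2 ⟨i, h0.symm⟩)
  obtain ⟨r, hr, hri⟩ : ∃ r, 0 < r ∧ ∀ i, r ≤ ⟪n i, e p⟫ := by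
    obtain ⟨i, -, hi⟩ := Finset.exists_min_image Finset.univ (fun i => ⟪n i, e p⟫)
      ⟨0, Finset.mem_univ _⟩
    exact ⟨_, hpos i, fun j => hi j (Finset.mem_univ j)⟩
  refine ⟨r, hr, fun q _ => h.norm_map q, fun q _ q' _ => h.angle_map q q', fun v hv hvr => ?_⟩
  obtain ⟨q, hq⟩ := h.surj v hv fun i => by
    have := inner_sub_angle_le (h.norm_normal i) (h.norm_map p) hv
    linarith [hri i]
  refine ⟨q, ?_, hq⟩
  rw [Metric.mem_ball, dist_comm, ← h.angle_map, hq]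
  exact hvr

theorem hasSectorNhd_edge (h : IsTriangleModel bd vert n e) {p : X} (hp : p ∈ bd)
    (hv : p ∉ Set.range vert) : HasSectorNhd bd p 1 := by
  obtain ⟨k, hk⟩ := (h.mem_bd p).1 hp
  have hpos : ∀ i, i ≠ k → 0 < ⟪n i, e p⟫ := by
    intro i hik
    refine lt_of_le_of_ne (h.nonneg p i) fun h0 => hv ?_
    obtain ⟨j, hji, hjk⟩ := exists_ne_ne i k
    refine ⟨j, h.injective ?_⟩
    have hall : ∀ l, l ≠ j → ⟪n l, e p⟫ = 0 := by
      intro l hl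
      rcases eq_or_eq_or_eq hji hjk hik l with rfl | rfl | rfl
      · exact absurd rfl hl
      · exact h0.symm
      · exact hk
    have hvj := h.inner_vert_pos j
    -- A point lying on two sides has vanishing products with the same two normals as their common
    -- vertex, so the two vectors are proportional, and equal after comparing norms.
    have hz : ⟪n j, e p⟫ • e (vert j) - ⟪n j, e (vert j)⟫ • e p = 0 := by
      apply eq_zero_of_inner_normals h.linearIndependent
      intro l
      rw [inner_sub_right, real_inner_smul_right, real_inner_smul_right]
      by_cases hl : l = j
      · rw [hl]; ring
      · rw [hall l hl, h.inner_vert j l hl]; ring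
    rw [sub_eq_zero] at hz
    have hnn := congrArg (fun z : E3 => ‖z‖) hz
    simp only [norm_smul, h.norm_map, Real.norm_eq_abs, abs_of_nonneg (h.nonneg _ _),
      mul_one] at hnn
    rw [hnn] at hz
    exact smul_right_injective E3 hvj.ne' hz
  obtain ⟨u, hu, hxu, hwu⟩ := exists_unit_orthogonal (e p) (n k)
  have hf : IsFrame (e p) u (n k) := ⟨h.norm_map p, hu, h.norm_normal k, hxu,
    (real_inner_comm _ _).trans hk, (real_inner_comm _ _).trans hwu⟩
  obtain ⟨r, hr, hri⟩ : ∃ r, 0 < r ∧ ∀ i, i ≠ k → r ≤ ⟪n i, e p⟫ := by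
    have hne : (Finset.univ.filter fun i : Fin 3 => i ≠ k).Nonempty := by
      obtain ⟨j, hj, -⟩ := exists_ne_ne k k
      exact ⟨j, by simpa using hj⟩
    obtain ⟨i, hi0, hi⟩ := Finset.exists_min_image _ (fun i => ⟪n i, e p⟫) hne
    exact ⟨_, hpos i (Finset.mem_filter.1 hi0).2, fun j hj =>
      hi j (Finset.mem_filter.2 ⟨Finset.mem_univ j, hj⟩)⟩
  have hloc : ∀ v, ‖v‖ = 1 → angle (e p) v < r → ∀ i, i ≠ k → 0 < ⟪n i, v⟫ := by
    intro v hv hvr i hi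
    have := inner_sub_angle_le (h.norm_normal i) (h.norm_map p) hv
    linarith [hri i hi]
  -- For `α = 1` the two half-spaces of the wedge coincide, so only the inequality for `n k`
  -- remains.
  refine hasSectorNhd_of_frame h.norm_map h.angle_map hf one_pos le_rfl hr ?_ ?_ ?_
  · intro v hv hvr hw _
    apply h.surj v hv
    intro i
    by_cases hi : i = k
    · rw [hi]; exact hw
    · exact (hloc v hv hvr i hi).le
  · intro q _
    simp [h.nonneg]
  · intro q hq
    rw [h.mem_bd]
    simp only [mul_one, Real.sin_pi, Real.cos_pi, zero_mul, zero_sub, neg_mul, one_mul, neg_neg,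
      or_self]
    constructor
    · rintro ⟨i, hi⟩
      by_cases hik : i = k
      · rw [← hik]; exact hi
      · exact absurd hi (hloc _ (h.norm_map q) (by rw [h.angle_map]; exact hq) i hik).ne'
    · exact fun hk => ⟨k, hk⟩

theorem abs_inner_normals_lt (hn1 : ∀ i, ‖n i‖ = 1) (hn : LinearIndependent ℝ n) {j k : Fin 3}
    (hjk : j ≠ k) : -1 < -⟪n j, n k⟫ ∧ -⟪n j, n k⟫ < 1 := by
  have h1 : ⟪n j, n k⟫ ≠ 1 := by
    intro h1
    exact hjk (hn.injective ((inner_eq_one_iff_of_norm_eq_one (hn1 j) (hn1 k)).1 h1))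
  have h2 : ⟪n j, n k⟫ ≠ -1 := by
    intro h2
    rw [inner_eq_neg_one_iff_of_norm_eq_one (hn1 j) (hn1 k)] at h2
    have hp := Fintype.linearIndependent_iff.1 hn (Pi.single j 1 + Pi.single k 1) (by
      simp [add_smul, Finset.sum_add_distrib, Pi.single_apply, ite_smul, h2]) j
    simp [hjk] at hp
  have h3 := abs_le.1 (abs_real_inner_le_norm (n j) (n k))
  rw [hn1, hn1, mul_one] at h3
  constructor
  · have := lt_of_le_of_ne h3.2 h1; linarith
  · have := lt_of_le_of_ne h3.1 (Ne.symm h2); linarith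

theorem hasSectorNhd_vert (h : IsTriangleModel bd vert n e) {i j k : Fin 3} (hij : i ≠ j)
    (hik : i ≠ k) (hjk : j ≠ k) {α : ℝ} (hα0 : 0 < α) (hα1 : α ≤ 1)
    (hα : ⟪n j, n k⟫ = -Real.cos (Real.pi * α)) : HasSectorNhd bd (vert i) α := by
  have hpi := Real.pi_pos
  have hαlt : α < 1 := by
    refine lt_of_le_of_ne hα1 fun h1 => ?_
    have := (abs_inner_normals_lt h.norm_normal h.linearIndependent hjk).1
    rw [hα, h1] at this
    simp at this
  have hsin : 0 < Real.sin (Real.pi * α) :=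
    Real.sin_pos_of_pos_of_lt_pi (by positivity) (by nlinarith)
  -- The tangent direction at the vertex along the side with normal `n k`. It is chosen so that `n
  -- j` becomes `sin (π α) u - cos (π α) n k`, the normal of the ray `ψ = π α` in the frame `(u, n
  -- k)`.
  set u : E3 := (Real.sin (Real.pi * α))⁻¹ • (n j + Real.cos (Real.pi * α) • n k) with hu
  have hsu : n j = Real.sin (Real.pi * α) • u - Real.cos (Real.pi * α) • n k := by
    rw [hu, smul_smul, mul_inv_cancel₀ hsin.ne', one_smul]; abel
  have hkk := inner_self_of_unit (h.norm_normal k)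
  have hjj := inner_self_of_unit (h.norm_normal j)
  have hxj := h.inner_vert i j hij.symm
  have hxk := h.inner_vert i k hik.symm
  have hf : IsFrame (e (vert i)) u (n k) := by
    refine ⟨h.norm_map _, ?_, h.norm_normal k, ?_, (real_inner_comm _ _).trans hxk, ?_⟩
    · apply norm_eq_one_of_inner_self
      rw [hu]
      simp only [inner_add_left, inner_add_right, real_inner_smul_left, real_inner_smul_right,
        hkk, hjj, real_inner_comm (n j) (n k), hα]
      have := Real.sin_sq_add_cos_sq (Real.pi * α)
      field_simp
      linarith
    · rw [hu, real_inner_smul_right, inner_add_right, real_inner_smul_right,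
        real_inner_comm, hxj, real_inner_comm, hxk]; ring
    · rw [hu, real_inner_smul_left, inner_add_left, real_inner_smul_left, hkk, hα]; ring
  have hnj : ∀ v, ⟪n j, v⟫ =
      Real.sin (Real.pi * α) * ⟪u, v⟫ - Real.cos (Real.pi * α) * ⟪n k, v⟫ := by
    intro v
    rw [← real_inner_smul_left, ← real_inner_smul_left, ← inner_sub_left, ← hsu]
  have hcases := eq_or_eq_or_eq hij hik hjk
  have hri := h.inner_vert_pos i
  have hloc : ∀ v, ‖v‖ = 1 → angle (e (vert i)) v < ⟪n i, e (vert i)⟫ → 0 < ⟪n i, v⟫ := by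
    intro v hv hvr
    have := inner_sub_angle_le (h.norm_normal i) (h.norm_map (vert i)) hv
    linarith
  refine hasSectorNhd_of_frame h.norm_map h.angle_map hf hα0 hα1 hri ?_ ?_ ?_
  · intro v hv hvr hw hw'
    apply h.surj v hv
    intro l
    rcases hcases l with rfl | rfl | rfl
    · exact (hloc v hv hvr).le
    · rw [hnj]; exact hw'
    · exact hw
  · intro q _
    rw [← hnj]
    exact ⟨h.nonneg _ _, h.nonneg _ _⟩
  · intro q hq
    rw [h.mem_bd, ← hnj]
    constructor
    · rintro ⟨l, hl⟩
      rcases hcases l with rfl | rfl | rfl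
      · exact absurd hl (hloc _ (h.norm_map q) (by rw [h.angle_map]; exact hq)).ne'
      · exact Or.inr hl
      · exact Or.inl hl
    · rintro (hl | hl)
      · exact ⟨k, hl⟩
      · exact ⟨j, hl⟩

/-- Great circle arcs between points of the triangle stay in it and pull back through `e`. The
positivity clause is there to keep paths off prescribed sides when loops in the double are built. -/
theorem exists_geodesic (h : IsTriangleModel bd vert n e) (p q : X) :
    ∃ c : ℝ → X, c 0 = p ∧ c 1 = q ∧ LipschitzOnWith (dist p q).toNNReal c (Set.Icc 0 1) ∧
      ∀ i, 0 < ⟪n i, e p⟫ → 0 < ⟪n i, e q⟫ → ∀ t ∈ Set.Icc (0 : ℝ) 1, 0 < ⟪n i, e (c t)⟫ := by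
  have : Nonempty X := ⟨p⟩
  obtain ⟨w, hw, huw, hq⟩ := exists_arc (h.norm_map p) (h.norm_map q)
  rw [h.angle_map] at hq
  set θ := dist p q with hθ
  have hθ0 : 0 ≤ θ := dist_nonneg
  have hθπ : θ < Real.pi := h.dist_lt_pi p q
  set c : ℝ → X := fun t => Function.invFun e
    (Real.cos (t * θ) • e p + Real.sin (t * θ) • w) with hc
  have hec : ∀ t ∈ Set.Icc (0 : ℝ) 1,
      e (c t) = Real.cos (t * θ) • e p + Real.sin (t * θ) • w := by
    intro t ht
    apply Function.invFun_eq
    apply h.surj _ (norm_arc (h.norm_map p) hw huw _)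
    intro i
    refine nonneg_on_arc (mul_nonneg ht.1 hθ0) (mul_le_of_le_one_left hθ0 ht.2) hθπ
      (h.nonneg p i) ?_
    rw [← hq]
    exact h.nonneg q i
  have hdc : ∀ s ∈ Set.Icc (0 : ℝ) 1, ∀ t ∈ Set.Icc (0 : ℝ) 1,
      dist (c s) (c t) = θ * |s - t| := by
    intro s hs t ht
    have hab : |s * θ - t * θ| = θ * |s - t| := by
      rw [← sub_mul, abs_mul, abs_of_nonneg hθ0, mul_comm]
    have hst : |s - t| ≤ 1 := by
      rw [abs_le]; constructor <;> linarith [hs.1, hs.2, ht.1, ht.2]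
    rw [← h.angle_map, hec s hs, hec t ht, angle_arc (h.norm_map p) hw huw, hab]
    rw [hab]
    nlinarith
  have hlip : LipschitzOnWith θ.toNNReal c (Set.Icc 0 1) := by
    apply LipschitzOnWith.of_dist_le_mul
    intro s hs t ht
    rw [hdc s hs t ht, Real.coe_toNNReal _ hθ0, Real.dist_eq]
  have hc0 : c 0 = p := h.injective (by rw [hec 0 (by simp)]; simp)
  have hc1 : c 1 = q := h.injective (by rw [hec 1 (by simp), one_mul, ← hq])
  refine ⟨c, hc0, hc1, hlip, fun i hpi hqi t ht => ?_⟩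
  rw [hec t ht]
  refine pos_on_arc (mul_nonneg ht.1 hθ0) (mul_le_of_le_one_left hθ0 ht.2) hθπ hpi ?_
  rw [← hq]
  exact hqi

theorem isLengthSpace (h : IsTriangleModel bd vert n e) : IsLengthSpace X := by
  intro p q ε hε
  obtain ⟨c, hc0, hc1, hlip, -⟩ := h.exists_geodesic p q
  refine ⟨⟨⟨fun t => c t, ?_⟩, by simpa using hc0, by simpa using hc1⟩, ?_⟩
  · exact hlip.continuousOn.comp_continuous continuous_subtype_val fun t => t.2
  · change eVariationOn (c ∘ ((↑) : unitInterval → ℝ)) Set.univ ≤ _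
    refine (hlip.comp_eVariationOn_le (g := ((↑) : unitInterval → ℝ)) fun t _ => t.2).trans ?_
    have hmono : MonotoneOn ((↑) : unitInterval → ℝ) Set.univ := fun a _ b _ hab => hab
    have hvar : eVariationOn ((↑) : unitInterval → ℝ) Set.univ ≤ ENNReal.ofReal 1 := by
      have := hmono.eVariationOn_eq (a := 0) (b := 1) (Set.mem_univ _) (Set.mem_univ _)
      have h01 : (Set.univ ∩ Set.Icc (0 : unitInterval) 1) = Set.univ := by
        ext t; simp [unitInterval.le_one']
      rw [h01] at this
      simp [this]
    calc ((dist p q).toNNReal : ENNReal) * eVariationOn ((↑) : unitInterval → ℝ) Set.univ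
        ≤ ((dist p q).toNNReal : ENNReal) * ENNReal.ofReal 1 := by gcongr
      _ = ENNReal.ofReal (dist p q) := by simp [ENNReal.ofReal]
      _ ≤ ENNReal.ofReal (dist p q + ε) := ENNReal.ofReal_le_ofReal (by linarith)

end IsTriangleModel


/-! ### Developing maps -/

/-- Near `p`, the map `e` is an isometry onto a full-dimensional subset of the unit sphere. -/
def IsDevelopingAt {X : Type*} [MetricSpace X] (e : X → E3) (p : X) : Prop :=
  (∃ r > 0, ∀ q ∈ Metric.ball p r, ∀ q' ∈ Metric.ball p r, ⟪e q, e q'⟫ = Real.cos (dist q q')) ∧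
    ∀ r > 0, Submodule.span ℝ (e '' Metric.ball p r) = ⊤

theorem IsFrame.eq_top {x u w : E3} (h : IsFrame x u w) {S : Submodule ℝ E3} {s ψ : ℝ}
    (hs : Real.sin s ≠ 0) (hψ : Real.sin ψ ≠ 0) (h0 : x ∈ S) (h1 : polarPoint x u w s 0 ∈ S)
    (h2 : polarPoint x u w s ψ ∈ S) : S = ⊤ := by
  have hu : u ∈ S := by
    have := S.smul_mem (Real.sin s)⁻¹ (S.sub_mem h1 (S.smul_mem (Real.cos s) h0))
    simpa [polarPoint, smul_smul, inv_mul_cancel₀ hs] using this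
  have hw : w ∈ S := by
    have h3 : Real.sin s • Real.sin ψ • w ∈ S := by
      have := S.sub_mem (S.sub_mem h2 (S.smul_mem (Real.cos s) h0))
        (S.smul_mem (Real.sin s * Real.cos ψ) hu)
      convert this using 1
      simp only [polarPoint, smul_add, mul_smul]
      abel
    have := S.smul_mem (Real.sin ψ)⁻¹ (S.smul_mem (Real.sin s)⁻¹ h3)
    rwa [smul_smul (Real.sin s)⁻¹, inv_mul_cancel₀ hs, one_smul, smul_smul,
      inv_mul_cancel₀ hψ, one_smul] at this
  rw [eq_top_iff]
  intro v _
  rw [h.expansion v]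
  exact S.add_mem (S.add_mem (S.smul_mem _ h0) (S.smul_mem _ hu)) (S.smul_mem _ hw)

theorem exists_isFrame {x : E3} (hx : ‖x‖ = 1) : ∃ u w, IsFrame x u w := by
  obtain ⟨u, hu, hxu, -⟩ := exists_unit_orthogonal x x
  obtain ⟨w, hw, hxw, huw⟩ := exists_unit_orthogonal x u
  exact ⟨u, w, hx, hu, hw, hxu, hxw, huw⟩

theorem exists_frame : ∃ x u w, IsFrame x u w := by
  obtain ⟨x, hx, -⟩ := exists_unit_orthogonal 0 0
  obtain ⟨u, w, h⟩ := exists_isFrame hx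
  exact ⟨x, u, w, h⟩

variable {X : Type*} [MetricSpace X]

theorem isDevelopingAt_of_chart {f : X → E3} {p : X} {r : ℝ} (h : IsSphericalChartAt f p r) :
    IsDevelopingAt f p := by
  have hpi := Real.pi_pos
  refine ⟨⟨r, h.pos, fun q hq q' hq' => ?_⟩, fun r' hr' => ?_⟩
  · rw [inner_eq_cos_angle_of_norm_eq_one (h.norm_eq q hq) (h.norm_eq q' hq'), h.angle_eq q hq q' hq']
  · have hp : p ∈ Metric.ball p r := Metric.mem_ball_self h.pos
    obtain ⟨u, w, hf⟩ := exists_isFrame (h.norm_eq p hp)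
    have hmin : 0 < min (min r r') Real.pi := lt_min (lt_min h.pos hr') hpi
    set s := min (min r r') Real.pi / 2 with hs
    have hs0 : 0 < s := by positivity
    have hsr : s < r := by
      linarith [(min_le_left (min r r') Real.pi).trans (min_le_left r r')]
    have hsr' : s < r' := by
      linarith [(min_le_left (min r r') Real.pi).trans (min_le_right r r')]
    have hsπ : s < Real.pi := by linarith [min_le_right (min r r') Real.pi]
    have hmem : ∀ ψ, polarPoint (f p) u w s ψ ∈ Submodule.span ℝ (f '' Metric.ball p r') := by
      intro ψ
      have ha : angle (f p) (polarPoint (f p) u w s ψ) = s :=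
        hf.angle_x_polarPoint hs0.le hsπ.le ψ
      obtain ⟨q, hq, hqv⟩ := h.surj _ (hf.norm_polarPoint s ψ) (by rw [ha]; exact hsr)
      refine Submodule.subset_span ⟨q, ?_, hqv⟩
      rw [Metric.mem_ball, dist_comm, ← h.angle_eq p hp q hq, hqv, ha]
      exact hsr'
    refine hf.eq_top (s := s) (ψ := Real.pi / 2) (Real.sin_pos_of_pos_of_lt_pi hs0 hsπ).ne'
      (by simp) ?_ (hmem _) (hmem _)
    exact Submodule.subset_span ⟨p, Metric.mem_ball_self hr', rfl⟩

theorem exists_isDevelopingAt_of_sector {bd : Set X} {p : X} {α : ℝ} (hα : 0 < α) (hα1 : α ≤ 1)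
    (h : HasSectorNhd bd p α) : ∃ f : X → E3, IsDevelopingAt f p := by
  have hpi := Real.pi_pos
  obtain ⟨r, hr, hrπ, F, hF0, hFd, hFs, -⟩ := h
  obtain ⟨x, u, w, hf⟩ := exists_frame
  have habs : ∀ ψ ∈ Set.Icc 0 (Real.pi * α), ∀ ψ' ∈ Set.Icc 0 (Real.pi * α),
      |ψ - ψ'| ≤ Real.pi := by
    intro ψ hψ ψ' hψ'
    have : Real.pi * α ≤ Real.pi := by nlinarith
    rw [abs_le]; constructor <;> linarith [hψ.1, hψ.2, hψ'.1, hψ'.2]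
  have hπα : 0 < Real.pi * α := by positivity
  have hchoice : ∀ q, ∃ c : ℝ × ℝ, q ∈ Metric.ball p r →
      c.1 ∈ Set.Ico 0 r ∧ c.2 ∈ Set.Icc 0 (Real.pi * α) ∧ F c.1 c.2 = q := by
    intro q
    by_cases hq : q ∈ Metric.ball p r
    · obtain ⟨φ, hφ, ψ, hψ, he⟩ := hFs q hq
      exact ⟨(φ, ψ), fun _ => ⟨hφ, hψ, he⟩⟩
    · exact ⟨(0, 0), fun h => absurd h hq⟩
  choose c hc using hchoice
  set f : X → E3 := fun q => polarPoint x u w (c q).1 (c q).2 with hfdef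
  have hinner : ∀ q ∈ Metric.ball p r, ∀ q' ∈ Metric.ball p r,
      ⟪f q, f q'⟫ = Real.cos (dist q q') := by
    intro q hq q' hq'
    obtain ⟨h1, h2, h3⟩ := hc q hq
    obtain ⟨h1', h2', h3'⟩ := hc q' hq'
    rw [← h3, ← h3', hFd _ h1 _ h2 _ h1' _ h2', cos_sectorDist, h3, h3', hf.inner_polarPoint,
      min_eq_left (habs _ h2 _ h2'), Real.cos_abs]
  have hdist : ∀ φ ∈ Set.Ico 0 r, ∀ ψ ∈ Set.Icc 0 (Real.pi * α), dist (F φ ψ) p = φ := by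
    intro φ hφ ψ hψ
    rw [dist_comm, ← hF0, hFd 0 ⟨le_rfl, hr⟩ 0 ⟨le_rfl, hπα.le⟩ φ hφ ψ hψ,
      sectorDist_vertex hφ.1 (by linarith [hφ.2])]
  -- The chosen coordinates of a point are not unique at the vertex, but any two choices have sector
  -- distance zero and so give the same point of the sphere.
  have hpolar : ∀ φ ∈ Set.Ico 0 r, ∀ ψ ∈ Set.Icc 0 (Real.pi * α),
      f (F φ ψ) = polarPoint x u w φ ψ := by
    intro φ hφ ψ hψ
    obtain ⟨h1, h2, h3⟩ := hc (F φ ψ) (by rw [Metric.mem_ball, hdist φ hφ ψ hψ]; exact hφ.2)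
    apply eq_of_angle_eq_zero_of_norm_eq
    · rw [hf.angle_polarPoint (habs _ h2 _ hψ), ← hFd _ h1 _ h2 _ hφ _ hψ, h3, dist_self]
    · rw [hf.norm_polarPoint, hf.norm_polarPoint]
  refine ⟨f, ⟨r, hr, hinner⟩, fun r' hr' => ?_⟩
  set s := min r r' / 2 with hs
  have hmin : 0 < min r r' := lt_min hr hr'
  have hs0 : 0 < s := by positivity
  have hsr : s < r := by linarith [min_le_left r r']
  have hsr' : s < r' := by linarith [min_le_right r r']
  have hmem : ∀ ψ ∈ Set.Icc 0 (Real.pi * α),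
      polarPoint x u w s ψ ∈ Submodule.span ℝ (f '' Metric.ball p r') := by
    intro ψ hψ
    refine Submodule.subset_span ⟨F s ψ, ?_, hpolar s ⟨hs0.le, hsr⟩ ψ hψ⟩
    rw [Metric.mem_ball, hdist s ⟨hs0.le, hsr⟩ ψ hψ]
    exact hsr'
  refine hf.eq_top (s := s) (ψ := Real.pi * α / 2)
    (Real.sin_pos_of_pos_of_lt_pi hs0 (by linarith)).ne'
    (Real.sin_pos_of_pos_of_lt_pi (by positivity) (by nlinarith)).ne' ?_
    (hmem 0 ⟨le_rfl, hπα.le⟩) (hmem _ ⟨by positivity, by linarith⟩)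
  have h0 : f p = x := by
    rw [← hF0, hpolar 0 ⟨le_rfl, hr⟩ 0 ⟨le_rfl, hπα.le⟩]
    simp [polarPoint]
  exact Submodule.subset_span ⟨p, Metric.mem_ball_self hr', h0⟩

/-- Two developing maps differ locally by an isometry of the sphere. -/
theorem exists_isometry_eventually {e f : X → E3} {p : X} {r : ℝ} (hr : 0 < r)
    (he : ∀ q ∈ Metric.ball p r, ∀ q' ∈ Metric.ball p r, ⟪e q, e q'⟫ = Real.cos (dist q q'))
    (hf : IsDevelopingAt f p) : ∃ A : E3 ≃ₗᵢ[ℝ] E3, ∀ᶠ q in 𝓝 p, e q = A (f q) := by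
  obtain ⟨⟨r', hr', hfi⟩, hspan⟩ := hf
  have hρ : 0 < min r r' := lt_min hr hr'
  have h1 : Metric.ball p (min r r') ⊆ Metric.ball p r := Metric.ball_subset_ball (min_le_left _ _)
  have h2 : Metric.ball p (min r r') ⊆ Metric.ball p r' :=
    Metric.ball_subset_ball (min_le_right _ _)
  obtain ⟨A, hA⟩ := exists_isometry_of_inner_eq (ι := Metric.ball p (min r r'))
    (f := fun q => e q) (g := fun q => f q)
    (fun q q' => by rw [he _ (h1 q.2) _ (h1 q'.2), hfi _ (h2 q.2) _ (h2 q'.2)])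
    (by
      have : Set.range (fun q : Metric.ball p (min r r') => f q) =
          f '' Metric.ball p (min r r') := by
        rw [Set.image_eq_range]
      rw [this]
      exact hspan _ hρ)
  refine ⟨A, ?_⟩
  filter_upwards [Metric.ball_mem_nhds p hρ] with q hq
  exact (hA ⟨q, hq⟩).symm

theorem IsDevelopingAt.congr_isometry {e f : X → E3} {p : X} (hf : IsDevelopingAt f p)
    (A : E3 ≃ₗᵢ[ℝ] E3) (h : ∀ᶠ q in 𝓝 p, e q = A (f q)) : IsDevelopingAt e p := by
  obtain ⟨ρ, hρ, hball⟩ := Metric.eventually_nhds_iff_ball.1 h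
  obtain ⟨⟨r, hr, hfi⟩, hspan⟩ := hf
  refine ⟨⟨min r ρ, lt_min hr hρ, fun q hq q' hq' => ?_⟩, fun r' hr' => ?_⟩
  · have h1 := Metric.ball_subset_ball (x := p) (min_le_left r ρ)
    have h2 := Metric.ball_subset_ball (x := p) (min_le_right r ρ)
    rw [hball q (h2 hq), hball q' (h2 hq'), LinearIsometryEquiv.inner_map_map,
      hfi q (h1 hq) q' (h1 hq')]
  · have hmin : 0 < min r' ρ := lt_min hr' hρ
    have himg : e '' Metric.ball p (min r' ρ) =
        A.toLinearEquiv.toLinearMap '' (f '' Metric.ball p (min r' ρ)) := by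
      rw [Set.image_image]
      apply Set.image_congr
      intro q hq
      exact hball q (Metric.ball_subset_ball (min_le_right _ _) hq)
    have htop : Submodule.span ℝ (e '' Metric.ball p (min r' ρ)) = ⊤ := by
      rw [himg, Submodule.span_image, hspan _ hmin]
      simp
    rw [eq_top_iff, ← htop]
    exact Submodule.span_mono
      (Set.image_mono (Metric.ball_subset_ball (min_le_left _ _)))

theorem IsDevelopingAt.congr {e f : X → E3} {p : X} (hf : IsDevelopingAt f p)
    (h : e =ᶠ[𝓝 p] f) : IsDevelopingAt e p :=
  hf.congr_isometry (LinearIsometryEquiv.refl ℝ E3) h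

/-- The cosine formula passes to nearby points at once; full-dimensionality of the image there does
not, and is borrowed from a developing map at the nearby point, from which `e` differs by an
isometry. -/
theorem IsDevelopingAt.eventually (hX : ∀ p : X, ∃ f : X → E3, IsDevelopingAt f p) {e : X → E3}
    {p : X} (he : IsDevelopingAt e p) : ∀ᶠ q in 𝓝 p, IsDevelopingAt e q := by
  obtain ⟨⟨r, hr, hei⟩, -⟩ := he
  filter_upwards [Metric.ball_mem_nhds p hr] with q hq
  obtain ⟨ρ, hρ, hsub⟩ := Metric.isOpen_iff.1 Metric.isOpen_ball q hq
  obtain ⟨f, hf⟩ := hX q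
  obtain ⟨A, hA⟩ := exists_isometry_eventually hρ
    (fun a ha b hb => hei a (hsub ha) b (hsub hb)) hf
  exact hf.congr_isometry A hA

/-- Developing maps on two closed sets with connected intersection can be glued. -/
theorem exists_isDevelopingAt_union {K₁ K₂ : Set X} (hK₁ : IsClosed K₁) (hK₂ : IsClosed K₂)
    (hconn : IsPreconnected (K₁ ∩ K₂)) {e₁ e₂ : X → E3} (h₁ : ∀ p ∈ K₁, IsDevelopingAt e₁ p)
    (h₂ : ∀ p ∈ K₂, IsDevelopingAt e₂ p) : ∃ e : X → E3, ∀ p ∈ K₁ ∪ K₂, IsDevelopingAt e p := by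
  have hloc : ∀ p ∈ K₁ ∩ K₂, ∃ A : E3 ≃ₗᵢ[ℝ] E3, ∀ᶠ q in 𝓝 p, e₁ q = A (e₂ q) := by
    rintro p ⟨hp₁, hp₂⟩
    obtain ⟨⟨r, hr, hi⟩, -⟩ := h₁ p hp₁
    exact exists_isometry_eventually hr hi (h₂ p hp₂)
  obtain ⟨A, hA⟩ : ∃ A : E3 ≃ₗᵢ[ℝ] E3, ∀ p ∈ K₁ ∩ K₂, ∀ᶠ q in 𝓝 p, e₁ q = A (e₂ q) := by
    rcases (K₁ ∩ K₂).eq_empty_or_nonempty with hemp | ⟨p₀, hp₀⟩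
    · exact ⟨LinearIsometryEquiv.refl ℝ E3, by simp [hemp]⟩
    obtain ⟨A, hA⟩ := hloc p₀ hp₀
    refine ⟨A, ?_⟩
    -- The isometry comparing the two maps is unique because images span, hence locally constant;
    -- connectedness of the intersection makes it a single `A`.
    set U : Set X := {p | ∀ᶠ q in 𝓝 p, e₁ q = A (e₂ q)} with hU
    set V : Set X := {p | ∃ B : E3 ≃ₗᵢ[ℝ] E3, B ≠ A ∧ ∀ᶠ q in 𝓝 p, e₁ q = B (e₂ q)} with hV
    have hUo : IsOpen U := isOpen_setOfPred_eventually_nhds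
    have hVo : IsOpen V := by
      rw [isOpen_iff_mem_nhds]
      rintro p ⟨B, hB, hp⟩
      filter_upwards [eventually_eventually_nhds.2 hp] with q hq
      exact ⟨B, hB, hq⟩
    have hcover : K₁ ∩ K₂ ⊆ U ∪ V := by
      intro p hp
      obtain ⟨B, hB⟩ := hloc p hp
      by_cases hBA : B = A
      · subst hBA
        exact Or.inl hB
      · exact Or.inr ⟨B, hBA, hB⟩
    have hdisj : K₁ ∩ K₂ ∩ (U ∩ V) = ∅ := by
      rw [Set.eq_empty_iff_forall_notMem]
      rintro p ⟨hp, hpU, B, hBA, hB⟩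
      apply hBA
      obtain ⟨ρ, hρ, hball⟩ := Metric.eventually_nhds_iff_ball.1 (hpU.and hB)
      refine isometryEquiv_eq_of_eqOn_span ((h₂ p hp.2).2 ρ hρ) ?_
      rintro _ ⟨q, hq, rfl⟩
      rw [← (hball q hq).1, ← (hball q hq).2]
    rcases isPreconnected_iff_subset_of_disjoint.1 hconn U V hUo hVo hcover hdisj with h | h
    · exact h
    · exact absurd (show p₀ ∈ K₁ ∩ K₂ ∩ (U ∩ V) from ⟨hp₀, hA, h hp₀⟩) (by simp [hdisj])
  set U : Set X := {p | ∀ᶠ q in 𝓝 p, e₁ q = A (e₂ q)} with hU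
  have hUo : IsOpen U := isOpen_setOfPred_eventually_nhds
  -- On the open set `U` the maps `e₁` and `A ∘ e₂` agree, so switching between them there is
  -- harmless. What remains of the two closed sets is disjoint and can be separated by open sets,
  -- which decides where to switch.
  have hdisj : Disjoint (K₁ \ U) (K₂ \ U) := by
    rw [Set.disjoint_left]
    rintro p ⟨hp₁, hpU⟩ ⟨hp₂, -⟩
    exact hpU (hA p ⟨hp₁, hp₂⟩)
  obtain ⟨V₁, V₂, hV₁, hV₂, hs₁, hs₂, hV⟩ :=
    normal_separation (hK₁.sdiff hUo) (hK₂.sdiff hUo) hdisj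
  classical
  refine ⟨fun q => if q ∈ V₁ then e₁ q else A (e₂ q), fun p hp => ?_⟩
  by_cases hpU : p ∈ U
  · rcases hp with hp | hp
    · refine (h₁ p hp).congr ?_
      filter_upwards [hpU] with q hq
      split_ifs
      · rfl
      · exact hq.symm
    · refine (h₂ p hp).congr_isometry A ?_
      filter_upwards [hpU] with q hq
      split_ifs
      · exact hq
      · rfl
  · rcases hp with hp | hp
    · refine (h₁ p hp).congr ?_
      filter_upwards [hV₁.mem_nhds (hs₁ ⟨hp, hpU⟩)] with q hq
      rw [if_pos hq]
    · refine (h₂ p hp).congr_isometry A ?_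
      filter_upwards [hV₂.mem_nhds (hs₂ ⟨hp, hpU⟩)] with q hq
      rw [if_neg fun h => Set.disjoint_left.1 hV h hq]

/-- A fine subdivision, given by compactness, places each step inside one of the local intervals;
the steps are then glued one after another. It is used once per coordinate direction of a square
containing the disc. -/
theorem interval_induction {P : ℝ → ℝ → Prop} {a b : ℝ} (hab : a ≤ b)
    (hmono : ∀ s t s' t', P s t → s ≤ s' → t' ≤ t → P s' t')
    (hglue : ∀ s m t, s ≤ m → m ≤ t → P s m → P m t → P s t)
    (hloc : ∀ x ∈ Set.Icc a b, ∃ ε > 0, P (x - ε) (x + ε)) : P a b := by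
  choose! ε hε hP using hloc
  obtain ⟨t, ht0, htm, ⟨m, hm⟩, hsub⟩ := exists_monotone_Icc_subset_open_cover_Icc hab
    (c := fun x : Set.Icc a b => Metric.ball x (ε x)) (fun x => Metric.isOpen_ball)
    (fun x _ => Set.mem_iUnion.2 ⟨x, Metric.mem_ball_self (hε x x.2)⟩)
  have hstep : ∀ n, P (t n) (t (n + 1)) := by
    intro n
    obtain ⟨x, hx⟩ := hsub n
    have h1 := hx ⟨le_rfl, htm (Nat.le_succ n)⟩
    have h2 := hx ⟨htm (Nat.le_succ n), le_rfl⟩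
    rw [Metric.mem_ball, Subtype.dist_eq, Real.dist_eq, abs_lt] at h1 h2
    exact hmono _ _ _ _ (hP x x.2) (by linarith [h1.1]) (by linarith [h2.2])
  have hall : ∀ n, P a (t n) := by
    intro n
    induction n with
    | zero =>
      rw [ht0]
      exact hmono _ _ _ _ (hP a ⟨le_rfl, hab⟩) (by linarith [hε a ⟨le_rfl, hab⟩])
        (by linarith [hε a ⟨le_rfl, hab⟩])
    | succ n ih => exact hglue _ _ _ (t n).2.1 (htm (Nat.le_succ n)) ih (hstep n)
  have := hall m
  rwa [hm m le_rfl] at this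

theorem isPreconnected_preimage_convex (H : X ≃ₜ Disc) {C : Set ℂ} (hC : Convex ℝ C) :
    IsPreconnected {x : X | (H x : ℂ) ∈ C} := by
  have h1 : IsPreconnected ((↑) ⁻¹' C : Set Disc) := by
    rw [← Topology.IsInducing.subtypeVal.isPreconnected_image, Subtype.image_preimage_coe]
    exact ((convex_closedBall (0 : ℂ) 1).inter hC).isPreconnected
  exact H.isPreconnected_preimage.2 h1

/-- A surface homeomorphic to the disc that can be developed locally can be developed globally. -/
theorem exists_global_developing (H : X ≃ₜ Disc)
    (hX : ∀ p : X, ∃ f : X → E3, IsDevelopingAt f p) :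
    ∃ e : X → E3, ∀ p, IsDevelopingAt e p := by
  -- Rectangles are convenient pieces: they are closed, the intersection of two is again one, and
  -- each meets the disc in a convex, hence connected, set.
  set box : ℝ → ℝ → ℝ → ℝ → Set X := fun a b c d =>
    {x | (H x : ℂ) ∈ Set.Icc a b ×ℂ Set.Icc c d} with hbox
  have hre : Continuous fun x : X => (H x : ℂ).re := by fun_prop
  have him : Continuous fun x : X => (H x : ℂ).im := by fun_prop
  have hclosed : ∀ a b c d, IsClosed (box a b c d) := fun a b c d =>
    (isClosed_Icc.preimage hre).inter (isClosed_Icc.preimage him)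
  have hconv : ∀ a b c d, Convex ℝ (Set.Icc a b ×ℂ Set.Icc c d) := fun a b c d =>
    ((convex_Icc a b).linear_preimage Complex.reLm).inter
      ((convex_Icc c d).linear_preimage Complex.imLm)
  have hpre : ∀ a b c d, IsPreconnected (box a b c d) := fun a b c d =>
    isPreconnected_preimage_convex H (hconv a b c d)
  set D : Set X → Prop := fun K => ∃ e : X → E3, ∀ p ∈ K, IsDevelopingAt e p with hD
  have hDmono : ∀ K K', K ⊆ K' → D K' → D K := fun K K' hKK' ⟨e, he⟩ =>
    ⟨e, fun p hp => he p (hKK' hp)⟩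
  have hDglue : ∀ a b c d a' b' c' d', ∀ K, K ⊆ box a b c d ∪ box a' b' c' d' →
      box a b c d ∩ box a' b' c' d' = box (max a a') (min b b') (max c c') (min d d') →
      D (box a b c d) → D (box a' b' c' d') → D K := by
    rintro a b c d a' b' c' d' K hK hinter ⟨e₁, h₁⟩ ⟨e₂, h₂⟩
    refine hDmono _ _ hK (exists_isDevelopingAt_union (hclosed _ _ _ _) (hclosed _ _ _ _) ?_ h₁ h₂)
    rw [hinter]
    exact hpre _ _ _ _
  have hinter : ∀ a b c d a' b' c' d',
      box a b c d ∩ box a' b' c' d' = box (max a a') (min b b') (max c c') (min d d') := by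
    intro a b c d a' b' c' d'
    ext x
    simp only [hbox, Set.mem_inter_iff, Set.mem_ofPred_eq, Complex.mem_reProdIm, Set.mem_Icc,
      max_le_iff, le_min_iff]
    tauto
  have hlocal : ∀ z : ℂ, ∃ δ > 0, D (box (z.re - δ) (z.re + δ) (z.im - δ) (z.im + δ)) := by
    intro z
    by_cases hz : z ∈ Metric.closedBall (0 : ℂ) 1
    · obtain ⟨f, hf⟩ := hX (H.symm ⟨z, hz⟩)
      have hev := hf.eventually hX
      have hcont : Filter.Tendsto (fun y : Disc => H.symm y) (𝓝 ⟨z, hz⟩)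
        (𝓝 (H.symm ⟨z, hz⟩)) := H.symm.continuous.continuousAt
      obtain ⟨ρ, hρ, hball⟩ := Metric.eventually_nhds_iff_ball.1 (hcont.eventually hev)
      refine ⟨ρ / 3, by positivity, f, fun p hp => ?_⟩
      have := hball (H p) ?_
      · rwa [H.symm_apply_apply] at this
      · simp only [hbox, Set.mem_ofPred_eq, Complex.mem_reProdIm, Set.mem_Icc] at hp
        rw [Metric.mem_ball, Subtype.dist_eq, Complex.dist_eq]
        refine (Complex.norm_le_abs_re_add_abs_im _).trans_lt ?_
        have h1 : |((H p : ℂ) - z).re| ≤ ρ / 3 := by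
          rw [Complex.sub_re, abs_le]; constructor <;> linarith [hp.1.1, hp.1.2]
        have h2 : |((H p : ℂ) - z).im| ≤ ρ / 3 := by
          rw [Complex.sub_im, abs_le]; constructor <;> linarith [hp.2.1, hp.2.2]
        linarith
    -- A small box around a point outside the disc has empty trace, so any map develops it
    -- vacuously.
    · have : {w : ℂ | w ∉ Metric.closedBall (0 : ℂ) 1} ∈ 𝓝 z :=
        Metric.isClosed_closedBall.isOpen_compl.mem_nhds hz
      obtain ⟨ρ, hρ, hball⟩ := Metric.mem_nhds_iff.1 this
      refine ⟨ρ / 3, by positivity, fun _ => 0, fun p hp => ?_⟩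
      exfalso
      refine hball (a := (H p : ℂ)) ?_ (H p).2
      simp only [hbox, Set.mem_ofPred_eq, Complex.mem_reProdIm, Set.mem_Icc] at hp
      rw [Metric.mem_ball, Complex.dist_eq]
      refine (Complex.norm_le_abs_re_add_abs_im _).trans_lt ?_
      have h1 : |((H p : ℂ) - z).re| ≤ ρ / 3 := by
        rw [Complex.sub_re, abs_le]; constructor <;> linarith [hp.1.1, hp.1.2]
      have h2 : |((H p : ℂ) - z).im| ≤ ρ / 3 := by
        rw [Complex.sub_im, abs_le]; constructor <;> linarith [hp.2.1, hp.2.2]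
      linarith
  have hmem : ∀ a b c d x, x ∈ box a b c d ↔
      (a ≤ (H x : ℂ).re ∧ (H x : ℂ).re ≤ b) ∧ (c ≤ (H x : ℂ).im ∧ (H x : ℂ).im ≤ d) := by
    intro a b c d x
    simp [hbox, Complex.mem_reProdIm]
  have hstrip : ∀ y : ℝ, ∃ δ > 0, D (box (-1) 1 (y - δ) (y + δ)) := by
    intro y
    refine interval_induction (P := fun s t => ∃ δ > 0, D (box s t (y - δ) (y + δ)))
      (by norm_num) ?_ ?_ ?_
    · rintro s t s' t' ⟨δ, hδ, h⟩ hs ht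
      refine ⟨δ, hδ, hDmono _ _ (fun x hx => ?_) h⟩
      rw [hmem] at hx ⊢
      exact ⟨⟨hs.trans hx.1.1, hx.1.2.trans ht⟩, hx.2⟩
    · rintro s m t hsm hmt ⟨δ, hδ, h⟩ ⟨δ', hδ', h'⟩
      refine ⟨min δ δ', lt_min hδ hδ', hDglue _ _ _ _ _ _ _ _ _ (fun x hx => ?_)
        (hinter _ _ _ _ _ _ _ _) h h'⟩
      rw [Set.mem_union, hmem, hmem]
      rw [hmem] at hx
      have h1 := min_le_left δ δ'
      have h2 := min_le_right δ δ'
      rcases le_total (H x : ℂ).re m with hm | hm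
      · exact Or.inl ⟨⟨hx.1.1, hm⟩, by linarith [hx.2.1], by linarith [hx.2.2]⟩
      · exact Or.inr ⟨⟨hm, hx.1.2⟩, by linarith [hx.2.1], by linarith [hx.2.2]⟩
    · intro x _
      obtain ⟨δ, hδ, h⟩ := hlocal ⟨x, y⟩
      exact ⟨δ, hδ, δ, hδ, h⟩
  have hfull : D (box (-1) 1 (-1) 1) := by
    refine interval_induction (P := fun s t => D (box (-1) 1 s t)) (by norm_num) ?_ ?_ ?_
    · intro s t s' t' h hs ht
      refine hDmono _ _ (fun x hx => ?_) h
      rw [hmem] at hx ⊢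
      exact ⟨hx.1, hs.trans hx.2.1, hx.2.2.trans ht⟩
    · intro s m t hsm hmt h h'
      refine hDglue _ _ _ _ _ _ _ _ _ (fun x hx => ?_) (hinter _ _ _ _ _ _ _ _) h h'
      rw [Set.mem_union, hmem, hmem]
      rw [hmem] at hx
      rcases le_total (H x : ℂ).im m with hm | hm
      · exact Or.inl ⟨hx.1, hx.2.1, hm⟩
      · exact Or.inr ⟨hx.1, hm, hx.2.2⟩
    · intro y _
      exact hstrip y
  obtain ⟨e, he⟩ := hfull
  refine ⟨e, fun p => he p ?_⟩
  have hp : ‖(H p : ℂ)‖ ≤ 1 := mem_closedBall_zero_iff.1 (H p).2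
  rw [hmem]
  exact ⟨abs_le.1 ((Complex.abs_re_le_norm _).trans hp),
    abs_le.1 ((Complex.abs_im_le_norm _).trans hp)⟩


/-! ### Convex discs of curvature one embed into the sphere -/

section Rigidity

variable {X : Type*} [MetricSpace X]

theorem dist_add_dist_le_of_path {p q : X} (γ : Path p q) {D : ℝ} (hD : 0 ≤ D)
    (h : eVariationOn (γ : unitInterval → X) Set.univ ≤ ENNReal.ofReal D) (s : unitInterval) :
    dist p (γ s) + dist (γ s) q ≤ D := by
  have h1 := eVariationOn.Icc_add_Icc (γ : unitInterval → X) (s := Set.univ)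
    (unitInterval.nonneg' (t := s)) (unitInterval.le_one' (t := s)) (Set.mem_univ s)
  have h2 : edist p (γ s) ≤ eVariationOn (γ : unitInterval → X) (Set.univ ∩ Set.Icc 0 s) := by
    have := eVariationOn.edist_le (γ : unitInterval → X) (s := Set.univ ∩ Set.Icc 0 s)
      (x := 0) (y := s) ⟨Set.mem_univ _, le_rfl, unitInterval.nonneg'⟩
      ⟨Set.mem_univ _, unitInterval.nonneg', le_rfl⟩
    simpa using this
  have h3 : edist (γ s) q ≤ eVariationOn (γ : unitInterval → X) (Set.univ ∩ Set.Icc s 1) := by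
    have := eVariationOn.edist_le (γ : unitInterval → X) (s := Set.univ ∩ Set.Icc s 1)
      (x := s) (y := 1) ⟨Set.mem_univ _, le_rfl, unitInterval.le_one'⟩
      ⟨Set.mem_univ _, unitInterval.le_one', le_rfl⟩
    simpa using this
  have h4 : edist p (γ s) + edist (γ s) q ≤ ENNReal.ofReal D := by
    refine (add_le_add h2 h3).trans ?_
    rw [h1]
    exact (eVariationOn.mono _ Set.inter_subset_left).trans h
  rw [edist_dist, edist_dist, ← ENNReal.ofReal_add dist_nonneg dist_nonneg] at h4
  exact (ENNReal.ofReal_le_ofReal_iff hD).1 h4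

/-- Compact length spaces are geodesic. -/
theorem exists_between [CompactSpace X] (hL : IsLengthSpace X) (p q : X) {t : ℝ} (h0 : 0 ≤ t)
    (ht : t ≤ dist p q) : ∃ m, dist p m = t ∧ dist m q = dist p q - t := by
  have happrox : ∀ ε > 0, ∃ m, dist p m = t ∧ dist m q ≤ dist p q - t + ε := by
    intro ε hε
    obtain ⟨γ, hγ⟩ := hL p q ε hε
    have hcont : Continuous fun s : unitInterval => dist p (γ s) := by fun_prop
    obtain ⟨s, hs⟩ := mem_range_of_exists_le_of_exists_ge hcont ⟨0, by simpa using h0⟩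
      ⟨1, by simpa using ht⟩
    refine ⟨γ s, hs, ?_⟩
    have := dist_add_dist_le_of_path γ (by positivity) hγ s
    simp only at hs
    linarith
  have hclosed : IsClosed {m : X | dist p m = t} := isClosed_eq (by fun_prop) continuous_const
  obtain ⟨m₀, hm₀, -⟩ := happrox 1 one_pos
  -- All approximate division points lie on the same compact sphere about `p`, so the nearest point
  -- to `q` on it is an exact one.
  obtain ⟨m, hm, hmin⟩ := hclosed.isCompact.exists_isMinOn ⟨m₀, hm₀⟩
    (f := fun m => dist m q) (by fun_prop)
  refine ⟨m, hm, le_antisymm (le_of_forall_pos_le_add fun ε hε => ?_) ?_⟩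
  · obtain ⟨m', hm', hle⟩ := happrox ε hε
    exact (hmin hm').trans hle
  · have := dist_triangle p m q
    rw [show dist p m = t from hm] at this
    linarith

/-- The difference of the two sides has zero square. This is how an equality in the triangle
inequality becomes collinearity on a great circle: `z` is the reflection of `x` through `y`. -/
theorem add_eq_smul_of_inner {x y z : E3} {a : ℝ} (hx : ⟪x, x⟫ = 1) (hy : ⟪y, y⟫ = 1)
    (hz : ⟪z, z⟫ = 1) (hxy : ⟪x, y⟫ = Real.cos a) (hyz : ⟪y, z⟫ = Real.cos a)
    (hxz : ⟪x, z⟫ = Real.cos (2 * a)) : x + z = (2 * Real.cos a) • y := by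
  rw [← sub_eq_zero, ← inner_self_eq_zero (𝕜 := ℝ)]
  have h1 : ⟪y, x⟫ = Real.cos a := by rw [real_inner_comm, hxy]
  have h2 : ⟪z, y⟫ = Real.cos a := by rw [real_inner_comm, hyz]
  have h3 : ⟪z, x⟫ = Real.cos (2 * a) := by rw [real_inner_comm, hxz]
  simp only [inner_sub_left, inner_sub_right, inner_add_left, inner_add_right,
    real_inner_smul_left, real_inner_smul_right, hx, hy, hz, hxy, hyz, hxz, h1, h2, h3,
    Real.cos_two_mul]
  ring

/-- A developing map of a compact length space maps shortest paths to great circles. -/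
theorem inner_eq_cos_dist [CompactSpace X] (hL : IsLengthSpace X) {e : X → E3}
    (he : ∀ p, IsDevelopingAt e p) (p q : X) : ⟪e p, e q⟫ = Real.cos (dist p q) := by
  have hr := fun p => (he p).1
  choose r hr0 hr using hr
  obtain ⟨δ, hδ, hleb⟩ := lebesgue_number_lemma_of_metric (isCompact_univ (X := X))
    (c := fun p => Metric.ball p (r p)) (fun p => Metric.isOpen_ball)
    (fun p _ => Set.mem_iUnion.2 ⟨p, Metric.mem_ball_self (hr0 p)⟩)
  -- Cut a shortest path into three equal parts. Two thirds of `4 / 3 * s` is still below `s`, so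
  -- the formula holds on both overlapping two-thirds; these determine `e q` from `e x` and `e y`,
  -- and the triple angle formula concludes.
  have hstep : ∀ s : ℝ, (∀ p q, dist p q < s → ⟪e p, e q⟫ = Real.cos (dist p q)) →
      ∀ p q, dist p q < 4 / 3 * s → ⟪e p, e q⟫ = Real.cos (dist p q) := by
    intro s hs p q hpq
    set a := dist p q / 3 with ha
    have ha0 : 0 ≤ a := by positivity
    have hD : dist p q = 3 * a := by rw [ha]; ring
    obtain ⟨x, hpx, hxq⟩ := exists_between hL p q ha0 (by linarith)
    obtain ⟨y, hxy, hyq⟩ := exists_between hL x q ha0 (by linarith)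
    have hpy : dist p y = 2 * a := by
      apply le_antisymm
      · linarith [dist_triangle p x y]
      · linarith [dist_triangle p y q]
    have hs0 : a < s := by linarith
    have hs0' : 0 < s := by linarith
    have hself : ∀ z, ⟪e z, e z⟫ = 1 := fun z => by
      rw [hs z z (by rw [dist_self]; exact hs0'), dist_self, Real.cos_zero]
    have hyq' : dist y q = a := by linarith
    have hxq' : dist x q = 2 * a := by linarith
    have e1 : ⟪e p, e x⟫ = Real.cos a := by rw [hs p x (by linarith), hpx]
    have e2 : ⟪e p, e y⟫ = Real.cos (2 * a) := by rw [hs p y (by linarith), hpy]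
    have h2 : e x + e q = (2 * Real.cos a) • e y :=
      add_eq_smul_of_inner (hself x) (hself y) (hself q) (by rw [hs x y (by linarith), hxy])
        (by rw [hs y q (by linarith), hyq']) (by rw [hs x q (by linarith), hxq'])
    have h3 : e q = (2 * Real.cos a) • e y - e x := by rw [← h2]; abel
    rw [h3, inner_sub_right, real_inner_smul_right, e1, e2, hD, Real.cos_three_mul,
      Real.cos_two_mul]
    ring
  have hpow : ∀ n : ℕ, ∀ p q, dist p q < (4 / 3) ^ n * δ → ⟪e p, e q⟫ = Real.cos (dist p q) := by
    intro n
    induction n with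
    | zero =>
      intro p q hpq
      obtain ⟨i, hi⟩ := hleb p (Set.mem_univ p)
      exact hr i p (hi (Metric.mem_ball_self hδ)) q
        (hi (by rw [Metric.mem_ball, dist_comm]; simpa using hpq))
    | succ n ih =>
      intro p q hpq
      exact hstep _ ih p q (by rw [pow_succ] at hpq; linarith)
  obtain ⟨n, hn⟩ := pow_unbounded_of_one_lt (dist p q / δ) (by norm_num : (1 : ℝ) < 4 / 3)
  exact hpow n p q (by rwa [div_lt_iff₀ hδ] at hn)

/-- Shortest paths do not pass through a vertex with angle less than `π`. -/
theorem dist_lt_add_of_sector [CompactSpace X] (hL : IsLengthSpace X) {bd : Set X} {p q v : X}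
    {α : ℝ} (hα : 0 < α) (hα1 : α < 1) (hv : HasSectorNhd bd v α) (hpv : p ≠ v) (hqv : v ≠ q) :
    dist p q < dist p v + dist v q := by
  have hpi := Real.pi_pos
  refine lt_of_le_of_ne (dist_triangle p v q) fun heq => ?_
  obtain ⟨r, hr, hrπ, F, hF0, hFd, hFs, -⟩ := hv
  have ha := dist_pos.2 hpv
  have hb := dist_pos.2 hqv
  obtain ⟨s, hs0, hsr, hsa, hsb⟩ : ∃ s, 0 < s ∧ s < r ∧ s < dist p v ∧ s < dist v q := by
    have hm : 0 < min r (min (dist p v) (dist v q)) := lt_min hr (lt_min ha hb)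
    refine ⟨min r (min (dist p v) (dist v q)) / 2, by positivity, ?_, ?_, ?_⟩
    · linarith [min_le_left r (min (dist p v) (dist v q))]
    · linarith [(min_le_right r (min (dist p v) (dist v q))).trans (min_le_left _ _)]
    · linarith [(min_le_right r (min (dist p v) (dist v q))).trans (min_le_right _ _)]
  -- If `v` were on a shortest path, the points at distance `s` before and after it would be `2 * s`
  -- apart. In the sector they subtend an angle at most `π α < π`, which makes their distance
  -- smaller.
  obtain ⟨y, hpy, hyv⟩ := exists_between hL p v (t := dist p v - s) (by linarith) (by linarith)
  obtain ⟨y', hvy', hy'q⟩ := exists_between hL v q hs0.le hsb.le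
  have hyy' : dist y y' = 2 * s := by
    apply le_antisymm
    · linarith [dist_triangle y v y']
    · linarith [dist_triangle p y q, dist_triangle y y' q]
  have hπα : 0 < Real.pi * α := by positivity
  have hcoord : ∀ z, dist v z = s → ∃ ψ ∈ Set.Icc 0 (Real.pi * α), F s ψ = z := by
    intro z hz
    obtain ⟨φ, hφ, ψ, hψ, he⟩ := hFs z (by rw [Metric.mem_ball, dist_comm, hz]; exact hsr)
    have : φ = s := by
      rw [← hz, ← he, ← hF0, hFd 0 ⟨le_rfl, hr⟩ 0 ⟨le_rfl, hπα.le⟩ φ hφ ψ hψ,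
        sectorDist_vertex hφ.1 (by linarith [hφ.2])]
    exact ⟨ψ, hψ, this ▸ he⟩
  obtain ⟨ψ, hψ, hFy⟩ := hcoord y (by rw [dist_comm]; linarith)
  obtain ⟨ψ', hψ', hFy'⟩ := hcoord y' hvy'
  have hd := hFd s ⟨hs0.le, hsr⟩ ψ hψ s ⟨hs0.le, hsr⟩ ψ' hψ'
  rw [hFy, hFy', hyy'] at hd
  have hcos := congrArg Real.cos hd
  have habs : |ψ - ψ'| ≤ Real.pi * α := by
    rw [abs_le]; constructor <;> linarith [hψ.1, hψ.2, hψ'.1, hψ'.2]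
  have hlt : |ψ - ψ'| < Real.pi := by nlinarith
  rw [cos_sectorDist, min_eq_left hlt.le, Real.cos_two_mul] at hcos
  have hsin : 0 < Real.sin s := Real.sin_pos_of_pos_of_lt_pi hs0 (by linarith)
  have hgt : Real.cos Real.pi < Real.cos |ψ - ψ'| :=
    Real.cos_lt_cos_of_nonneg_of_le_pi (abs_nonneg _) le_rfl hlt
  rw [Real.cos_pi] at hgt
  nlinarith [Real.sin_sq_add_cos_sq s, mul_pos hsin hsin]

/-- Otherwise some `q'` lies at distance exactly `π` from `p` and is sent to `-e p`. For `x` at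
distance less than `π` from both, the cosine formula forces `dist p x + dist x q' = π`; these `x`
form a set that is both open and closed in the complement of `{p, q'}`, hence all of it. At least
one of the three vertices is neither `p` nor `q'`, and it would lie on a shortest path. -/
theorem dist_lt_pi_of_vertices [CompactSpace X] (hL : IsLengthSpace X) {e : X → E3}
    (he : ∀ p q, ⟪e p, e q⟫ = Real.cos (dist p q))
    (hconn : ∀ p q : X, IsPreconnected ({p, q}ᶜ : Set X)) {bd : Set X} {vert : Fin 3 → X}
    (hinj : Function.Injective vert) {α : Fin 3 → ℝ} (hα : ∀ i, 0 < α i ∧ α i < 1)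
    (hsec : ∀ i, HasSectorNhd bd (vert i) (α i)) (p q : X) : dist p q < Real.pi := by
  have hpi := Real.pi_pos
  by_contra! hge
  obtain ⟨q', hq', -⟩ := exists_between hL p q hpi.le hge
  clear hge
  have hself : ∀ z, ⟪e z, e z⟫ = 1 := fun z => by rw [he, dist_self, Real.cos_zero]
  have heq' : e q' = -e p := by
    have h1 := he p q'
    rw [hq', Real.cos_pi] at h1
    rw [eq_neg_iff_add_eq_zero, ← inner_self_eq_zero (𝕜 := ℝ), inner_add_left, inner_add_right,
      inner_add_right, hself, hself, real_inner_comm, h1]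
    ring
  set U : Set X := {x | dist p x < Real.pi ∧ dist x q' < Real.pi ∧
    dist p x + dist x q' = Real.pi} with hU
  set V : Set X := {x | dist p x + dist x q' ≠ Real.pi} with hV
  have hVo : IsOpen V := isOpen_ne_fun (by fun_prop) continuous_const
  have hlocal : ∀ x, dist p x < Real.pi → dist x q' < Real.pi → dist p x + dist x q' = Real.pi := by
    intro x h1 h2
    have h3 := he p x
    have h4 := he x q'
    rw [heq', inner_neg_right, real_inner_comm, h3, ← Real.cos_pi_sub] at h4
    have := Real.injOn_cos ⟨by linarith, by linarith [dist_nonneg (x := p) (y := x)]⟩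
      ⟨dist_nonneg, h2.le⟩ h4
    linarith
  have hUeq : U = {x | dist p x < Real.pi ∧ dist x q' < Real.pi} := by
    ext x
    exact ⟨fun h => ⟨h.1, h.2.1⟩, fun h => ⟨h.1, h.2, hlocal x h.1 h.2⟩⟩
  have hUo : IsOpen U := by
    rw [hUeq]
    exact (isOpen_lt (continuous_const.dist continuous_id) continuous_const).inter
      (isOpen_lt (continuous_id.dist continuous_const) continuous_const)
  have hcover : ({p, q'}ᶜ : Set X) ⊆ U ∪ V := by
    intro x hx
    simp only [Set.mem_compl_iff, Set.mem_insert_iff, Set.mem_singleton_iff, not_or] at hx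
    by_cases h : dist p x + dist x q' = Real.pi
    · left
      have h1 := dist_pos.2 (Ne.symm hx.1)
      have h2 := dist_pos.2 hx.2
      exact ⟨by linarith, by linarith, h⟩
    · exact Or.inr h
  have hdisj : ({p, q'}ᶜ : Set X) ∩ (U ∩ V) = ∅ := by
    rw [Set.eq_empty_iff_forall_notMem]
    rintro x ⟨-, hxU, hxV⟩
    exact hxV hxU.2.2
  obtain ⟨m, hm, hm'⟩ := exists_between hL p q' (t := Real.pi / 2) (by positivity) (by linarith)
  have hmmem : m ∈ ({p, q'}ᶜ : Set X) := by
    simp only [Set.mem_compl_iff, Set.mem_insert_iff, Set.mem_singleton_iff, not_or]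
    constructor
    · rintro rfl
      rw [dist_self] at hm
      linarith
    · rintro rfl
      rw [dist_self] at hm'
      linarith
  have hsub : ({p, q'}ᶜ : Set X) ⊆ U := by
    rcases isPreconnected_iff_subset_of_disjoint.1 (hconn p q') U V hUo hVo hcover hdisj with h | h
    · exact h
    · exact absurd (by linarith : dist p m + dist m q' = Real.pi) (h hmmem)
  obtain ⟨i, hip, hiq⟩ : ∃ i, vert i ≠ p ∧ vert i ≠ q' := by
    by_contra! hcon
    by_cases h0 : vert 0 = p
    · have h1 : vert 1 ≠ p := fun h => absurd (hinj (h.trans h0.symm)) (by decide)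
      have h2 : vert 2 ≠ p := fun h => absurd (hinj (h.trans h0.symm)) (by decide)
      exact absurd (hinj ((hcon 1 h1).trans (hcon 2 h2).symm)) (by decide)
    · by_cases h1 : vert 1 = p
      · have h2 : vert 2 ≠ p := fun h => absurd (hinj (h.trans h1.symm)) (by decide)
        exact absurd (hinj ((hcon 0 h0).trans (hcon 2 h2).symm)) (by decide)
      · exact absurd (hinj ((hcon 0 h0).trans (hcon 1 h1).symm)) (by decide)
  have hiU := hsub (show vert i ∈ ({p, q'}ᶜ : Set X) by simp [hip, hiq])
  have := dist_lt_add_of_sector hL (hα i).1 (hα i).2 (hsec i) (Ne.symm hip) hiq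
  linarith [hiU.2.2]

/-- The open ball is homeomorphic to the plane, which stays connected after removal of a countable
set; the closed disc minus two points lies between the punctured ball and its closure. -/
theorem isPreconnected_compl_pair (H : X ≃ₜ Disc) (p q : X) :
    IsPreconnected ({p, q}ᶜ : Set X) := by
  set a : ℂ := (H p : ℂ) with ha
  set b : ℂ := (H q : ℂ) with hb
  have hball : IsPreconnected (Metric.ball (0 : ℂ) 1 \ {a, b}) := by
    set φ : ℂ → ℂ := fun z => (Homeomorph.unitBall z : ℂ) with hφ
    have hφc : Continuous φ := continuous_subtype_val.comp Homeomorph.unitBall.continuous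
    have hφi : Function.Injective φ :=
      Subtype.val_injective.comp Homeomorph.unitBall.injective
    have hcount : (φ ⁻¹' {a, b}).Countable :=
      (Set.Finite.preimage hφi.injOn (by simp)).countable
    have h1 := (hcount.isPathConnected_compl_of_one_lt_rank (by
      rw [Complex.rank_real_complex]; norm_num)).isConnected.isPreconnected
    have h2 := h1.image φ hφc.continuousOn
    convert h2 using 1
    ext z
    constructor
    · rintro ⟨hz, hzab⟩
      refine ⟨Homeomorph.unitBall.symm ⟨z, hz⟩, ?_, ?_⟩
      · simpa [hφ] using hzab
      · simp [hφ]
    · rintro ⟨y, hy, rfl⟩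
      exact ⟨(Homeomorph.unitBall y).2, hy⟩
  have hclos : closure (Metric.ball (0 : ℂ) 1 \ {a, b}) = Metric.closedBall 0 1 := by
    have hd : Dense ({a, b}ᶜ : Set ℂ) :=
      (Set.Finite.countable (by simp)).dense_compl ℝ
    have := hd.open_subset_closure_inter (Metric.isOpen_ball (x := (0 : ℂ)) (ε := 1))
    apply subset_antisymm
    · exact closure_minimal (Set.sdiff_subset.trans Metric.ball_subset_closedBall)
        Metric.isClosed_closedBall
    · rw [← closure_ball (0 : ℂ) one_ne_zero]
      exact closure_minimal this isClosed_closure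
  have hdisc : IsPreconnected (Metric.closedBall (0 : ℂ) 1 \ {a, b}) :=
    hball.subset_closure (Set.sdiff_subset_sdiff_left Metric.ball_subset_closedBall)
      (by rw [hclos]; exact Set.sdiff_subset)
  have h3 : IsPreconnected ((↑) ⁻¹' ({a, b}ᶜ : Set ℂ) : Set Disc) := by
    rw [← Topology.IsInducing.subtypeVal.isPreconnected_image, Subtype.image_preimage_coe]
    exact hdisc
  have h4 := H.isPreconnected_preimage.2 h3
  convert h4 using 1
  ext x
  simp [ha, hb, Subtype.val_inj]

end Rigidity


/-! ### The developed image as a convex cone -/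

section Image

variable {X : Type*} [MetricSpace X]

theorem norm_of_inner_eq_cos {e : X → E3} (he : ∀ p q, ⟪e p, e q⟫ = Real.cos (dist p q)) (p : X) :
    ‖e p‖ = 1 :=
  norm_eq_one_of_inner_self (by rw [he, dist_self, Real.cos_zero])

theorem angle_eq_dist {e : X → E3} (he : ∀ p q, ⟪e p, e q⟫ = Real.cos (dist p q))
    (hπ : ∀ p q : X, dist p q < Real.pi) (p q : X) : angle (e p) (e q) = dist p q :=
  angle_eq_of_inner_eq_cos (norm_of_inner_eq_cos he p) (norm_of_inner_eq_cos he q) dist_nonneg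
    (hπ p q).le (he p q)

theorem continuous_of_angle_eq_dist {e : X → E3} (hn : ∀ p, ‖e p‖ = 1)
    (he : ∀ p q, angle (e p) (e q) = dist p q) : Continuous e := by
  have : LipschitzWith 1 e := LipschitzWith.of_dist_le_mul fun p q => by
    rw [dist_eq_norm, NNReal.coe_one, one_mul, dist_comm, ← he]
    exact norm_sub_le_angle (hn q) (hn p)
  exact this.continuous

/-- The cone over a geodesically convex subset of the sphere is convex. -/
theorem exists_smul_eq_add [CompactSpace X] (hL : IsLengthSpace X) {e : X → E3}
    (he : ∀ p q, ⟪e p, e q⟫ = Real.cos (dist p q)) (hπ : ∀ p q : X, dist p q < Real.pi) (p q : X)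
    {c d : ℝ} (hc : 0 < c) (hd : 0 < d) : ∃ t : ℝ, 0 < t ∧ ∃ m, c • e p + d • e q = t • e m := by
  have hpi := Real.pi_pos
  have hnp := norm_of_inner_eq_cos he p
  have hnq := norm_of_inner_eq_cos he q
  rcases eq_or_lt_of_le (dist_nonneg (x := p) (y := q)) with h0 | h0
  · have hpq : p = q := dist_eq_zero.1 h0.symm
    exact ⟨c + d, by positivity, p, by rw [hpq, add_smul]⟩
  obtain ⟨w, hw, hpw, hq⟩ := exists_arc hnp hnq
  rw [angle_eq_dist he hπ] at hq
  set D := dist p q with hD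
  have hsD : 0 < Real.sin D := Real.sin_pos_of_pos_of_lt_pi h0 (hπ p q)
  -- The combination, written in the orthonormal basis `(e p, w)` of the plane of the arc. Its
  -- modulus is the scale, and its argument is the distance from `p` at which the point is found on
  -- a shortest path.
  set z : ℂ := ⟨c + d * Real.cos D, d * Real.sin D⟩ with hz
  have hzim : 0 < z.im := by positivity
  have hz0 : z ≠ 0 := fun h => by rw [h] at hzim; simp at hzim
  have hρ : 0 < ‖z‖ := norm_pos_iff.2 hz0
  set t := z.arg with ht
  have hcos : ‖z‖ * Real.cos t = c + d * Real.cos D := Complex.norm_mul_cos_arg z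
  have hsin : ‖z‖ * Real.sin t = d * Real.sin D := Complex.norm_mul_sin_arg z
  have ht0 : 0 ≤ t := Complex.arg_nonneg_iff.2 hzim.le
  have htπ : t ≤ Real.pi := Complex.arg_le_pi z
  have hDt : ‖z‖ * Real.sin (D - t) = c * Real.sin D := by
    rw [Real.sin_sub]
    linear_combination Real.sin D * hcos - Real.cos D * hsin
  have htD : t ≤ D := by
    by_contra! h
    have h1 : Real.sin (D - t) ≤ 0 :=
      Real.sin_nonpos_of_nonpos_of_neg_pi_le (by linarith) (by linarith)
    nlinarith [mul_pos hc hsD]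
  obtain ⟨m, hpm, hmq⟩ := exists_between hL p q ht0 htD
  refine ⟨‖z‖, hρ, m, ?_⟩
  set a : E3 := Real.cos t • e p + Real.sin t • w with ha
  have hlin : Real.sin D • a = Real.sin (D - t) • e p + Real.sin t • e q := by
    rw [hq, ha, Real.sin_sub]
    module
  have hma : ⟪e m, a⟫ = 1 := by
    have h1 : Real.sin D * ⟪e m, a⟫ = Real.sin D := by
      rw [← real_inner_smul_right, hlin, inner_add_right, real_inner_smul_right,
        real_inner_smul_right, he, he, dist_comm m p, hpm, hmq, ← hD]
      have : Real.sin D = Real.sin ((D - t) + t) := by ring_nf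
      conv_rhs => rw [this, Real.sin_add]
      ring
    exact mul_left_cancel₀ hsD.ne' (by rw [h1, mul_one])
  have hma' : e m = a :=
    (inner_eq_one_iff_of_norm_eq_one (norm_of_inner_eq_cos he m) (norm_arc hnp hw hpw t)).1 hma
  rw [hma', ha, smul_add, smul_smul, smul_smul, hcos, hsin, hq]
  module

theorem exists_smul_eq_sum [CompactSpace X] (hL : IsLengthSpace X) {e : X → E3}
    (he : ∀ p q, ⟪e p, e q⟫ = Real.cos (dist p q)) (hπ : ∀ p q : X, dist p q < Real.pi)
    {ι : Type*} (s : Finset ι) (v : ι → X) {c : ι → ℝ} (hc : ∀ i, 0 ≤ c i) (p₀ : X) :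
    ∃ t : ℝ, 0 ≤ t ∧ ∃ m, ∑ i ∈ s, c i • e (v i) = t • e m := by
  classical
  induction s using Finset.induction_on with
  | empty => exact ⟨0, le_rfl, p₀, by simp⟩
  | insert i s hi ih =>
    obtain ⟨t, ht, m, hm⟩ := ih
    rw [Finset.sum_insert hi, hm]
    rcases eq_or_lt_of_le (hc i) with h0 | h0
    · exact ⟨t, ht, m, by rw [← h0]; simp⟩
    rcases eq_or_lt_of_le ht with h1 | h1
    · exact ⟨c i, hc i, v i, by rw [← h1]; simp⟩
    obtain ⟨t', ht', m', hm'⟩ := exists_smul_eq_add hL he hπ (v i) m h0 h1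
    exact ⟨t', ht'.le, m', hm'⟩

/-- A compact geodesically convex set without antipodal points lies in an open hemisphere. -/
theorem exists_pos_functional [CompactSpace X] (hL : IsLengthSpace X) {e : X → E3}
    (he : ∀ p q, ⟪e p, e q⟫ = Real.cos (dist p q)) (hπ : ∀ p q : X, dist p q < Real.pi) :
    ∃ l : StrongDual ℝ E3, ∀ q, 0 < l (e q) := by
  have hnorm := norm_of_inner_eq_cos he
  have hcont := continuous_of_angle_eq_dist hnorm (angle_eq_dist he hπ)
  set C : Set E3 := {x | ∃ m, x = ‖x‖ • e m} with hC
  have hmem : ∀ t : ℝ, 0 ≤ t → ∀ m, t • e m ∈ C := by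
    intro t ht m
    refine ⟨m, ?_⟩
    rw [norm_smul, hnorm, mul_one, Real.norm_eq_abs, abs_of_nonneg ht]
  have hclosed : IsClosed C := by
    have h1 : IsClosed {z : E3 × X | z.1 = ‖z.1‖ • e z.2} :=
      isClosed_eq continuous_fst (continuous_fst.norm.smul (hcont.comp continuous_snd))
    have h2 := isClosedMap_fst_of_compactSpace _ h1
    convert h2 using 1
    ext x
    simp [hC]
  have hconv : Convex ℝ C := by
    rintro x ⟨m, hx⟩ y ⟨m', hy⟩ a b ha hb -
    obtain ⟨t, ht, m'', h⟩ := exists_smul_eq_sum hL he hπ Finset.univ ![m, m']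
      (c := ![a * ‖x‖, b * ‖y‖]) (by
        intro i
        fin_cases i
        · exact mul_nonneg ha (norm_nonneg x)
        · exact mul_nonneg hb (norm_nonneg y)) m
    simp only [Fin.sum_univ_two, Matrix.cons_val_zero, Matrix.cons_val_one, mul_smul, ← hx,
      ← hy] at h
    rw [h]
    exact hmem t ht m''
  -- With no antipodal pairs, `-e p` lies outside the closed convex cone, and Hahn–Banach separates
  -- it. Finitely many of these functionals cover the compact image, and their sum is positive
  -- everywhere.
  have hsep : ∀ p, ∃ f : StrongDual ℝ E3, (∀ q, 0 ≤ f (e q)) ∧ 0 < f (e p) := by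
    intro p
    have hp : -e p ∉ C := by
      rintro ⟨m, hm⟩
      rw [norm_neg, hnorm, one_smul] at hm
      have h1 := he p m
      rw [← hm, inner_neg_right, inner_self_of_unit (hnorm p), ← Real.cos_pi] at h1
      exact (hπ p m).ne (Real.injOn_cos ⟨Real.pi_pos.le, le_rfl⟩
        ⟨dist_nonneg, (hπ p m).le⟩ h1).symm
    obtain ⟨f, u, hu, hf⟩ := geometric_hahn_banach_point_closed hconv hclosed hp
    have hu0 : u < 0 := by
      have := hf _ (hmem 0 le_rfl p)
      rwa [zero_smul, map_zero] at this
    rw [map_neg] at hu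
    refine ⟨f, fun q => ?_, by linarith⟩
    by_contra! hneg
    have := hf _ (hmem (u / f (e q)) (div_nonneg_of_nonpos hu0.le hneg.le) q)
    rw [map_smul, smul_eq_mul, div_mul_cancel₀ _ hneg.ne] at this
    exact lt_irrefl _ this
  choose f hf hfp using hsep
  obtain ⟨t, ht⟩ := isCompact_univ.elim_finite_subcover (fun p => {q : X | 0 < f p (e q)})
    (fun p => isOpen_lt continuous_const ((f p).continuous.comp hcont))
    (fun p _ => Set.mem_iUnion.2 ⟨p, hfp p⟩)
  refine ⟨∑ p ∈ t, f p, fun q => ?_⟩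
  obtain ⟨p, hp⟩ := Set.mem_iUnion.1 (ht (Set.mem_univ q))
  obtain ⟨hpt, hpq⟩ := Set.mem_iUnion.1 hp
  rw [sum_apply]
  exact Finset.sum_pos' (fun i _ => hf i q) ⟨p, hpt, hpq⟩

/-- A compact geodesically convex subset of the sphere is spanned by the points which are not
midpoints of geodesics. -/
theorem exists_cone_coefficients [CompactSpace X] (hL : IsLengthSpace X) {e : X → E3}
    (he : ∀ p q, ⟪e p, e q⟫ = Real.cos (dist p q)) (hπ : ∀ p q : X, dist p q < Real.pi)
    {ι : Type*} [Fintype ι] (vert : ι → X)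
    (hmid : ∀ p ∉ Set.range vert, ∃ a b, ∃ s > 0, s < Real.pi / 2 ∧ dist a p = s ∧ dist p b = s ∧
      dist a b = 2 * s) (p : X) :
    ∃ c : ι → ℝ, (∀ i, 0 ≤ c i) ∧ e p = ∑ i, c i • e (vert i) := by
  have hself : ∀ z, ⟪e z, e z⟫ = 1 := fun z => by rw [he, dist_self, Real.cos_zero]
  have hnorm := norm_of_inner_eq_cos he
  have hcont := continuous_of_angle_eq_dist hnorm (angle_eq_dist he hπ)
  set C : Set E3 := {x | ∃ t : ℝ, 0 < t ∧ ∃ m, x = t • e m} with hC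
  have hCconv : Convex ℝ C := by
    rintro x ⟨t, ht, m, rfl⟩ y ⟨t', ht', m', rfl⟩ a b ha hb hab
    rcases eq_or_lt_of_le ha with h0 | h0
    · exact ⟨t', ht', m', by rw [← h0, show b = 1 by linarith]; simp⟩
    rcases eq_or_lt_of_le hb with h1 | h1
    · exact ⟨t, ht, m, by rw [← h1, show a = 1 by linarith]; simp⟩
    obtain ⟨τ, hτ, n, hn⟩ := exists_smul_eq_add hL he hπ m m' (mul_pos h0 ht) (mul_pos h1 ht')
    exact ⟨τ, hτ, n, by rw [smul_smul, smul_smul, hn]⟩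
  obtain ⟨l, hlpos⟩ := exists_pos_functional hL he hπ
  -- Central projection to the affine plane `l = 1` turns the cone into a compact convex set, to
  -- which Krein–Milman applies.
  set e' : X → E3 := fun q => (l (e q))⁻¹ • e q with he'
  have hle' : ∀ q, l (e' q) = 1 := fun q => by
    rw [he']
    simp [(hlpos q).ne']
  have hcont' : Continuous e' :=
    ((l.continuous.comp hcont).inv₀ fun q => (hlpos q).ne').smul hcont
  have hK'comp : IsCompact (Set.range e') := isCompact_range hcont'
  have hK'conv : Convex ℝ (Set.range e') := by
    rintro _ ⟨q, rfl⟩ _ ⟨q', rfl⟩ a b ha hb hab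
    obtain ⟨t, ht, m, hm⟩ := hCconv ⟨(l (e q))⁻¹, inv_pos.2 (hlpos q), q, rfl⟩
      ⟨(l (e q'))⁻¹, inv_pos.2 (hlpos q'), q', rfl⟩ ha hb hab
    refine ⟨m, ?_⟩
    have hl1 : t * l (e m) = 1 := by
      have h2 : l (a • e' q + b • e' q') = l (t • e m) := congrArg l hm
      rw [map_add, map_smul l t, map_smul l a (e' q), map_smul l b (e' q'), hle', hle',
        smul_eq_mul, smul_eq_mul, smul_eq_mul] at h2
      linarith
    change (l (e m))⁻¹ • e m = _
    rw [show (l (e m))⁻¹ = t from (eq_inv_of_mul_eq_one_left hl1).symm]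
    exact hm.symm
  have hext : (Set.range e').extremePoints ℝ ⊆ Set.range (e' ∘ vert) := by
    rintro x hx
    obtain ⟨⟨q, rfl⟩, hmin⟩ := hx
    by_cases hq : q ∈ Set.range vert
    · obtain ⟨i, rfl⟩ := hq
      exact ⟨i, rfl⟩
    exfalso
    obtain ⟨a, b, s, hs0, hsπ, hap, hpb, hab⟩ := hmid q hq
    have hsum := add_eq_smul_of_inner (hself a) (hself q) (hself b) (by rw [he, hap])
      (by rw [he, hpb]) (by rw [he, hab])
    have hcos : 0 < Real.cos s := Real.cos_pos_of_mem_Ioo ⟨by linarith, hsπ⟩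
    have hq' : 0 < 2 * Real.cos s * l (e q) := mul_pos (by positivity) (hlpos q)
    have hlsum : l (e a) + l (e b) = 2 * Real.cos s * l (e q) := by
      rw [← map_add, hsum, map_smul, smul_eq_mul]
    -- From `e a + e b = 2 cos s • e q`, after normalization by `l`: the weights are the heights of
    -- `e a` and `e b` divided by their sum. So the midpoint of a geodesic is not extreme.
    have hseg : e' q ∈ openSegment ℝ (e' a) (e' b) := by
      refine ⟨l (e a) / (2 * Real.cos s * l (e q)), l (e b) / (2 * Real.cos s * l (e q)),
        div_pos (hlpos a) hq', div_pos (hlpos b) hq', ?_, ?_⟩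
      · rw [← add_div, hlsum, div_self hq'.ne']
      · have ha' := (hlpos a).ne'
        have hb' := (hlpos b).ne'
        have hqq := (hlpos q).ne'
        have e1 : l (e a) / (2 * Real.cos s * l (e q)) * (l (e a))⁻¹ =
          (2 * Real.cos s * l (e q))⁻¹ := by field_simp
        have e2 : l (e b) / (2 * Real.cos s * l (e q)) * (l (e b))⁻¹ =
          (2 * Real.cos s * l (e q))⁻¹ := by field_simp
        simp only [he', smul_smul]
        rw [e1, e2, ← smul_add, hsum, smul_smul]
        congr 1
        field_simp
    have haq : e' a = e' q := hmin ⟨a, rfl⟩ ⟨b, rfl⟩ hseg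
    have hnn := congrArg norm haq
    simp only [he', norm_smul, hnorm, mul_one, Real.norm_eq_abs,
      abs_of_pos (inv_pos.2 (hlpos _))] at hnn
    have haq' : e a = e q := by
      simp only [he'] at haq
      rw [hnn] at haq
      exact smul_right_injective E3 (inv_pos.2 (hlpos q)).ne' haq
    have h1 := he a q
    rw [haq', hself, hap] at h1
    have := Real.cos_lt_cos_of_nonneg_of_le_pi le_rfl (by linarith [Real.pi_pos]) hs0
    rw [Real.cos_zero] at this
    linarith
  set S : Set E3 := {x | ∃ c : ι → ℝ, (∀ i, 0 ≤ c i) ∧ x = ∑ i, c i • e (vert i)} with hS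
  have hSconv : Convex ℝ S := by
    rintro _ ⟨c, hc, rfl⟩ _ ⟨c', hc', rfl⟩ a b ha hb -
    refine ⟨fun i => a * c i + b * c' i,
      fun i => add_nonneg (mul_nonneg ha (hc i)) (mul_nonneg hb (hc' i)), ?_⟩
    simp only [Finset.smul_sum, smul_smul, add_smul, Finset.sum_add_distrib]
  have hSv : Set.range (e' ∘ vert) ⊆ S := by
    classical
    rintro _ ⟨i, rfl⟩
    refine ⟨Pi.single i (l (e (vert i)))⁻¹, fun j => ?_, ?_⟩
    · by_cases hji : j = i
      · subst hji
        simpa using (hlpos _).le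
      · simp [hji]
    · simp [Pi.single_apply, ite_smul, he']
  have hp : e' p ∈ S := by
    have h1 : e' p ∈ closure (convexHull ℝ ((Set.range e').extremePoints ℝ)) := by
      rw [closure_convexHull_extremePoints hK'comp hK'conv]
      exact ⟨p, rfl⟩
    have h2 := closure_mono (convexHull_mono hext) h1
    rw [((Set.finite_range (e' ∘ vert)).isClosed_convexHull ℝ).closure_eq] at h2
    exact convexHull_min hSv hSconv h2
  obtain ⟨c, hc, hpc⟩ := hp
  refine ⟨fun i => l (e p) * c i, fun i => mul_nonneg (hlpos p).le (hc i), ?_⟩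
  simp only [← smul_smul]
  rw [← Finset.smul_sum, ← hpc, he', smul_smul, mul_inv_cancel₀ (hlpos p).ne', one_smul]

/-- Inside a full spherical ball, the point opposite to `y` is the one with image `2 cos s • f p - f
y`; radii below `π / 2` make the doubled distance a genuine angle. Together with its failure at the
edge, this metric property tells interior points from boundary points. -/
theorem exists_reflection_of_chart {f : X → E3} {p : X} {r : ℝ} (h : IsSphericalChartAt f p r) :
    ∃ ρ > 0, ∀ y ∈ Metric.ball p ρ, ∃ q, dist p q = dist y p ∧ dist y q = 2 * dist y p := by
  have hpi := Real.pi_pos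
  refine ⟨min r (Real.pi / 2), lt_min h.pos (by positivity), fun y hy => ?_⟩
  rw [Metric.mem_ball] at hy
  have hyr : y ∈ Metric.ball p r := lt_of_lt_of_le hy (min_le_left _ _)
  have hys : dist y p < Real.pi / 2 := lt_of_lt_of_le hy (min_le_right _ _)
  have hp : p ∈ Metric.ball p r := Metric.mem_ball_self h.pos
  set s := dist y p with hs
  have hs0 : 0 ≤ s := dist_nonneg
  have hpp := inner_self_of_unit (h.norm_eq p hp)
  have hyy := inner_self_of_unit (h.norm_eq y hyr)
  have hpy : ⟪f p, f y⟫ = Real.cos s := by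
    rw [inner_eq_cos_angle_of_norm_eq_one (h.norm_eq p hp) (h.norm_eq y hyr),
      h.angle_eq p hp y hyr, dist_comm]
  have hyp : ⟪f y, f p⟫ = Real.cos s := by rw [real_inner_comm, hpy]
  set v : E3 := (2 * Real.cos s) • f p - f y with hv
  have hvn : ‖v‖ = 1 := by
    apply norm_eq_one_of_inner_self
    simp only [hv, inner_sub_left, inner_sub_right, real_inner_smul_left, real_inner_smul_right,
      hpp, hyy, hpy, hyp]
    ring
  have hav : angle (f p) v = s := by
    apply angle_eq_of_inner_eq_cos (h.norm_eq p hp) hvn hs0 (by linarith)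
    simp only [hv, inner_sub_right, real_inner_smul_right, hpp, hpy]
    ring
  obtain ⟨q, hq, hqv⟩ := h.surj v hvn (by rw [hav]; exact hyr)
  refine ⟨q, ?_, ?_⟩
  · rw [← h.angle_eq p hp q hq, hqv, hav]
  · rw [← h.angle_eq y hyr q hq, hqv]
    apply angle_eq_of_inner_eq_cos (h.norm_eq y hyr) hvn (by positivity) (by linarith)
    simp only [hv, inner_sub_right, real_inner_smul_right, hyy, hyp, Real.cos_two_mul]
    ring

/-- Near a boundary point, some geodesics cannot be prolonged. -/
theorem exists_no_reflection_of_sector {bd : Set X} {p : X} {α : ℝ} (hα : 0 < α) (hα1 : α ≤ 1)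
    (h : HasSectorNhd bd p α) : ∀ ρ > 0, ∃ y ∈ Metric.ball p ρ, ∀ q, dist p q = dist y p →
      dist y q ≠ 2 * dist y p := by
  have hpi := Real.pi_pos
  intro ρ hρ
  obtain ⟨r, hr, hrπ, F, hF0, hFd, hFs, -⟩ := h
  obtain ⟨s, hs0, hsr, hsρ⟩ : ∃ s, 0 < s ∧ s < r ∧ s < ρ :=
    ⟨min r ρ / 2, by positivity, by linarith [min_le_left r ρ, lt_min hr hρ],
      by linarith [min_le_right r ρ, lt_min hr hρ]⟩
  have hπα : 0 < Real.pi * α := by positivity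
  have hdist : ∀ φ ∈ Set.Ico 0 r, ∀ ψ ∈ Set.Icc 0 (Real.pi * α), dist p (F φ ψ) = φ := by
    intro φ hφ ψ hψ
    rw [← hF0, hFd 0 ⟨le_rfl, hr⟩ 0 ⟨le_rfl, hπα.le⟩ φ hφ ψ hψ,
      sectorDist_vertex hφ.1 (by linarith [hφ.2])]
  have hs : s ∈ Set.Ico 0 r := ⟨hs0.le, hsr⟩
  -- A point on the bisector makes an angle at most `π / 2` at `p` with every other point of the
  -- sector, so nothing lies opposite to it.
  have hψ₀ : Real.pi * α / 2 ∈ Set.Icc 0 (Real.pi * α) := ⟨by positivity, by linarith⟩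
  have hys : dist (F s (Real.pi * α / 2)) p = s := by rw [dist_comm, hdist s hs _ hψ₀]
  refine ⟨F s (Real.pi * α / 2), by rw [Metric.mem_ball, hys]; exact hsρ, fun q hpq hyq => ?_⟩
  rw [hys] at hpq hyq
  obtain ⟨φ, hφ, ψ, hψ, rfl⟩ := hFs q (by rw [Metric.mem_ball, dist_comm, hpq]; exact hsr)
  rw [hdist φ hφ ψ hψ] at hpq
  subst hpq
  rw [hFd φ hφ _ hψ₀ φ hφ ψ hψ] at hyq
  have hcos := congrArg Real.cos hyq
  have habs : |Real.pi * α / 2 - ψ| ≤ Real.pi / 2 := by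
    have : Real.pi * α ≤ Real.pi := by nlinarith
    rw [abs_le]; constructor <;> linarith [hψ.1, hψ.2]
  rw [cos_sectorDist, min_eq_left (by linarith), Real.cos_two_mul] at hcos
  have hsin : 0 < Real.sin φ := Real.sin_pos_of_pos_of_lt_pi hs0 (by linarith)
  have hge : 0 ≤ Real.cos |Real.pi * α / 2 - ψ| :=
    Real.cos_nonneg_of_mem_Icc ⟨by linarith [abs_nonneg (Real.pi * α / 2 - ψ)], habs⟩
  nlinarith [Real.sin_sq_add_cos_sq φ, mul_pos hsin hsin]

/-- The bounding diameter of the half-disc, `ψ = 0` and `ψ = π`, is a geodesic through its centre.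
-/
theorem exists_midpoint_of_half_disc {bd : Set X} {p : X} (h : HasSectorNhd bd p 1) :
    ∃ a b, ∃ s > 0, s < Real.pi / 2 ∧ dist a p = s ∧ dist p b = s ∧ dist a b = 2 * s := by
  have hpi := Real.pi_pos
  obtain ⟨r, hr, hrπ, F, hF0, hFd, hFs, -⟩ := h
  rw [mul_one] at hFd
  have hs : r / 2 ∈ Set.Ico 0 r := ⟨by positivity, by linarith⟩
  have h0 : (0 : ℝ) ∈ Set.Icc 0 Real.pi := ⟨le_rfl, hpi.le⟩
  have hπ : Real.pi ∈ Set.Icc 0 Real.pi := ⟨hpi.le, le_rfl⟩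
  have hdist : ∀ ψ ∈ Set.Icc 0 Real.pi, dist p (F (r / 2) ψ) = r / 2 := by
    intro ψ hψ
    rw [← hF0, hFd 0 ⟨le_rfl, hr⟩ 0 h0 _ hs ψ hψ, sectorDist_vertex hs.1 (by linarith)]
  refine ⟨F (r / 2) 0, F (r / 2) Real.pi, r / 2, by positivity, by linarith, ?_, hdist _ hπ, ?_⟩
  · rw [dist_comm, hdist _ h0]
  · rw [hFd _ hs _ h0 _ hs _ hπ, sectorDist, zero_sub, abs_neg, abs_of_pos hpi, min_self,
      Real.cos_pi]
    have : Real.cos (r / 2) * Real.cos (r / 2) + Real.sin (r / 2) * Real.sin (r / 2) * -1 =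
        Real.cos (2 * (r / 2)) := by
      rw [Real.cos_two_mul]
      nlinarith [Real.sin_sq_add_cos_sq (r / 2)]
    rw [this, Real.arccos_cos (by positivity) (by linarith)]

end Image

/-- Unit inward normals of the cone spanned by a basis. -/
theorem exists_dual_normals {x : Fin 3 → E3} (hx : Submodule.span ℝ (Set.range x) = ⊤) :
    ∃ n : Fin 3 → E3, (∀ i, ‖n i‖ = 1) ∧ LinearIndependent ℝ n ∧ (∀ i, 0 < ⟪n i, x i⟫) ∧
      (∀ i j, j ≠ i → ⟪n j, x i⟫ = 0) ∧
      ∀ v, ∃ c : Fin 3 → ℝ, v = ∑ i, c i • x i ∧ ∀ i, 0 ≤ ⟪n i, v⟫ → 0 ≤ c i := by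
  have hli : LinearIndependent ℝ x :=
    linearIndependent_of_top_le_span_of_card_eq_finrank hx.ge (by simp)
  set b := Module.Basis.mk hli hx.ge with hb
  have hbx : ∀ i, b i = x i := fun i => by rw [hb, Module.Basis.mk_apply]
  -- The dual basis, represented by vectors; the normals are its normalizations, and the coordinates
  -- of `v` are its products with these.
  set N : Fin 3 → E3 := fun i =>
    (InnerProductSpace.toDual ℝ E3).symm (LinearMap.toContinuousLinearMap (b.coord i)) with hN
  have hNi : ∀ i v, ⟪N i, v⟫ = b.coord i v := fun i v => by
    rw [hN, InnerProductSpace.toDual_symm_apply]; rfl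
  have hNx : ∀ i j, ⟪N i, x j⟫ = if i = j then 1 else 0 := fun i j => by
    rw [hNi, ← hbx, Module.Basis.coord_apply, Module.Basis.repr_self, Finsupp.single_apply]
    simp [eq_comm]
  have hN0 : ∀ i, N i ≠ 0 := fun i h => by
    have := hNx i i
    rw [h] at this
    simp at this
  have hpos : ∀ i, 0 < ‖N i‖⁻¹ := fun i => inv_pos.2 (norm_pos_iff.2 (hN0 i))
  have hoff : ∀ i j, j ≠ i → ⟪‖N j‖⁻¹ • N j, x i⟫ = 0 := fun i j hji => by
    rw [real_inner_smul_left, hNx, if_neg hji, mul_zero]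
  have hon : ∀ i, 0 < ⟪‖N i‖⁻¹ • N i, x i⟫ := fun i => by
    rw [real_inner_smul_left, hNx, if_pos rfl, mul_one]
    exact hpos i
  refine ⟨fun i => ‖N i‖⁻¹ • N i, fun i => norm_smul_inv_norm (hN0 i), ?_, hon, hoff, ?_⟩
  · rw [Fintype.linearIndependent_iff]
    intro g hg j
    have := congrArg (fun z => ⟪z, x j⟫) hg
    simp only [sum_inner, inner_zero_left] at this
    rw [Finset.sum_eq_single j] at this
    · rw [real_inner_smul_left] at this
      exact (mul_eq_zero.1 this).resolve_right (hon j).ne'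
    · intro i _ hij
      rw [real_inner_smul_left, hoff j i hij, mul_zero]
    · simp
  · intro v
    refine ⟨fun i => b.coord i v, ?_, fun i hi => ?_⟩
    · have := (b.sum_repr v).symm
      simpa only [hbx, Module.Basis.coord_apply] using this
    · simp only [← hNi]
      rw [real_inner_smul_left] at hi
      exact nonneg_of_mul_nonneg_right hi (hpos i)

/-- The disc underlying a polygon, with the topology of its distance. -/
def spaceHomeomorph (g : DiscMetric) : g.Space ≃ₜ Disc where
  toFun x := x
  invFun x := x
  left_inv _ := rfl
  right_inv _ := rfl
  continuous_toFun := continuous_def.2 fun s hs =>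
    show IsOpen[g.toMetricSpace.toPseudoMetricSpace.toUniformSpace.toTopologicalSpace] s from
      g.topology_eq ▸ hs
  continuous_invFun := continuous_def.2 fun s hs =>
    show IsOpen[instTopologicalSpaceSubtype] s from g.topology_eq ▸ hs

/-- A spherical triangle with angles less than `π` is isometric to a triangle in the sphere. -/
theorem exists_isTriangleModel (T : SphericalPolygon 3) (hα : ∀ i, T.angle i < 1) :
    ∃ n e, IsTriangleModel T.metric.boundary T.vertex n e := by
  have hpi := Real.pi_pos
  set H := spaceHomeomorph T.metric
  have hcompact : CompactSpace T.metric.Space := H.symm.compactSpace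
  have hL := T.isLengthSpace
  have hlocal : ∀ p : T.metric.Space, ∃ f : T.metric.Space → E3, IsDevelopingAt f p := by
    intro p
    by_cases hp : p ∈ T.metric.boundary
    · by_cases hv : p ∈ Set.range T.vertex
      · obtain ⟨i, rfl⟩ := hv
        exact exists_isDevelopingAt_of_sector (T.angle_pos i) (hα i).le (T.vertex_chart i)
      · exact exists_isDevelopingAt_of_sector one_pos le_rfl (T.edge_chart p hp hv)
    · obtain ⟨f, r, hf⟩ := T.interior_chart p hp
      exact ⟨f, isDevelopingAt_of_chart hf⟩
  obtain ⟨e, hdev⟩ := exists_global_developing H hlocal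
  have he := inner_eq_cos_dist hL hdev
  have hπ := dist_lt_pi_of_vertices hL he (isPreconnected_compl_pair H) T.vertex_injective
    (fun i => ⟨T.angle_pos i, hα i⟩) T.vertex_chart
  have hnorm := norm_of_inner_eq_cos he
  have hangle := angle_eq_dist he hπ
  have hself : ∀ z, ⟪e z, e z⟫ = 1 := fun z => by rw [he, dist_self, Real.cos_zero]
  have hmid : ∀ p ∉ Set.range T.vertex, ∃ a b, ∃ s > 0, s < Real.pi / 2 ∧ dist a p = s ∧
      dist p b = s ∧ dist a b = 2 * s := by
    intro p hv
    by_cases hp : p ∈ T.metric.boundary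
    · exact exists_midpoint_of_half_disc (T.edge_chart p hp hv)
    · obtain ⟨f, r, hf⟩ := T.interior_chart p hp
      obtain ⟨ρ, hρ, hrefl⟩ := exists_reflection_of_chart hf
      have hpv : 0 < dist p (T.vertex 0) := dist_pos.2 fun h => hv ⟨0, h.symm⟩
      -- Any point at distance exactly `s` from `p` would do; one is taken on a shortest path to
      -- vertex `0`, which merely serves as a point different from `p`.
      set s := min (min ρ Real.pi) (dist p (T.vertex 0)) / 3 with hs
      have hmin : 0 < min (min ρ Real.pi) (dist p (T.vertex 0)) := lt_min (lt_min hρ hpi) hpv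
      have h1 := min_le_right (min ρ Real.pi) (dist p (T.vertex 0))
      have h2 := (min_le_left (min ρ Real.pi) (dist p (T.vertex 0))).trans (min_le_left _ _)
      have h3 := (min_le_left (min ρ Real.pi) (dist p (T.vertex 0))).trans (min_le_right _ _)
      obtain ⟨y, hy, -⟩ := exists_between hL p (T.vertex 0) (t := s) (by positivity) (by linarith)
      have hyp : dist y p = s := by rw [dist_comm, hy]
      obtain ⟨q, hpq, hyq⟩ := hrefl y (by rw [Metric.mem_ball, hyp]; linarith)
      exact ⟨y, q, s, by positivity, by linarith, hyp, by rw [hpq, hyp], by rw [hyq, hyp]⟩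
  have hcone := exists_cone_coefficients hL he hπ T.vertex hmid
  have hspan : Submodule.span ℝ (Set.range fun i => e (T.vertex i)) = ⊤ := by
    rw [eq_top_iff, ← (hdev (T.vertex 0)).2 1 one_pos, Submodule.span_le]
    rintro _ ⟨q, -, rfl⟩
    obtain ⟨c, -, hc⟩ := hcone q
    rw [hc]
    exact Submodule.sum_mem _ fun i _ =>
      Submodule.smul_mem _ _ (Submodule.subset_span ⟨i, rfl⟩)
  obtain ⟨n, hn1, hnli, hnpos, hnoff, hncoef⟩ := exists_dual_normals hspan
  have hnonneg : ∀ p i, 0 ≤ ⟪n i, e p⟫ := by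
    intro p i
    obtain ⟨c, hc, hpc⟩ := hcone p
    rw [hpc, inner_sum]
    refine Finset.sum_nonneg fun j _ => ?_
    rw [real_inner_smul_right]
    by_cases hij : i = j
    · rw [hij]
      exact mul_nonneg (hc j) (hnpos j).le
    · rw [hnoff j i hij, mul_zero]
  have hsurj : ∀ v, ‖v‖ = 1 → (∀ i, 0 ≤ ⟪n i, v⟫) → ∃ p, e p = v := by
    intro v hv hvn
    obtain ⟨c, hvc, hc⟩ := hncoef v
    obtain ⟨t, ht, m, hm⟩ := exists_smul_eq_sum hL he hπ Finset.univ T.vertex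
      (fun i => hc i (hvn i)) (T.vertex 0)
    rw [← hvc] at hm
    have h1 := congrArg norm hm
    rw [hv, norm_smul, hnorm, mul_one, Real.norm_eq_abs, abs_of_nonneg ht] at h1
    exact ⟨m, by rw [hm, ← h1, one_smul]⟩
  have hreflect : ∀ p y q : T.metric.Space, dist p q = dist y p → dist y q = 2 * dist y p →
      e y + e q = (2 * Real.cos (dist y p)) • e p := fun p y q h1 h2 =>
    add_eq_smul_of_inner (hself y) (hself p) (hself q) (he y p) (by rw [he, h1])
      (by rw [he, h2])
  refine ⟨n, e, hn1, hnli, hnorm, hangle, hnonneg, hsurj, fun p => ⟨fun hp => ?_, ?_⟩, hnoff⟩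
  · by_contra! hne
    -- A point off the three planes has a full spherical ball around it, so nearby points can be
    -- reflected through it; at a boundary point the bisector of the sector forbids this.
    have hpos : ∀ i, 0 < ⟪n i, e p⟫ := fun i => lt_of_le_of_ne (hnonneg p i) (Ne.symm (hne i))
    obtain ⟨r, hr, hri⟩ : ∃ r, 0 < r ∧ ∀ i, r ≤ ⟪n i, e p⟫ := by
      obtain ⟨i, -, hi⟩ := Finset.exists_min_image Finset.univ (fun i => ⟪n i, e p⟫)
        ⟨0, Finset.mem_univ _⟩
      exact ⟨_, hpos i, fun j => hi j (Finset.mem_univ j)⟩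
    have hchart : IsSphericalChartAt e p r := by
      refine ⟨hr, fun q _ => hnorm q, fun q _ q' _ => hangle q q', fun v hv hvr => ?_⟩
      obtain ⟨q, hq⟩ := hsurj v hv fun i => by
        have := inner_sub_angle_le (hn1 i) (hnorm p) hv
        linarith [hri i]
      refine ⟨q, ?_, hq⟩
      rw [Metric.mem_ball, dist_comm, ← hangle, hq]
      exact hvr
    obtain ⟨ρ, hρ, hrefl⟩ := exists_reflection_of_chart hchart
    obtain ⟨α, hα0, hα1, hsec⟩ : ∃ α, 0 < α ∧ α ≤ 1 ∧ HasSectorNhd T.metric.boundary p α := by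
      by_cases hv : p ∈ Set.range T.vertex
      · obtain ⟨i, rfl⟩ := hv
        exact ⟨_, T.angle_pos i, (hα i).le, T.vertex_chart i⟩
      · exact ⟨1, one_pos, le_rfl, T.edge_chart p hp hv⟩
    obtain ⟨y, hy, hno⟩ := exists_no_reflection_of_sector hα0 hα1 hsec ρ hρ
    obtain ⟨q, h1, h2⟩ := hrefl y hy
    exact hno q h1 h2
  · rintro ⟨i, hi⟩
    by_contra hp
    obtain ⟨f, r, hf⟩ := T.interior_chart p hp
    obtain ⟨ρ, hρ, hrefl⟩ := exists_reflection_of_chart hf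
    -- A nonnegative functional vanishing at an interior point vanishes at every nearby `y`, since
    -- the values at `y` and at its reflection add up to zero. The images of these `y` span, so the
    -- functional is zero.
    have hzero : n i = 0 := by
      apply eq_of_inner_eq_on_span ((hdev p).2 ρ hρ)
      rintro _ ⟨y, hy, rfl⟩
      rw [inner_zero_right, real_inner_comm]
      obtain ⟨q, h1, h2⟩ := hrefl y hy
      have h3 := congrArg (fun z => ⟪n i, z⟫) (hreflect p y q h1 h2)
      simp only [inner_add_right, real_inner_smul_right, hi, mul_zero] at h3
      linarith [hnonneg y i, hnonneg q i]
    have := hn1 i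
    rw [hzero] at this
    simp at this


/-! ### Normals of triangles with prescribed angles -/

theorem cos_add_cos_neg_iff {a t : ℝ} (ha0 : 0 < a) (haπ : a < Real.pi) (ht0 : 0 ≤ t)
    (htπ : t ≤ Real.pi) : Real.cos a + Real.cos t < 0 ↔ Real.pi < a + t := by
  have h : Real.cos (Real.pi - t) = -Real.cos t := Real.cos_pi_sub t
  have := Real.strictAntiOn_cos.lt_iff_gt (a := a) (b := Real.pi - t) ⟨ha0.le, haπ.le⟩
    ⟨by linarith, by linarith⟩
  rw [h] at this
  constructor
  · intro h1; linarith [this.1 (by linarith)]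
  · intro h1; linarith [this.2 (by linarith)]

theorem cos_add_cos_pos_iff {a t : ℝ} (ha0 : 0 < a) (haπ : a < Real.pi) (ht0 : 0 ≤ t)
    (htπ : t ≤ Real.pi) : 0 < Real.cos a + Real.cos t ↔ a + t < Real.pi := by
  have h : Real.cos (Real.pi - t) = -Real.cos t := Real.cos_pi_sub t
  have := Real.strictAntiOn_cos.lt_iff_gt (a := Real.pi - t) (b := a)
    ⟨by linarith, by linarith⟩ ⟨ha0.le, haπ.le⟩
  rw [h] at this
  constructor
  · intro h1; linarith [this.1 (by linarith)]
  · intro h1; linarith [this.2 (by linarith)]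

/-- The Gram determinant of the normals of a triangle is positive exactly for the angles of
convex spherical triangles. -/
theorem gram_pos_iff {a b c : ℝ} (ha : a ∈ Set.Ioo 0 Real.pi) (hb : b ∈ Set.Ioo 0 Real.pi)
    (hc : c ∈ Set.Ioo 0 Real.pi) :
    0 < 1 - Real.cos a ^ 2 - Real.cos b ^ 2 - Real.cos c ^ 2 -
        2 * Real.cos a * Real.cos b * Real.cos c ↔
      a + b - c < Real.pi ∧ a + c - b < Real.pi ∧ b + c - a < Real.pi ∧ Real.pi < a + b + c := by
  have hsb : 0 < Real.sin b := Real.sin_pos_of_pos_of_lt_pi hb.1 hb.2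
  have hsc : 0 < Real.sin c := Real.sin_pos_of_pos_of_lt_pi hc.1 hc.2
  have hbc := mul_pos hsb hsc
  -- The determinant is quadratic in `cos a`, with roots `-cos (b + c)` and `-cos (b - c)`. As `cos
  -- (b + c) < cos (b - c)`, positivity means that `cos a` lies strictly between the roots.
  have hid : 1 - Real.cos a ^ 2 - Real.cos b ^ 2 - Real.cos c ^ 2 -
      2 * Real.cos a * Real.cos b * Real.cos c =
        -((Real.cos a + Real.cos (b + c)) * (Real.cos a + Real.cos (b - c))) := by
    rw [Real.cos_add, Real.cos_sub]
    have h1 := Real.sin_sq_add_cos_sq b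
    have h2 := Real.sin_sq_add_cos_sq c
    have h3 : Real.sin b ^ 2 * Real.sin c ^ 2 = (1 - Real.cos b ^ 2) * (1 - Real.cos c ^ 2) := by
      rw [← Real.sin_sq, ← Real.sin_sq]
    linear_combination -h3
  have hlt : Real.cos (b + c) < Real.cos (b - c) := by
    rw [Real.cos_add, Real.cos_sub]; linarith
  have hfact : 0 < -((Real.cos a + Real.cos (b + c)) * (Real.cos a + Real.cos (b - c))) ↔
      Real.cos a + Real.cos (b + c) < 0 ∧ 0 < Real.cos a + Real.cos (b - c) := by
    constructor
    · intro h
      constructor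
      · by_contra! h1
        have : 0 ≤ Real.cos a + Real.cos (b - c) := by linarith
        nlinarith [mul_nonneg h1 this]
      · by_contra! h1
        have : Real.cos a + Real.cos (b + c) ≤ 0 := by linarith
        nlinarith [mul_nonneg_of_nonpos_of_nonpos this h1]
    · rintro ⟨h1, h2⟩
      nlinarith [mul_pos (neg_pos.2 h1) h2]
  have h1 : Real.cos a + Real.cos (b + c) < 0 ↔ Real.pi < a + b + c ∧ b + c - a < Real.pi := by
    rcases le_total (b + c) Real.pi with h | h
    · rw [cos_add_cos_neg_iff ha.1 ha.2 (by linarith [hb.1, hc.1]) h]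
      constructor
      · intro h'; exact ⟨by linarith, by linarith [ha.1]⟩
      · intro h'; linarith [h'.1]
    -- When `b + c` exceeds `π` it is folded back into `[0, π]`. In each of the two ranges one of
    -- the inequalities on the right is automatic.
    · have h2 : Real.cos (b + c) = Real.cos (2 * Real.pi - (b + c)) := by
        rw [Real.cos_two_pi_sub]
      rw [h2, cos_add_cos_neg_iff ha.1 ha.2 (by linarith [hb.2, hc.2]) (by linarith)]
      constructor
      · intro h'; exact ⟨by linarith [ha.1], by linarith⟩
      · intro h'; linarith [h'.2]
  have h2 : 0 < Real.cos a + Real.cos (b - c) ↔ a + b - c < Real.pi ∧ a + c - b < Real.pi := by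
    rw [← Real.cos_abs (b - c), cos_add_cos_pos_iff ha.1 ha.2 (abs_nonneg _)
      (by rw [abs_le]; constructor <;> linarith [hb.1, hb.2, hc.1, hc.2])]
    constructor
    · intro h
      exact ⟨by linarith [le_abs_self (b - c)], by linarith [neg_abs_le (b - c)]⟩
    · rintro ⟨h3, h4⟩
      rcases abs_cases (b - c) with h5 | h5 <;> linarith [h5.1]
  rw [hid, hfact, h1, h2]
  tauto

/-- The angles (in units of `π`) of the convex spherical triangles without flat angles. -/
def angleRegion : Set (Fin 3 → ℝ) :=
  {ν | (∀ i, ν i ∈ Set.Ioo (0 : ℝ) 1) ∧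
    (1 - ν 0 < (1 - ν 1) + (1 - ν 2) ∧ 1 - ν 1 < (1 - ν 2) + (1 - ν 0) ∧
      1 - ν 2 < (1 - ν 0) + (1 - ν 1)) ∧ 0 < ν 0 + ν 1 + ν 2 - 1}

/-- The vectors `n i` are the inward unit normals of a triangle with angles `π * ν i`. -/
structure HasAngles (n : Fin 3 → E3) (ν : Fin 3 → ℝ) : Prop where
  norm_normal : ∀ i, ‖n i‖ = 1
  linearIndependent : LinearIndependent ℝ n
  inner_normal : ∀ i j k, i ≠ j → i ≠ k → j ≠ k → ⟪n j, n k⟫ = -Real.cos (Real.pi * ν i)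

theorem det_gram_normals {n : Fin 3 → E3} {ν : Fin 3 → ℝ} (h1 : ∀ i, ‖n i‖ = 1)
    (h : ∀ i j k, i ≠ j → i ≠ k → j ≠ k → ⟪n j, n k⟫ = -Real.cos (Real.pi * ν i)) :
    (Matrix.gram ℝ n).det = 1 - Real.cos (Real.pi * ν 0) ^ 2 - Real.cos (Real.pi * ν 1) ^ 2 -
      Real.cos (Real.pi * ν 2) ^ 2 - 2 * Real.cos (Real.pi * ν 0) * Real.cos (Real.pi * ν 1) *
        Real.cos (Real.pi * ν 2) := by
  rw [Matrix.det_fin_three]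
  simp only [Matrix.gram_apply, inner_self_of_unit (h1 _),
    h 0 1 2 (by decide) (by decide) (by decide), h 0 2 1 (by decide) (by decide) (by decide),
    h 1 0 2 (by decide) (by decide) (by decide), h 1 2 0 (by decide) (by decide) (by decide),
    h 2 0 1 (by decide) (by decide) (by decide), h 2 1 0 (by decide) (by decide) (by decide)]
  ring

theorem gram_pos_iff_region {ν : Fin 3 → ℝ} (hν : ∀ i, ν i ∈ Set.Ioo (0 : ℝ) 1) :
    0 < 1 - Real.cos (Real.pi * ν 0) ^ 2 - Real.cos (Real.pi * ν 1) ^ 2 -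
      Real.cos (Real.pi * ν 2) ^ 2 - 2 * Real.cos (Real.pi * ν 0) * Real.cos (Real.pi * ν 1) *
        Real.cos (Real.pi * ν 2) ↔ ν ∈ angleRegion := by
  have hpi := Real.pi_pos
  have hmem : ∀ i, Real.pi * ν i ∈ Set.Ioo 0 Real.pi := fun i =>
    ⟨mul_pos hpi (hν i).1, by nlinarith [(hν i).2]⟩
  rw [gram_pos_iff (hmem 0) (hmem 1) (hmem 2)]
  have key : ∀ x : ℝ, Real.pi * x < Real.pi ↔ x < 1 := fun x => by
    rw [mul_lt_iff_lt_one_right hpi]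
  have key' : ∀ x : ℝ, Real.pi < Real.pi * x ↔ 1 < x := fun x => by
    rw [lt_mul_iff_one_lt_right hpi]
  rw [← mul_add, ← mul_sub, ← mul_add, ← mul_sub, ← mul_add, ← mul_sub, ← mul_add, key, key, key,
    key']
  constructor
  · rintro ⟨h1, h2, h3, h4⟩
    exact ⟨hν, ⟨by linarith, by linarith, by linarith⟩, by linarith⟩
  · rintro ⟨-, ⟨h1, h2, h3⟩, h4⟩
    exact ⟨by linarith, by linarith, by linarith, by linarith⟩

/-- The Gram matrix of independent vectors is positive definite, so its determinant is positive.
This is the necessity of (i) and (ii). -/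
theorem HasAngles.mem_angleRegion {n : Fin 3 → E3} {ν : Fin 3 → ℝ} (h : HasAngles n ν)
    (hν : ∀ i, ν i ∈ Set.Ioo (0 : ℝ) 1) : ν ∈ angleRegion := by
  rw [← gram_pos_iff_region hν, ← det_gram_normals h.norm_normal h.inner_normal]
  exact (Matrix.posDef_gram_of_linearIndependent h.linearIndependent).det_pos

theorem isOpen_angleRegion : IsOpen angleRegion := by
  have h1 : IsOpen {ν : Fin 3 → ℝ | ∀ i, ν i ∈ Set.Ioo (0 : ℝ) 1} := by
    have : {ν : Fin 3 → ℝ | ∀ i, ν i ∈ Set.Ioo (0 : ℝ) 1} =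
        Set.univ.pi fun _ => Set.Ioo (0 : ℝ) 1 := by ext; simp
    rw [this]
    exact isOpen_set_pi Set.finite_univ fun _ _ => isOpen_Ioo
  have hlt : ∀ f g : (Fin 3 → ℝ) → ℝ, Continuous f → Continuous g → IsOpen {ν | f ν < g ν} :=
    fun f g hf hg => isOpen_lt hf hg
  exact h1.inter (((hlt (fun ν => 1 - ν 0) (fun ν => (1 - ν 1) + (1 - ν 2)) (by fun_prop)
    (by fun_prop)).inter ((hlt (fun ν => 1 - ν 1) (fun ν => (1 - ν 2) + (1 - ν 0)) (by fun_prop)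
      (by fun_prop)).inter (hlt (fun ν => 1 - ν 2) (fun ν => (1 - ν 0) + (1 - ν 1)) (by fun_prop)
        (by fun_prop)))).inter
          (hlt (fun _ => 0) (fun ν => ν 0 + ν 1 + ν 2 - 1) (by fun_prop) (by fun_prop)))

/-- Second coordinate of the last normal in `normals`. -/
noncomputable def normalY (ν : Fin 3 → ℝ) : ℝ :=
  -(Real.cos (Real.pi * ν 0) + Real.cos (Real.pi * ν 1) * Real.cos (Real.pi * ν 2)) /
    Real.sin (Real.pi * ν 2)

/-- Inward unit normals of a standard triangle with angles `π * ν i`. -/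
noncomputable def normals (ν : Fin 3 → ℝ) : Fin 3 → E3 :=
  ![!₂[1, 0, 0], !₂[-Real.cos (Real.pi * ν 2), Real.sin (Real.pi * ν 2), 0],
    !₂[-Real.cos (Real.pi * ν 1), normalY ν,
      Real.sqrt (1 - Real.cos (Real.pi * ν 1) ^ 2 - normalY ν ^ 2)]]

theorem hasAngles_normals {ν : Fin 3 → ℝ} (h : ν ∈ angleRegion) : HasAngles (normals ν) ν := by
  have hpi := Real.pi_pos
  have hD := (gram_pos_iff_region h.1).2 h
  have hs2 : 0 < Real.sin (Real.pi * ν 2) :=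
    Real.sin_pos_of_pos_of_lt_pi (mul_pos hpi (h.1 2).1) (by nlinarith [(h.1 2).2])
  have hsq := Real.sin_sq_add_cos_sq (Real.pi * ν 2)
  have hy : Real.sin (Real.pi * ν 2) * normalY ν =
      -(Real.cos (Real.pi * ν 0) + Real.cos (Real.pi * ν 1) * Real.cos (Real.pi * ν 2)) := by
    rw [normalY, mul_div_cancel₀ _ hs2.ne']
  have hz : 0 ≤ 1 - Real.cos (Real.pi * ν 1) ^ 2 - normalY ν ^ 2 := by
    -- Up to the factor `sin² (π ν 2)`, the square of the last coordinate is the Gram determinant,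
    -- which is why the square root is legitimate exactly on the region.
    have h1 : Real.sin (Real.pi * ν 2) ^ 2 *
        (1 - Real.cos (Real.pi * ν 1) ^ 2 - normalY ν ^ 2) =
        1 - Real.cos (Real.pi * ν 0) ^ 2 - Real.cos (Real.pi * ν 1) ^ 2 -
          Real.cos (Real.pi * ν 2) ^ 2 - 2 * Real.cos (Real.pi * ν 0) *
            Real.cos (Real.pi * ν 1) * Real.cos (Real.pi * ν 2) := by
      have h2 : Real.sin (Real.pi * ν 2) ^ 2 * normalY ν ^ 2 =
        (Real.cos (Real.pi * ν 0) + Real.cos (Real.pi * ν 1) * Real.cos (Real.pi * ν 2)) ^ 2 := by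
        rw [← mul_pow, hy, neg_sq]
      linear_combination -h2 + (1 - Real.cos (Real.pi * ν 1) ^ 2) * hsq
    exact (pos_of_mul_pos_right (h1 ▸ hD) (by positivity)).le
  have hinner : ∀ x y : E3, ⟪x, y⟫ = x 0 * y 0 + x 1 * y 1 + x 2 * y 2 := by
    intro x y
    simp [PiLp.inner_apply, Fin.sum_univ_three, mul_comm]
  have h01 : ⟪normals ν 0, normals ν 1⟫ = -Real.cos (Real.pi * ν 2) := by
    rw [hinner]; simp [normals]
  have h02 : ⟪normals ν 0, normals ν 2⟫ = -Real.cos (Real.pi * ν 1) := by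
    rw [hinner]; simp [normals]
  have h12 : ⟪normals ν 1, normals ν 2⟫ = -Real.cos (Real.pi * ν 0) := by
    rw [hinner]
    simp only [normals, Matrix.cons_val]
    rw [hy]
    ring
  have hunit : ∀ i, ‖normals ν i‖ = 1 := by
    intro i
    apply norm_eq_one_of_inner_self
    rw [hinner]
    fin_cases i
    · simp [normals]
    · simp only [normals, Fin.mk_one, Matrix.cons_val]
      linear_combination hsq
    · simp only [normals, Fin.reduceFinMk, Matrix.cons_val]
      rw [Real.mul_self_sqrt hz]
      ring
  have hall : ∀ i j k, i ≠ j → i ≠ k → j ≠ k →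
      ⟪normals ν j, normals ν k⟫ = -Real.cos (Real.pi * ν i) := by
    intro i j k hij hik hjk
    fin_cases i <;> fin_cases j <;> fin_cases k <;>
      first
        | exact absurd rfl hij
        | exact absurd rfl hik
        | exact absurd rfl hjk
        | exact h01
        | exact h02
        | exact h12
        | exact (real_inner_comm _ _).trans h01
        | exact (real_inner_comm _ _).trans h02
        | exact (real_inner_comm _ _).trans h12
  refine ⟨hunit, Matrix.linearIndependent_of_det_gram_ne_zero (𝕜 := ℝ) ?_, hall⟩
  rw [det_gram_normals hunit hall]
  exact hD.ne'

theorem continuousOn_normals (i : Fin 3) : ContinuousOn (fun ν => normals ν i) angleRegion := by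
  have hpi := Real.pi_pos
  have hy : ContinuousOn normalY angleRegion := by
    refine ContinuousOn.div (by fun_prop) (by fun_prop) fun ν h => ?_
    exact (Real.sin_pos_of_pos_of_lt_pi (mul_pos hpi (h.1 2).1) (by nlinarith [(h.1 2).2])).ne'
  have hpi' : ∀ f : Fin 3 → (Fin 3 → ℝ) → ℝ, (∀ j, ContinuousOn (f j) angleRegion) →
      ContinuousOn (fun ν => (!₂[f 0 ν, f 1 ν, f 2 ν] : E3)) angleRegion := by
    intro f hf
    refine (PiLp.continuous_toLp 2 _).comp_continuousOn (continuousOn_pi.2 fun j => ?_)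
    fin_cases j
    · exact hf 0
    · exact hf 1
    · exact hf 2
  fin_cases i
  · exact continuousOn_const
  · refine hpi' ![fun ν => -Real.cos (Real.pi * ν 2), fun ν => Real.sin (Real.pi * ν 2),
      fun _ => 0] fun j => ?_
    fin_cases j
    · exact Continuous.continuousOn (by dsimp; fun_prop)
    · exact Continuous.continuousOn (by dsimp; fun_prop)
    · exact continuousOn_const
  · refine hpi' ![fun ν => -Real.cos (Real.pi * ν 1), normalY, fun ν =>
      Real.sqrt (1 - Real.cos (Real.pi * ν 1) ^ 2 - normalY ν ^ 2)] fun j => ?_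
    fin_cases j
    · exact Continuous.continuousOn (by dsimp; fun_prop)
    · exact hy
    · exact (ContinuousOn.sub (Continuous.continuousOn (by fun_prop)) (hy.pow 2)).sqrt

/-! ### The linear maps attached to a triple of normals -/

/-- The coordinates `⟪n i, v⟫` of a vector `v`. -/
noncomputable def coordMap (n : Fin 3 → E3) : E3 →L[ℝ] E3 :=
  LinearMap.toContinuousLinearMap
    { toFun := fun v => WithLp.toLp 2 fun i => ⟪n i, v⟫
      map_add' := fun v w => by ext i; simp [inner_add_right]
      map_smul' := fun a v => by ext i; simp [real_inner_smul_right] }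

theorem coordMap_apply (n : Fin 3 → E3) (v : E3) (i : Fin 3) : coordMap n v i = ⟪n i, v⟫ := rfl

theorem isUnit_coordMap {n : Fin 3 → E3} (hn : LinearIndependent ℝ n) : IsUnit (coordMap n) := by
  have hinj : Function.Injective (coordMap n : E3 →ₗ[ℝ] E3) := by
    rw [← LinearMap.ker_eq_bot, LinearMap.ker_eq_bot']
    intro v hv
    apply eq_zero_of_inner_normals hn
    intro i
    have := congrArg (fun w : E3 => w i) hv
    exact this
  set L := (LinearEquiv.ofInjectiveEndo _ hinj).toContinuousLinearEquiv with hL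
  have h1 : coordMap n * (L.symm : E3 →L[ℝ] E3) = 1 := by
    ext1 v
    exact L.apply_symm_apply v
  have h2 : (L.symm : E3 →L[ℝ] E3) * coordMap n = 1 := by
    ext1 v
    exact L.symm_apply_apply v
  exact ⟨⟨coordMap n, L.symm, h1, h2⟩, rfl⟩

/-- The inverse of `coordMap n`. -/
noncomputable def vectorMap (n : Fin 3 → E3) : E3 →L[ℝ] E3 := Ring.inverse (coordMap n)

theorem coordMap_vectorMap {n : Fin 3 → E3} (hn : LinearIndependent ℝ n) (t : E3) :
    coordMap n (vectorMap n t) = t := by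
  have := Ring.mul_inverse_cancel _ (isUnit_coordMap hn)
  exact congrArg (fun L : E3 →L[ℝ] E3 => L t) this

theorem vectorMap_coordMap {n : Fin 3 → E3} (hn : LinearIndependent ℝ n) (v : E3) :
    vectorMap n (coordMap n v) = v := by
  have := Ring.inverse_mul_cancel _ (isUnit_coordMap hn)
  exact congrArg (fun L : E3 →L[ℝ] E3 => L v) this

theorem inner_vectorMap {n : Fin 3 → E3} (hn : LinearIndependent ℝ n) (t : E3) (i : Fin 3) :
    ⟪n i, vectorMap n t⟫ = t i := by
  rw [← coordMap_apply, coordMap_vectorMap hn]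

theorem vectorMap_ne_zero {n : Fin 3 → E3} (hn : LinearIndependent ℝ n) {t : E3} (ht : t ≠ 0) :
    vectorMap n t ≠ 0 := fun h => ht (by rw [← coordMap_vectorMap hn t, h, map_zero])

theorem continuousOn_coordMap : ContinuousOn (fun ν => coordMap (normals ν)) angleRegion := by
  rw [continuousOn_clm_apply]
  intro v
  refine (PiLp.continuous_toLp 2 _).comp_continuousOn (continuousOn_pi.2 fun i => ?_)
  exact (continuousOn_normals i).inner continuousOn_const

theorem continuousOn_vectorMap : ContinuousOn (fun ν => vectorMap (normals ν)) angleRegion := by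
  intro ν hν
  obtain ⟨u, hu⟩ := isUnit_coordMap (hasAngles_normals hν).linearIndependent
  have h1 := NormedRing.inverse_continuousAt u
  rw [hu] at h1
  exact h1.comp_continuousWithinAt (f := fun ν => coordMap (normals ν)) (continuousOn_coordMap ν hν)

/-! ### Distortion of angles by linear maps -/

theorem normSq_sub_normalize_le (p q : E3) :
    ‖p‖ * ‖q‖ * (2 - 2 * Real.cos (angle p q)) ≤ ‖p - q‖ ^ 2 := by
  rw [norm_sub_sq_real, ← cos_angle_mul_norm_mul_norm]
  nlinarith [sq_nonneg (‖p‖ - ‖q‖)]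

/-- Comparing chords before and after `B` gives the ratio `M / m` up to the discrepancy between
chord and arc. That error is quadratic in the angle, so it disappears when an arc is subdivided. -/
theorem angle_map_le_of_small {B : E3 →L[ℝ] E3} {m M : ℝ} (hm : 0 < m)
    (hB : ∀ w, m * ‖w‖ ≤ ‖B w‖) (hB' : ∀ w, ‖B w‖ ≤ M * ‖w‖) {u v : E3} (hu : ‖u‖ = 1)
    (hv : ‖v‖ = 1) : angle (B u) (B v) * (1 - (M / m * angle u v) ^ 2) ≤ M / m * angle u v := by
  have hpi := Real.pi_pos
  have hM : 0 ≤ M := by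
    have h1 := hB u
    have h2 := hB' u
    rw [hu] at h1 h2
    linarith
  have hBu : m ≤ ‖B u‖ := by simpa [hu] using hB u
  have hBv : m ≤ ‖B v‖ := by simpa [hv] using hB v
  set a := angle u v with ha
  set a' := angle (B u) (B v) with ha'
  have ha0 : 0 ≤ a := angle_nonneg _ _
  have ha'0 : 0 ≤ a' := angle_nonneg _ _
  have ha'π : a' ≤ Real.pi := angle_le_pi _ _
  have h1 := normSq_sub_normalize_le (B u) (B v)
  rw [← ha'] at h1
  have h2 : ‖B u - B v‖ ≤ M * a := by
    rw [← map_sub]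
    refine (hB' _).trans (mul_le_mul_of_nonneg_left ?_ hM)
    rw [ha, angle_comm]
    exact norm_sub_le_angle hv hu
  have hsin : 2 - 2 * Real.cos a' = (2 * Real.sin (a' / 2)) ^ 2 := by
    have : Real.cos a' = 1 - 2 * Real.sin (a' / 2) ^ 2 := by
      rw [← Real.cos_two_mul_eq_one_sub (a' / 2)]; ring_nf
    rw [this]; ring
  have hs0 : 0 ≤ Real.sin (a' / 2) :=
    Real.sin_nonneg_of_nonneg_of_le_pi (by linarith) (by linarith)
  have h3 : m * (2 * Real.sin (a' / 2)) ≤ M * a := by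
    have h4 : (m * (2 * Real.sin (a' / 2))) ^ 2 ≤ (M * a) ^ 2 := by
      calc (m * (2 * Real.sin (a' / 2))) ^ 2 = m * m * (2 * Real.sin (a' / 2)) ^ 2 := by ring
        _ ≤ ‖B u‖ * ‖B v‖ * (2 * Real.sin (a' / 2)) ^ 2 := by gcongr
        _ ≤ ‖B u - B v‖ ^ 2 := by rw [← hsin]; exact h1
        _ ≤ (M * a) ^ 2 := by gcongr
    exact (sq_le_sq₀ (by positivity) (by positivity)).1 h4
  set K := M / m * a with hK
  have h5 : 2 * Real.sin (a' / 2) ≤ K := by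
    rw [hK, div_mul_eq_mul_div, le_div_iff₀ hm]; linarith
  rcases eq_or_lt_of_le ha'0 with h0 | h0
  · rw [← h0, zero_mul]
    linarith
  -- Jordan's inequality gives `a' ≤ π K / 2`, and `π ≤ 4`. This crude bound controls the cubic
  -- error in the expansion of the sine.
  have h6 : a' / 2 ≤ K := by
    have h7 := Real.mul_le_sin (x := a' / 2) (by linarith) (by linarith)
    have h8 : a' / 2 * (2 / Real.pi) * Real.pi = a' := by field_simp
    have h9 : Real.pi ≤ 4 := Real.pi_le_four
    nlinarith
  have h10 := Real.sin_gt_sub_cube (x := a' / 2) (by linarith)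
  have h11 : (a' / 2) ^ 2 ≤ K ^ 2 := by gcongr
  nlinarith [mul_le_mul_of_nonneg_left h11 ha'0]

/-- A linear map distorts angles at most by the ratio of its largest and smallest dilation. -/
theorem angle_map_le {B : E3 →L[ℝ] E3} {m M : ℝ} (hm : 0 < m)
    (hB : ∀ w, m * ‖w‖ ≤ ‖B w‖) (hB' : ∀ w, ‖B w‖ ≤ M * ‖w‖) {u v : E3} (hu : ‖u‖ = 1)
    (hv : ‖v‖ = 1) : angle (B u) (B v) ≤ M / m * angle u v := by
  obtain ⟨w, hw, huw, hvw⟩ := exists_arc hu hv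
  set A := angle u v with hA
  have hA0 : 0 ≤ A := angle_nonneg _ _
  have hAπ : A ≤ Real.pi := angle_le_pi _ _
  set c : ℝ → E3 := fun t => Real.cos t • u + Real.sin t • w with hc
  have hstep : ∀ N : ℕ, 0 < N →
      angle (B u) (B v) * (1 - (M / m * (A / N)) ^ 2) ≤ M / m * A := by
    intro N hN
    have hN' : (0 : ℝ) < N := by exact_mod_cast hN
    -- The arc is divided into `N` equal pieces and the small-angle bounds are added by the triangle
    -- inequality. For coarse subdivisions the correction factor may be negative, which makes the
    -- desired bound trivial.
    have hchain : ∀ k : ℕ, angle (B u) (B (c (k * (A / N)))) * (1 - (M / m * (A / N)) ^ 2) ≤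
        k * (M / m * (A / N)) ∨ 1 - (M / m * (A / N)) ^ 2 < 0 := by
      intro k
      by_cases hneg : 1 - (M / m * (A / N)) ^ 2 < 0
      · exact Or.inr hneg
      left
      push Not at hneg
      induction k with
      | zero =>
        have h0 : B u ≠ 0 := norm_pos_iff.1 (hm.trans_le (by simpa [hu] using hB u))
        simp [hc, angle_self h0]
      | succ k ih =>
        have hAN : |(k : ℝ) * (A / N) - ((k + 1 : ℕ) : ℝ) * (A / N)| = A / N := by
          push_cast
          rw [show (k : ℝ) * (A / N) - (k + 1) * (A / N) = -(A / N) by ring, abs_neg,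
            abs_of_nonneg (by positivity)]
        have hANπ : A / N ≤ Real.pi :=
          (div_le_self hA0 (by exact_mod_cast hN)).trans hAπ
        have h1 := angle_map_le_of_small hm hB hB' (norm_arc hu hw huw (k * (A / N)))
          (norm_arc hu hw huw (((k + 1 : ℕ) : ℝ) * (A / N)))
        rw [angle_arc hu hw huw (by rw [hAN]; exact hANπ), hAN] at h1
        have h2 := angle_le_angle_add_angle (B u) (B (c (k * (A / N))))
          (B (c (((k + 1 : ℕ) : ℝ) * (A / N))))
        have h3 := mul_le_mul_of_nonneg_right h2 hneg
        rw [add_mul] at h3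
        have h4 : ((k + 1 : ℕ) : ℝ) * (M / m * (A / N)) =
          k * (M / m * (A / N)) + M / m * (A / N) := by push_cast; ring
        rw [h4]
        exact h3.trans (add_le_add ih h1)
    have hcv : c (N * (A / N)) = v := by
      rw [mul_div_cancel₀ _ hN'.ne', hc]
      exact hvw.symm
    rcases hchain N with h | h
    · rw [hcv] at h
      calc _ ≤ _ := h
        _ = M / m * A := by field_simp
    · have hM : 0 ≤ M / m * A := by
        have h1 := hB u
        have h2 := hB' u
        rw [hu] at h1 h2
        have : 0 ≤ M := by linarith
        positivity
      nlinarith [angle_nonneg (B u) (B v)]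
  have hlim : Filter.Tendsto (fun N : ℕ => angle (B u) (B v) * (1 - (M / m * (A / N)) ^ 2))
      Filter.atTop (𝓝 (angle (B u) (B v) * (1 - (M / m * 0) ^ 2))) := by
    have h1 : Filter.Tendsto (fun N : ℕ => A / (N : ℝ)) Filter.atTop (𝓝 0) :=
      tendsto_const_div_atTop_nhds_zero_nat A
    exact (((h1.const_mul (M / m)).pow 2).const_sub 1).const_mul _
  have := le_of_tendsto hlim (Filter.eventually_atTop.2 ⟨1, fun N hN => hstep N hN⟩)
  simpa using this

/-- The dilations of `B` lie between `1 - δ` and `1 + δ`, and `δ = ε / (2 + ε)` is the solution of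
`(1 + δ) / (1 - δ) = 1 + ε`. -/
theorem angle_map_le_of_near_one {ε : ℝ} (hε : 0 < ε) {B : E3 →L[ℝ] E3}
    (hB : ‖B - 1‖ < ε / (2 + ε)) {u v : E3} (hu : u ≠ 0) (hv : v ≠ 0) :
    angle (B u) (B v) ≤ (1 + ε) * angle u v := by
  set δ := ε / (2 + ε) with hδ
  have hδ0 : 0 < δ := by positivity
  have hδ1 : δ < 1 := by rw [hδ, div_lt_one (by positivity)]; linarith
  have hdiff : ∀ w, ‖B w - w‖ ≤ δ * ‖w‖ := fun w =>
    ((B - 1).le_opNorm w).trans (mul_le_mul_of_nonneg_right hB.le (norm_nonneg w))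
  have h1 : ∀ w, (1 - δ) * ‖w‖ ≤ ‖B w‖ := fun w => by
    have := norm_sub_norm_le w (B w)
    rw [norm_sub_rev] at this
    linarith [hdiff w]
  have h2 : ∀ w, ‖B w‖ ≤ (1 + δ) * ‖w‖ := fun w => by
    have := norm_sub_norm_le (B w) w
    linarith [hdiff w]
  have h3 := angle_map_le (by linarith) h1 h2 (norm_smul_inv_norm (𝕜 := ℝ) hu)
    (norm_smul_inv_norm (𝕜 := ℝ) hv)
  have hu' : (0 : ℝ) < ‖u‖⁻¹ := inv_pos.2 (norm_pos_iff.2 hu)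
  have hv' : (0 : ℝ) < ‖v‖⁻¹ := inv_pos.2 (norm_pos_iff.2 hv)
  simp only [RCLike.ofReal_real_eq_id, id_eq, map_smul] at h3
  rw [angle_smul_left_of_pos _ _ hu', angle_smul_right_of_pos _ _ hv',
    angle_smul_left_of_pos _ _ hu', angle_smul_right_of_pos _ _ hv'] at h3
  refine h3.trans (mul_le_mul_of_nonneg_right ?_ (angle_nonneg _ _))
  rw [div_le_iff₀ (by linarith)]
  have h4 : δ * (2 + ε) = ε := by rw [hδ]; field_simp
  nlinarith


/-! ### Spherical triangles on the disc -/

/-- The identity is a continuous bijection from a compact space to a Hausdorff one, hence a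
homeomorphism. -/
theorem metric_topology_eq_of_compact {X : Type*} [t : TopologicalSpace X] [CompactSpace X]
    (m : MetricSpace X) (h : ∀ p, Filter.Tendsto (fun q => m.dist q p) (𝓝 p) (𝓝 0)) :
    m.toPseudoMetricSpace.toUniformSpace.toTopologicalSpace = t := by
  have hcont : @Continuous X X t m.toPseudoMetricSpace.toUniformSpace.toTopologicalSpace id := by
    refine (@continuous_iff_continuousAt X X t
      m.toPseudoMetricSpace.toUniformSpace.toTopologicalSpace id).2 fun p => ?_
    exact (@tendsto_iff_dist_tendsto_zero X X m.toPseudoMetricSpace id (𝓝 p) p).2 (h p)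
  have hhom := (@isHomeomorph_iff_continuous_bijective X X t
    m.toPseudoMetricSpace.toUniformSpace.toTopologicalSpace id _
    (@TopologicalSpace.t2Space_of_metrizableSpace X
      m.toPseudoMetricSpace.toUniformSpace.toTopologicalSpace inferInstance)).2
    ⟨hcont, Function.bijective_id⟩
  have := @Topology.IsInducing.eq_induced X X t
    m.toPseudoMetricSpace.toUniformSpace.toTopologicalSpace id
    (@IsHomeomorph.isInducing X X t m.toPseudoMetricSpace.toUniformSpace.toTopologicalSpace id hhom)
  exact (this.trans (@induced_id X m.toPseudoMetricSpace.toUniformSpace.toTopologicalSpace)).symm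

/-- The distance induced from the angular distance by an injection into the sphere. -/
@[reducible]
noncomputable def angularMetricSpace {X : Type*} (h : X → E3) (h1 : ∀ p, ‖h p‖ = 1)
    (hinj : Function.Injective h) : MetricSpace X where
  dist := fun p q => angle (h p) (h q)
  dist_self := fun p => angle_self (norm_ne_zero_iff.1 (by rw [h1]; exact one_ne_zero))
  dist_comm := fun p q => angle_comm _ _
  dist_triangle := fun p q r => angle_le_angle_add_angle _ _ _
  eq_of_dist_eq_zero := fun {p q} hpq =>
    hinj (eq_of_angle_eq_zero_of_norm_eq hpq (by rw [h1, h1]))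

/-- The distance on the disc induced from the angular distance by an embedding into the sphere. -/
noncomputable def angularMetric (h : Disc → E3) (hc : Continuous h) (h1 : ∀ p, ‖h p‖ = 1)
    (hinj : Function.Injective h) : DiscMetric where
  toMetricSpace := angularMetricSpace h h1 hinj
  topology_eq := by
    refine metric_topology_eq_of_compact (X := Disc) (angularMetricSpace h h1 hinj) fun p => ?_
    have hne : ∀ q, h q ≠ 0 := fun q => norm_ne_zero_iff.1 (by rw [h1]; exact one_ne_zero)
    have h2 : Filter.Tendsto (fun q => angle (h q) (h p)) (𝓝 p) (𝓝 (angle (h p) (h p))) := by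
      have h3 := continuousAt_angle (x := (h p, h p)) (hne p) (hne p)
      exact h3.tendsto.comp (f := fun q => (h q, h p))
        ((hc.tendsto p).prodMk_nhds tendsto_const_nhds)
    rwa [angle_self (hne p)] at h2

/-- Homogeneous coordinates identifying the disc with the triangle of nonnegative rays, with
vertices `z i`. -/
structure IsConeCoordinates (c : Disc → E3) (z : Fin 3 → Disc) : Prop where
  continuous : Continuous c
  nonneg : ∀ p i, 0 ≤ c p i
  ne_zero : ∀ p, c p ≠ 0
  surj : ∀ t : E3, t ≠ 0 → (∀ i, 0 ≤ t i) → ∃ p, ∃ s : ℝ, 0 < s ∧ t = s • c p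
  inj : ∀ p q, ∀ s : ℝ, 0 < s → c p = s • c q → p = q
  mem_boundary : ∀ p, p ∈ Disc.boundary ↔ ∃ i, c p i = 0
  vert : ∀ i j, j ≠ i → c (z i) j = 0

/-- The point of the sphere with given homogeneous coordinates with respect to normals `n`. -/
noncomputable def coneMap (n : Fin 3 → E3) (c : Disc → E3) (p : Disc) : E3 :=
  ‖vectorMap n (c p)‖⁻¹ • vectorMap n (c p)

namespace IsConeCoordinates

variable {c : Disc → E3} {z : Fin 3 → Disc}

theorem inv_norm_pos (hc : IsConeCoordinates c z) {n : Fin 3 → E3} (hn : LinearIndependent ℝ n)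
    (p : Disc) : 0 < ‖vectorMap n (c p)‖⁻¹ :=
  inv_pos.2 (norm_pos_iff.2 (vectorMap_ne_zero hn (hc.ne_zero p)))

theorem norm_coneMap (hc : IsConeCoordinates c z) {n : Fin 3 → E3} (hn : LinearIndependent ℝ n)
    (p : Disc) : ‖coneMap n c p‖ = 1 :=
  norm_smul_inv_norm (𝕜 := ℝ) (vectorMap_ne_zero hn (hc.ne_zero p))

theorem continuous_coneMap (hc : IsConeCoordinates c z) {n : Fin 3 → E3}
    (hn : LinearIndependent ℝ n) : Continuous (coneMap n c) := by
  have h1 : Continuous fun p => vectorMap n (c p) := (vectorMap n).continuous.comp hc.continuous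
  exact (h1.norm.inv₀ fun p => norm_ne_zero_iff.2 (vectorMap_ne_zero hn (hc.ne_zero p))).smul h1

theorem coneMap_injective (hc : IsConeCoordinates c z) {n : Fin 3 → E3}
    (hn : LinearIndependent ℝ n) : Function.Injective (coneMap n c) := by
  intro p q hpq
  have hp := hc.inv_norm_pos hn p
  have hq := hc.inv_norm_pos hn q
  refine hc.inj p q (‖vectorMap n (c p)‖⁻¹⁻¹ * ‖vectorMap n (c q)‖⁻¹) (by positivity) ?_
  have h1 := congrArg (coordMap n) hpq
  simp only [coneMap, map_smul, coordMap_vectorMap hn] at h1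
  rw [mul_smul, ← h1, smul_smul, inv_mul_cancel₀ hp.ne', one_smul]

theorem angle_coneMap (hc : IsConeCoordinates c z) {n : Fin 3 → E3} (hn : LinearIndependent ℝ n)
    (p q : Disc) : angle (coneMap n c p) (coneMap n c q) =
      angle (vectorMap n (c p)) (vectorMap n (c q)) := by
  rw [coneMap, coneMap, angle_smul_left_of_pos _ _ (hc.inv_norm_pos hn p),
    angle_smul_right_of_pos _ _ (hc.inv_norm_pos hn q)]

/-- The metric of the triangle with normals `n`, in homogeneous coordinates. -/
noncomputable def coneMetric (hc : IsConeCoordinates c z) {n : Fin 3 → E3}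
    (hn : LinearIndependent ℝ n) : DiscMetric :=
  angularMetric (coneMap n c) (hc.continuous_coneMap hn) (hc.norm_coneMap hn)
    (hc.coneMap_injective hn)

theorem isTriangleModel (hc : IsConeCoordinates c z) {n : Fin 3 → E3} (hn1 : ∀ i, ‖n i‖ = 1)
    (hn : LinearIndependent ℝ n) :
    IsTriangleModel (X := (hc.coneMetric hn).Space) (hc.coneMetric hn).boundary z n
      (coneMap n c) := by
  have hinner : ∀ p i, ⟪n i, coneMap n c p⟫ = ‖vectorMap n (c p)‖⁻¹ * c p i := fun p i => by
    rw [coneMap, real_inner_smul_right, inner_vectorMap hn]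
  refine ⟨hn1, hn, hc.norm_coneMap hn, fun p q => rfl, fun p i => ?_, fun v hv hvn => ?_,
    fun p => ?_, fun i j hji => ?_⟩
  · refine le_of_le_of_eq ?_ (hinner p i).symm
    exact mul_nonneg (hc.inv_norm_pos hn p).le (hc.nonneg p i)
  · have hv0 : v ≠ 0 := norm_ne_zero_iff.1 (by rw [hv]; exact one_ne_zero)
    have hN : coordMap n v ≠ 0 := fun h => hv0 (by
      rw [← vectorMap_coordMap hn v, h, map_zero])
    obtain ⟨p, s, hs, hp⟩ := hc.surj (coordMap n v) hN hvn
    refine ⟨p, ?_⟩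
    have h1 : v = s • vectorMap n (c p) := by
      rw [← map_smul, ← hp, vectorMap_coordMap hn]
    have h2 : s * ‖vectorMap n (c p)‖ = 1 := by
      rw [← hv, h1, norm_smul, Real.norm_eq_abs, abs_of_pos hs]
    rw [coneMap, ← eq_inv_of_mul_eq_one_left h2]
    exact h1.symm
  · refine (hc.mem_boundary p).trans (exists_congr fun i => ?_)
    refine Iff.trans ?_ (mul_eq_zero.symm.trans (by rw [← hinner p i]))
    exact ⟨Or.inr, fun h => h.resolve_left (hc.inv_norm_pos hn p).ne'⟩
  · exact (hinner (z i) j).trans (by rw [hc.vert i j hji, mul_zero])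

theorem vert_injective (hc : IsConeCoordinates c z) : Function.Injective z := by
  intro i j hij
  by_contra hne
  apply hc.ne_zero (z i)
  ext k
  by_cases hki : k = i
  · rw [hij]
    exact hc.vert j k (by rw [hki]; exact hne)
  · exact hc.vert i k hki

/-- The spherical triangle with normals `n` and angles `π * ν i`, in homogeneous coordinates. -/
noncomputable def polygon (hc : IsConeCoordinates c z) {n : Fin 3 → E3} {ν : Fin 3 → ℝ}
    (hn : HasAngles n ν) (hν : ∀ i, ν i ∈ Set.Ioo (0 : ℝ) 1) : SphericalPolygon 3 where
  two_le := by norm_num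
  metric := hc.coneMetric hn.linearIndependent
  vertex := z
  angle := ν
  vertex_injective := hc.vert_injective
  vertex_mem := fun i => by
    obtain ⟨j, hj, -⟩ := exists_ne_ne i i
    exact (hc.mem_boundary _).2 ⟨j, hc.vert i j hj⟩
  angle_pos := fun i => (hν i).1
  isLengthSpace := (hc.isTriangleModel hn.norm_normal hn.linearIndependent).isLengthSpace
  interior_chart := fun _ hp =>
    ⟨_, (hc.isTriangleModel hn.norm_normal hn.linearIndependent).exists_chart hp⟩
  edge_chart := fun _ hp hv =>
    (hc.isTriangleModel hn.norm_normal hn.linearIndependent).hasSectorNhd_edge hp hv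
  vertex_chart := fun i => by
    obtain ⟨j, hj, -⟩ := exists_ne_ne i i
    obtain ⟨k, hki, hkj⟩ := exists_ne_ne i j
    exact (hc.isTriangleModel hn.norm_normal hn.linearIndependent).hasSectorNhd_vert hj.symm
      hki.symm hkj.symm (hν i).1 (hν i).2.le (hn.inner_normal i j k hj.symm hki.symm hkj.symm)

theorem polygon_d (hc : IsConeCoordinates c z) {n : Fin 3 → E3} {ν : Fin 3 → ℝ}
    (hn : HasAngles n ν) (hν : ∀ i, ν i ∈ Set.Ioo (0 : ℝ) 1) (p q : Disc) :
    (hc.polygon hn hν).metric.d p q = angle (vectorMap n (c p)) (vectorMap n (c q)) :=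
  hc.angle_coneMap hn.linearIndependent p q

end IsConeCoordinates

/-! ### Angles and deformations -/

/-- The model exhibits at each vertex a sector whose angle is read off from the normals, and the
polygon prescribes another; both are convex, so they have the same angle. -/
theorem IsTriangleModel.hasAngles {T : SphericalPolygon 3} {n : Fin 3 → E3}
    {e : T.metric.Space → E3} (h : IsTriangleModel T.metric.boundary T.vertex n e)
    (hα : ∀ i, T.angle i < 1) : HasAngles n T.angle := by
  have hpi := Real.pi_pos
  refine ⟨h.norm_normal, h.linearIndependent, fun i j k hij hik hjk => ?_⟩
  obtain ⟨h1, h2⟩ :=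
    IsTriangleModel.abs_inner_normals_lt h.norm_normal h.linearIndependent hjk
  set α := Real.arccos (-⟪n j, n k⟫) / Real.pi with hαdef
  have hπα : Real.pi * α = Real.arccos (-⟪n j, n k⟫) := by
    rw [hαdef, mul_div_cancel₀ _ hpi.ne']
  have hα0 : 0 < α := div_pos (Real.arccos_pos.2 h2) hpi
  have hα1 : α ≤ 1 := (div_le_one hpi).2 (Real.arccos_le_pi _)
  have hcos : ⟪n j, n k⟫ = -Real.cos (Real.pi * α) := by
    rw [hπα, Real.cos_arccos h1.le h2.le, neg_neg]
  have := sector_angle_unique hα0 hα1 (T.angle_pos i) (hα i).le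
    (h.hasSectorNhd_vert hij hik hjk hα0 hα1 hcos) (T.vertex_chart i)
  rw [hcos, this]

theorem IsTriangleModel.comp_isometry {X : Type*} [MetricSpace X] {bd : Set X} {vert : Fin 3 → X}
    {n n' : Fin 3 → E3} {e : X → E3} (h : IsTriangleModel bd vert n e) (A : E3 ≃ₗᵢ[ℝ] E3)
    (hA : ∀ i, A (n i) = n' i) : IsTriangleModel bd vert n' fun p => A (e p) := by
  have hinner : ∀ i v, ⟪n' i, A v⟫ = ⟪n i, v⟫ := fun i v => by
    rw [← hA, LinearIsometryEquiv.inner_map_map]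
  have hn' : n' = A.toLinearEquiv.toLinearMap ∘ n := funext fun i => (hA i).symm
  refine ⟨fun i => by rw [← hA, A.norm_map, h.norm_normal], ?_,
    fun p => by rw [A.norm_map, h.norm_map], fun p q => ?_,
    fun p i => by rw [hinner]; exact h.nonneg p i, fun v hv hvn => ?_,
    fun p => by simp only [hinner]; exact h.mem_bd p,
    fun i j hji => by rw [hinner]; exact h.inner_vert i j hji⟩
  · rw [hn']
    exact h.linearIndependent.map' _ A.toLinearEquiv.ker
  · rw [← h.angle_map]
    exact A.toLinearIsometry.angle_map _ _
  · obtain ⟨p, hp⟩ := h.surj (A.symm v) (by rw [A.symm.norm_map, hv]) fun i => by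
      rw [← hinner, A.apply_symm_apply]; exact hvn i
    exact ⟨p, by rw [hp, A.apply_symm_apply]⟩

/-- A given triangle supplies its own homogeneous coordinates on the disc. Using these for the
deformation keeps the vertices in place and recovers the given metric at the original angles. -/
theorem IsTriangleModel.isConeCoordinates {T : SphericalPolygon 3} {n : Fin 3 → E3}
    {e : T.metric.Space → E3} (h : IsTriangleModel T.metric.boundary T.vertex n e) :
    IsConeCoordinates (fun p : Disc => coordMap n (e p)) T.discVertex := by
  have hn := h.linearIndependent
  have he0 : ∀ p, e p ≠ 0 := fun p => norm_ne_zero_iff.1 (by rw [h.norm_map]; exact one_ne_zero)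
  refine ⟨?_, fun p i => h.nonneg p i, fun p h0 => he0 p ?_, fun t ht htn => ?_,
    fun p q s hs hpq => ?_, fun p => h.mem_bd p, fun i j hji => h.inner_vert i j hji⟩
  · exact (coordMap n).continuous.comp
      ((continuous_of_angle_eq_dist h.norm_map h.angle_map).comp
        (spaceHomeomorph T.metric).symm.continuous)
  · rw [← vectorMap_coordMap hn (e p), h0, map_zero]
  · have hv := vectorMap_ne_zero hn ht
    obtain ⟨p, hp⟩ := h.surj (‖vectorMap n t‖⁻¹ • vectorMap n t) (norm_smul_inv_norm (𝕜 := ℝ) hv)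
      fun i => by
        rw [real_inner_smul_right, inner_vectorMap hn]
        exact mul_nonneg (inv_nonneg.2 (norm_nonneg _)) (htn i)
    refine ⟨p, ‖vectorMap n t‖, norm_pos_iff.2 hv, ?_⟩
    rw [hp, map_smul, coordMap_vectorMap hn, smul_smul, mul_inv_cancel₀ (norm_ne_zero_iff.2 hv),
      one_smul]
  · have h1 : e p = s • e q := by
      have := congrArg (vectorMap n) hpq
      rwa [map_smul, vectorMap_coordMap hn, vectorMap_coordMap hn] at this
    have hp : ‖e p‖ = 1 := h.norm_map p
    have hq : ‖e q‖ = 1 := h.norm_map q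
    have h2 : s = 1 := by
      rw [h1, norm_smul, hq, mul_one, Real.norm_eq_abs, abs_of_pos hs] at hp
      exact hp
    rw [h2, one_smul] at h1
    exact h.injective h1

/-- With coordinates fixed, passing from one triangle to the other is the linear map `vectorMap *
coordMap`, which tends to the identity in norm as `ν → ν₀`, in either direction. The bound is
therefore uniform in the two points. -/
theorem eventually_distortion {ν₀ : Fin 3 → ℝ} (hν₀ : ν₀ ∈ angleRegion) {ε : ℝ} (hε : 0 < ε) :
    ∀ᶠ ν in 𝓝[angleRegion] ν₀, ∀ s t : E3, s ≠ 0 → t ≠ 0 →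
      angle (vectorMap (normals ν) s) (vectorMap (normals ν) t) ≤
        (1 + ε) * angle (vectorMap (normals ν₀) s) (vectorMap (normals ν₀) t) ∧
      angle (vectorMap (normals ν₀) s) (vectorMap (normals ν₀) t) ≤
        (1 + ε) * angle (vectorMap (normals ν) s) (vectorMap (normals ν) t) := by
  have hn₀ := (hasAngles_normals hν₀).linearIndependent
  have hδ : 0 < ε / (2 + ε) := by positivity
  have hinv : vectorMap (normals ν₀) * coordMap (normals ν₀) = 1 :=
    Ring.inverse_mul_cancel _ (isUnit_coordMap hn₀)
  have h1 : Filter.Tendsto (fun ν => vectorMap (normals ν) * coordMap (normals ν₀))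
      (𝓝[angleRegion] ν₀) (𝓝 1) := by
    rw [← hinv]
    exact (continuousOn_vectorMap ν₀ hν₀).mul_const _
  have h2 : Filter.Tendsto (fun ν => vectorMap (normals ν₀) * coordMap (normals ν))
      (𝓝[angleRegion] ν₀) (𝓝 1) := by
    rw [← hinv]
    exact (continuousOn_coordMap ν₀ hν₀).const_mul _
  filter_upwards [h1.eventually (Metric.ball_mem_nhds _ hδ),
    h2.eventually (Metric.ball_mem_nhds _ hδ), self_mem_nhdsWithin] with ν hν1 hν2 hν s t hs ht
  have hn := (hasAngles_normals hν).linearIndependent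
  rw [dist_eq_norm] at hν1 hν2
  have e1 : ∀ x, (vectorMap (normals ν) * coordMap (normals ν₀)) (vectorMap (normals ν₀) x) =
      vectorMap (normals ν) x := fun x => by
    rw [mul_apply_eq_comp, coordMap_vectorMap hn₀]
  have e2 : ∀ x, (vectorMap (normals ν₀) * coordMap (normals ν)) (vectorMap (normals ν) x) =
      vectorMap (normals ν₀) x := fun x => by
    rw [mul_apply_eq_comp, coordMap_vectorMap hn]
  constructor
  · rw [← e1 s, ← e1 t]
    exact angle_map_le_of_near_one hε hν1 (vectorMap_ne_zero hn₀ hs) (vectorMap_ne_zero hn₀ ht)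
  · rw [← e2 s, ← e2 t]
    exact angle_map_le_of_near_one hε hν2 (vectorMap_ne_zero hn hs) (vectorMap_ne_zero hn ht)

theorem angleDeformable_of_angle_lt_one {T : SphericalPolygon 3} (hα : ∀ i, T.angle i < 1) :
    T.AngleDeformable := by
  classical
  obtain ⟨n₀, e₀, h₀⟩ := exists_isTriangleModel T hα
  have hang₀ := h₀.hasAngles hα
  have hreg : T.angle ∈ angleRegion := hang₀.mem_angleRegion fun i => ⟨T.angle_pos i, hα i⟩
  have hangT := hasAngles_normals hreg
  -- The angles fix the Gram matrix, so the model can be moved by an isometry to have the standard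
  -- normals, which depend continuously on the angles.
  obtain ⟨A, hA⟩ := exists_isometry_of_inner_eq (f := normals T.angle) (g := n₀)
    (fun i j => by
      by_cases hij : i = j
      · subst hij
        rw [inner_self_of_unit (hangT.norm_normal i), inner_self_of_unit (hang₀.norm_normal i)]
      · obtain ⟨k, hki, hkj⟩ := exists_ne_ne i j
        rw [hangT.inner_normal k i j hki hkj hij, hang₀.inner_normal k i j hki hkj hij])
    (hang₀.linearIndependent.span_eq_top_of_card_eq_finrank (by simp))
  have h := h₀.comp_isometry A hA
  have hc := h.isConeCoordinates
  set c : Disc → E3 := fun p : Disc => coordMap (normals T.angle) (A (e₀ p)) with hcdef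
  -- The member over `T.angle` must be `T` itself, not just a polygon with the same distance, so it
  -- is inserted by cases; `hPd` checks that the common distance formula still holds there. Outside
  -- the region the value is irrelevant.
  set P : (Fin 3 → ℝ) → SphericalPolygon 3 := fun ν =>
    if hν : ν ∈ angleRegion ∧ ν ≠ T.angle then hc.polygon (hasAngles_normals hν.1) hν.1.1
    else T with hP
  have hPT : P T.angle = T := by
    simp only [hP]
    rw [dif_neg fun hν => hν.2 rfl]
  have hPne : ∀ ν (hν : ν ∈ angleRegion), ν ≠ T.angle →
      P ν = hc.polygon (hasAngles_normals hν) hν.1 := fun ν hν hne => by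
    simp only [hP]
    rw [dif_pos ⟨hν, hne⟩]
  have hPd : ∀ ν ∈ angleRegion, ∀ p q, (P ν).metric.d p q =
      angle (vectorMap (normals ν) (c p)) (vectorMap (normals ν) (c q)) := by
    intro ν hν p q
    by_cases hne : ν = T.angle
    · rw [hne, hPT]
      simp only [hcdef]
      rw [vectorMap_coordMap hangT.linearIndependent, vectorMap_coordMap hangT.linearIndependent]
      exact (h.angle_map p q).symm
    · rw [hPne ν hν hne, hc.polygon_d]
  refine ⟨angleRegion, isOpen_angleRegion.mem_nhds hreg, P, hPT, fun ν hν => ?_,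
    fun ν₀ hν₀ ε hε => ?_⟩
  · by_cases hne : ν = T.angle
    · rw [hne, hPT]
      exact ⟨rfl, rfl⟩
    · rw [hPne ν hν hne]
      exact ⟨rfl, rfl⟩
  · filter_upwards [eventually_distortion hν₀ hε, self_mem_nhdsWithin] with ν h1 hν p q
    rw [hPd ν hν, hPd ν₀ hν₀]
    exact h1 _ _ (hc.ne_zero p) (hc.ne_zero q)

/-! ### Existence -/

/-- Barycentric coordinates in an equilateral triangle centred at the origin. -/
noncomputable def triCoord (z : ℂ) : E3 :=
  !₂[1 + 2 * z.re, 1 - z.re + Real.sqrt 3 * z.im, 1 - z.re - Real.sqrt 3 * z.im]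

theorem exists_isConeCoordinates : ∃ c z, IsConeCoordinates c z := by
  have h3 : (0 : ℝ) < Real.sqrt 3 := by positivity
  have h33 : Real.sqrt 3 * Real.sqrt 3 = 3 := Real.mul_self_sqrt (by norm_num)
  have hcont : Continuous triCoord := by
    refine (PiLp.continuous_toLp 2 _).comp (continuous_pi fun i => ?_)
    fin_cases i
    · exact (by fun_prop : Continuous fun z : ℂ => 1 + 2 * z.re)
    · exact (by fun_prop : Continuous fun z : ℂ => 1 - z.re + Real.sqrt 3 * z.im)
    · exact (by fun_prop : Continuous fun z : ℂ => 1 - z.re - Real.sqrt 3 * z.im)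
  have hconti : ∀ i, Continuous fun z => triCoord z i := fun i => by fun_prop
  have hsum : ∀ z, triCoord z 0 + triCoord z 1 + triCoord z 2 = 3 := fun z => by
    simp only [triCoord, Matrix.cons_val]; ring
  have hcomb : ∀ i z w (a b : ℝ), a + b = 1 →
      triCoord (a • z + b • w) i = a * triCoord z i + b * triCoord w i := by
    intro i z w a b hab
    have hb : b = 1 - a := by linarith
    fin_cases i <;> simp [triCoord, hb] <;> ring
  set K : Set ℂ := {z | ∀ i, 0 ≤ triCoord z i} with hK
  have hKclosed : IsClosed K := by
    have : K = ⋂ i, {z | 0 ≤ triCoord z i} := by ext; simp [hK]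
    rw [this]
    exact isClosed_iInter fun i => isClosed_le continuous_const (hconti i)
  have hKconv : Convex ℝ K := by
    intro z hz w hw a b ha hb hab i
    rw [hcomb i z w a b hab]
    exact add_nonneg (mul_nonneg ha (hz i)) (mul_nonneg hb (hw i))
  have hopen : IsOpen {z | ∀ i, 0 < triCoord z i} := by
    have : {z | ∀ i, 0 < triCoord z i} = ⋂ i, {z | 0 < triCoord z i} := by ext; simp
    rw [this]
    exact isOpen_iInter_of_finite fun i => isOpen_lt continuous_const (hconti i)
  have hint : interior K = {z | ∀ i, 0 < triCoord z i} := by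
    apply subset_antisymm
    · intro z hz i
      -- Moving slightly away from the centre, where all coordinates equal `1`, would make a
      -- vanishing coordinate negative.
      refine lt_of_le_of_ne (interior_subset hz i) fun h0 => ?_
      have hlim : Filter.Tendsto (fun s : ℝ => (1 + s) • z + (-s) • (0 : ℂ)) (𝓝[>] 0) (𝓝 z) := by
        have : Continuous fun s : ℝ => (1 + s) • z + (-s) • (0 : ℂ) := by fun_prop
        have h1 := this.tendsto 0
        simp only [add_zero, one_smul, neg_zero, zero_smul] at h1
        exact h1.mono_left nhdsWithin_le_nhds
      obtain ⟨s, hs, hs0⟩ := ((hlim.eventually (isOpen_interior.mem_nhds hz)).and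
        self_mem_nhdsWithin).exists
      have h1 := interior_subset hs i
      rw [hcomb i z 0 _ _ (by ring), ← h0] at h1
      have h2 : triCoord 0 i = 1 := by fin_cases i <;> simp [triCoord]
      rw [h2] at h1
      have : (0 : ℝ) < s := hs0
      linarith
    · exact interior_maximal (fun z hz i => (hz i).le) hopen
  have hKne : (interior K).Nonempty := by
    refine ⟨0, ?_⟩
    rw [hint]
    intro i
    fin_cases i <;> simp [triCoord]
  have hKbdd : Bornology.IsBounded K := by
    refine (Metric.isBounded_iff_subset_closedBall 0).2 ⟨4, fun z hz => ?_⟩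
    rw [mem_closedBall_zero_iff]
    refine (Complex.norm_le_abs_re_add_abs_im z).trans ?_
    have h0 := hz 0
    have h1 := hz 1
    have h2 := hz 2
    simp only [triCoord, Matrix.cons_val] at h0 h1 h2
    have hre : |z.re| ≤ 1 := by rw [abs_le]; constructor <;> linarith
    have h1s : 1 ≤ Real.sqrt 3 := by nlinarith
    have him : |z.im| ≤ 2 := by
      rw [abs_le] at hre ⊢; constructor <;> nlinarith
    linarith
  -- Bounded convex sets with nonempty interior are matched by a homeomorphism of the plane; it
  -- carries the disc to the flat triangle and circle to perimeter.
  obtain ⟨E, -, hEcl, hEfr⟩ := exists_homeomorph_image_eq (convex_closedBall (0 : ℂ) 1)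
    (by rw [interior_closedBall _ one_ne_zero]; exact ⟨0, by simp⟩)
    (NormedSpace.isVonNBounded_of_isBounded ℝ Metric.isBounded_closedBall) hKconv hKne
    (NormedSpace.isVonNBounded_of_isBounded ℝ hKbdd)
  rw [Metric.isClosed_closedBall.closure_eq, hKclosed.closure_eq] at hEcl
  rw [frontier_closedBall _ one_ne_zero, hKclosed.frontier_eq, hint] at hEfr
  have hmem : ∀ p : Disc, E p ∈ K := fun p => hEcl ▸ ⟨p, p.2, rfl⟩
  have hsurj : ∀ t : E3, (∀ i, 0 ≤ t i) → t 0 + t 1 + t 2 = 3 → ∃ p : Disc, triCoord (E p) = t := by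
    intro t ht hts
    set w : ℂ := ⟨(t 0 - 1) / 2, (t 1 - t 2) / (2 * Real.sqrt 3)⟩ with hw
    have hwt : triCoord w = t := by
      ext i
      fin_cases i
      · simp [triCoord, hw]; ring
      · simp [triCoord, hw]; field_simp; linarith
      · simp [triCoord, hw]; field_simp; linarith
    have hwK : w ∈ K := fun i => by rw [hwt]; exact ht i
    rw [← hEcl] at hwK
    obtain ⟨p, hp, hpw⟩ := hwK
    exact ⟨⟨p, hp⟩, by rw [hpw, hwt]⟩
  have hz : ∀ i : Fin 3, ∃ p : Disc, triCoord (E p) = EuclideanSpace.single i (3 : ℝ) := by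
    intro i
    apply hsurj
    · intro j
      simp only [PiLp.single_apply]
      split_ifs <;> norm_num
    · fin_cases i <;> simp
  choose z hz using hz
  refine ⟨fun p => triCoord (E p), z, ?_, fun p i => hmem p i, fun p h0 => ?_,
    fun t ht0 ht => ?_, fun p q s hs hpq => ?_, fun p => ?_, fun i j hji => ?_⟩
  · exact hcont.comp (E.continuous.comp continuous_subtype_val)
  · have := hsum (E p)
    rw [h0] at this
    simp at this
  · have hpos : 0 < t 0 + t 1 + t 2 := by
      refine lt_of_le_of_ne (by linarith [ht 0, ht 1, ht 2]) fun h => ht0 ?_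
      ext i
      have h0 := ht 0
      have h1 := ht 1
      have h2 := ht 2
      fin_cases i
      · exact le_antisymm (by simp only [Fin.zero_eta, PiLp.zero_apply]; linarith) h0
      · exact le_antisymm (by simp only [Fin.mk_one, PiLp.zero_apply]; linarith) h1
      · exact le_antisymm (by simp only [Fin.reduceFinMk, PiLp.zero_apply]; linarith) h2
    obtain ⟨p, hp⟩ := hsurj ((3 / (t 0 + t 1 + t 2)) • t)
      (fun i => mul_nonneg (by positivity) (ht i)) (by
        simp only [PiLp.smul_apply, smul_eq_mul]
        field_simp)
    refine ⟨p, (t 0 + t 1 + t 2) / 3, by positivity, ?_⟩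
    rw [hp, smul_smul]
    have : (t 0 + t 1 + t 2) / 3 * (3 / (t 0 + t 1 + t 2)) = 1 := by field_simp
    rw [this, one_smul]
  · have h1 := hsum (E p)
    have h2 := hsum (E q)
    rw [hpq] at h1
    simp only [PiLp.smul_apply, smul_eq_mul] at h1
    have hs1 : s = 1 := by nlinarith
    rw [hs1, one_smul] at hpq
    have e0 := congrArg (fun v : E3 => v 0) hpq
    have e1 := congrArg (fun v : E3 => v 1) hpq
    simp only [triCoord, Matrix.cons_val] at e0 e1
    have hre : (E p).re = (E q).re := by linarith
    have him : (E p).im = (E q).im := by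
      have : Real.sqrt 3 * (E p).im = Real.sqrt 3 * (E q).im := by linarith
      exact mul_left_cancel₀ h3.ne' this
    exact Subtype.ext (E.injective (Complex.ext hre him))
  · have h1 : p ∈ Disc.boundary ↔ E p ∈ K \ {z | ∀ i, 0 < triCoord z i} := by
      rw [← hEfr]
      constructor
      · intro hp
        exact ⟨p, mem_sphere_zero_iff_norm.2 (show ‖(p : ℂ)‖ = 1 from hp), rfl⟩
      · rintro ⟨w, hw, hwp⟩
        have : w = p := E.injective hwp
        rw [this] at hw
        exact mem_sphere_zero_iff_norm.1 hw
    rw [h1]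
    constructor
    · rintro ⟨hp, hn⟩
      by_contra! hne
      exact hn fun i => lt_of_le_of_ne (hp i) (Ne.symm (hne i))
    · rintro ⟨i, hi⟩
      exact ⟨hmem p, fun hn => (hn i).ne' hi⟩
  · simp only [hz]
    simp [hji]


/-! ### Reflections -/

/-- The reflection in the plane orthogonal to `n` for `b = false`, the identity for `b = true`. -/
noncomputable def sideIsometry (n : E3) (b : Bool) : E3 ≃ₗᵢ[ℝ] E3 :=
  if b then LinearIsometryEquiv.refl ℝ E3 else Submodule.reflection (ℝ ∙ n)ᗮ

theorem sideIsometry_false {n : E3} (hn : ‖n‖ = 1) (v : E3) :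
    sideIsometry n false v = v - (2 * ⟪n, v⟫) • n := by
  have : sideIsometry n false v = Submodule.reflection (ℝ ∙ n)ᗮ v := rfl
  rw [this, Submodule.reflection_orthogonal_apply, Submodule.reflection_singleton_apply]
  simp only [hn, RCLike.ofReal_real_eq_id, id, one_pow, div_one]
  rw [mul_smul, two_smul, two_smul]
  abel

theorem sideIsometry_sideIsometry (n : E3) (b : Bool) (v : E3) :
    sideIsometry n b (sideIsometry n b v) = v := by
  cases b
  · exact Submodule.reflection_reflection _ v
  · rfl

theorem sideIsometry_not (n : E3) (b : Bool) (v : E3) :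
    sideIsometry n (!b) v = sideIsometry n b (sideIsometry n false v) := by
  cases b
  · exact (sideIsometry_sideIsometry n false v).symm
  · rfl

theorem sideIsometry_of_inner_eq_zero {n v : E3} (hn : ‖n‖ = 1) (h : ⟪n, v⟫ = 0) (b : Bool) :
    sideIsometry n b v = v := by
  cases b
  · rw [sideIsometry_false hn, h, mul_zero, zero_smul, sub_zero]
  · rfl

theorem inner_sideIsometry_false {n : E3} (hn : ‖n‖ = 1) (v : E3) :
    ⟪n, sideIsometry n false v⟫ = -⟪n, v⟫ := by
  rw [sideIsometry_false hn, inner_sub_right, real_inner_smul_right, inner_self_of_unit hn]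
  ring

theorem angle_isometry (A : E3 ≃ₗᵢ[ℝ] E3) (u v : E3) : angle (A u) (A v) = angle u v :=
  A.toLinearIsometry.angle_map u v

theorem isSphericalChartAt_comp_isometry {X : Type*} [MetricSpace X] {f : X → E3} {p : X} {r : ℝ}
    (h : IsSphericalChartAt f p r) (A : E3 ≃ₗᵢ[ℝ] E3) :
    IsSphericalChartAt (fun q => A (f q)) p r := by
  refine ⟨h.pos, fun q hq => by rw [A.norm_map, h.norm_eq q hq], fun q hq q' hq' => ?_,
    fun v hv hvr => ?_⟩
  · rw [angle_isometry, h.angle_eq q hq q' hq']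
  · obtain ⟨q, hq, hqv⟩ := h.surj (A.symm v) (by rw [A.symm.norm_map, hv]) (by
      rwa [← angle_isometry A, A.apply_symm_apply])
    exact ⟨q, hq, by rw [hqv, A.apply_symm_apply]⟩

/-! ### Doubles -/

theorem exists_lt_le (J : Fin 3 → Prop) {g : Fin 3 → ℝ} {c : ℝ} (hg : ∀ i, J i → c < g i) :
    ∃ r, c < r ∧ ∀ i, J i → r ≤ g i := by
  classical
  by_cases hJ : ∃ i, J i
  · obtain ⟨i, hi⟩ := hJ
    obtain ⟨i, hi, hmin⟩ := Finset.exists_min_image (Finset.univ.filter J) g ⟨i, by simpa using hi⟩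
    exact ⟨_, hg i (by simpa using hi), fun j hj => hmin j (by simpa using hj)⟩
  · push Not at hJ
    exact ⟨c + 1, lt_add_one c, fun i hi => absurd hi (hJ i)⟩

/-- `Y` consists of two copies of `X`, glued along `bd`. -/
structure IsDouble {X Y : Type*} [MetricSpace X] [MetricSpace Y] (bd : Set X)
    (side : Bool → X → Y) : Prop where
  isometry : ∀ b, Isometry (side b)
  surj : ∀ q, ∃ c : Bool × X, side c.1 c.2 = q
  glue : ∀ z ∈ bd, ∀ b c, side b z = side c z
  exists_bd : ∀ b x y s, dist (side b x) (side (!b) y) < s → ∃ z ∈ bd, dist x z + dist y z < s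

/-- The two copies of a polygon in its double. -/
noncomputable def doubleSide (T : SphericalPolygon 3) (b : Bool) : T.metric.Space → T.Double :=
  bif b then Metric.toGlueL isometry_subtype_coe isometry_subtype_coe
  else Metric.toGlueR isometry_subtype_coe isometry_subtype_coe

theorem isDouble_doubleSide (T : SphericalPolygon 3) :
    IsDouble T.metric.boundary (doubleSide T) := by
  have key : ∀ x y s, dist (doubleSide T true x) (doubleSide T false y) < s →
      ∃ z ∈ T.metric.boundary, dist x z + dist y z < s := by
    intro x y s hs
    -- Across the seam, the glued distance is an infimum over crossing points plus a gap parameter,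
    -- which is zero here.
    have hd : dist (doubleSide T true x) (doubleSide T false y) =
      (⨅ z : T.metric.boundary, dist x z + dist y z) + 0 := rfl
    rw [hd, add_zero] at hs
    obtain ⟨z, hz⟩ := exists_lt_of_ciInf_lt hs
    exact ⟨z, z.2, hz⟩
  have hglue : ∀ z ∈ T.metric.boundary, doubleSide T true z = doubleSide T false z := fun z hz =>
    congrFun (Metric.toGlue_commute (isometry_subtype_coe (s := T.metric.boundary))
      (isometry_subtype_coe (s := T.metric.boundary))) ⟨z, hz⟩
  refine ⟨fun b => ?_, fun q => ?_, fun z hz b c => ?_, fun b x y s hs => ?_⟩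
  · cases b
    · exact Metric.toGlueR_isometry _ _
    · exact Metric.toGlueL_isometry _ _
  · induction q using Quotient.inductionOn' with
    | h x =>
      rcases x with x | x
      · exact ⟨(true, x), rfl⟩
      · exact ⟨(false, x), rfl⟩
  · cases b <;> cases c
    · rfl
    · exact (hglue z hz).symm
    · exact hglue z hz
    · rfl
  · cases b
    · rw [dist_comm] at hs
      obtain ⟨z, hz, hzs⟩ := key y x s hs
      exact ⟨z, hz, by linarith⟩
    · exact key x y s hs

/-- Folding the double back onto one copy does not increase distances. -/
theorem IsDouble.dist_le {X Y : Type*} [MetricSpace X] [MetricSpace Y] {bd : Set X}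
    {side : Bool → X → Y} (h : IsDouble bd side) (b c : Bool) (x y : X) :
    dist x y ≤ dist (side b x) (side c y) := by
  by_cases hbc : c = b
  · rw [hbc, (h.isometry b).dist_eq]
  · have hc : c = !b := by cases b <;> cases c <;> simp_all
    subst hc
    refine le_of_forall_gt fun s hs => ?_
    obtain ⟨z, -, hz⟩ := h.exists_bd b x y s hs
    exact (dist_triangle_right x y z).trans_lt hz

/-- A chart on the double of a triangle, which unfolds it over the side number `a`. -/
noncomputable def unfoldChart {X Y : Type*} [MetricSpace X] [MetricSpace Y] {bd : Set X}
    {side : Bool → X → Y} (hD : IsDouble bd side) (n : Fin 3 → E3) (e : X → E3) (a : Fin 3)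
    (q : Y) : E3 :=
  sideIsometry (n a) (hD.surj q).choose.1 (e (hD.surj q).choose.2)

namespace IsTriangleModel

variable {X Y : Type*} [MetricSpace X] [MetricSpace Y] {bd : Set X} {vert : Fin 3 → X}
  {n : Fin 3 → E3} {e : X → E3} {side : Bool → X → Y}

theorem inner_sub_dist_le (h : IsTriangleModel bd vert n e) (p q : X) (i : Fin 3) :
    ⟪n i, e p⟫ - dist p q ≤ ⟪n i, e q⟫ := by
  rw [← h.angle_map]
  exact inner_sub_angle_le (h.norm_normal i) (h.norm_map p) (h.norm_map q)

theorem mem_bd_of_side_eq (h : IsTriangleModel bd vert n e) (hD : IsDouble bd side) {b : Bool}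
    {x : X} (hx : side b x = side (!b) x) : x ∈ bd := by
  by_contra hxb
  have hpos : ∀ i, 0 < ⟪n i, e x⟫ := fun i =>
    lt_of_le_of_ne (h.nonneg x i) fun h0 => hxb ((h.mem_bd x).2 ⟨i, h0.symm⟩)
  obtain ⟨r, hr, hri⟩ := exists_lt_le (fun _ => True) fun i _ => hpos i
  obtain ⟨z, hz, hzr⟩ := hD.exists_bd b x x r (by rw [← hx, dist_self]; exact hr)
  obtain ⟨i, hi⟩ := (h.mem_bd z).1 hz
  have h1 := h.inner_sub_dist_le x z i
  linarith [hri i trivial, dist_nonneg (x := x) (y := z)]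

/-- The representative picked in `unfoldChart` can be in the wrong copy only for a point of the
boundary. Off the other two sides such a point lies on side `a`, and the reflection fixes its image.
-/
theorem unfoldChart_side (h : IsTriangleModel bd vert n e) (hD : IsDouble bd side) {a : Fin 3}
    {x : X} (hx : ∀ j, j ≠ a → 0 < ⟪n j, e x⟫) (b : Bool) :
    unfoldChart hD n e a (side b x) = sideIsometry (n a) b (e x) := by
  have hspec := (hD.surj (side b x)).choose_spec
  rw [unfoldChart]
  set c := (hD.surj (side b x)).choose
  have hcx : c.2 = x := by
    have := hD.dist_le c.1 b c.2 x
    rw [hspec, dist_self] at this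
    exact dist_le_zero.1 this
  rw [hcx] at hspec ⊢
  by_cases hcb : c.1 = b
  · rw [hcb]
  · have hc : c.1 = !b := by cases b <;> cases h : c.1 <;> simp_all
    rw [hc] at hspec
    obtain ⟨i, hi⟩ := (h.mem_bd x).1 (h.mem_bd_of_side_eq hD hspec.symm)
    have hia : i = a := by
      by_contra hne
      exact (hx i hne).ne' hi
    rw [hia] at hi
    rw [sideIsometry_of_inner_eq_zero (h.norm_normal a) hi,
      sideIsometry_of_inner_eq_zero (h.norm_normal a) hi]

/-- The arc from `e y` to the mirror image of `e y'` meets the mirror at some point. Being too short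
to reach the planes of the other sides, it does so on side `a` of the triangle, and this is where a
path in the double changes copies. -/
theorem dist_side_le_angle (h : IsTriangleModel bd vert n e) (hD : IsDouble bd side) {a : Fin 3}
    {y y' : X} (hy : ∀ j, j ≠ a → angle (e y) (sideIsometry (n a) false (e y')) < ⟪n j, e y⟫)
    (b : Bool) :
    dist (side b y) (side (!b) y') ≤ angle (e y) (sideIsometry (n a) false (e y')) := by
  have hna := h.norm_normal a
  set v := sideIsometry (n a) false (e y') with hv
  have hv1 : ‖v‖ = 1 := by rw [hv, LinearIsometryEquiv.norm_map, h.norm_map]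
  obtain ⟨w, hw, huw, hvw⟩ := exists_arc (h.norm_map y) hv1
  set θ := angle (e y) v with hθ
  have hθ0 : 0 ≤ θ := angle_nonneg _ _
  have hθπ : θ ≤ Real.pi := angle_le_pi _ _
  obtain ⟨t, ht, ht0⟩ : ∃ t ∈ Set.Icc 0 θ,
      ⟪n a, Real.cos t • e y + Real.sin t • w⟫ = 0 := by
    have hcont : ContinuousOn (fun t : ℝ => ⟪n a, Real.cos t • e y + Real.sin t • w⟫)
        (Set.Icc 0 θ) := by fun_prop
    refine intermediate_value_Icc' hθ0 hcont ⟨?_, ?_⟩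
    · rw [← hvw, hv, inner_sideIsometry_false hna]
      linarith [h.nonneg y' a]
    · simpa using h.nonneg y a
  set m := Real.cos t • e y + Real.sin t • w with hm
  have hm1 : ‖m‖ = 1 := norm_arc (h.norm_map y) hw huw t
  have hum : angle (e y) m = t := by
    have := angle_arc (h.norm_map y) hw huw (s := 0) (t := t) (by
      rw [zero_sub, abs_neg, abs_of_nonneg ht.1]; exact ht.2.trans hθπ)
    rwa [Real.cos_zero, Real.sin_zero, one_smul, zero_smul, add_zero, zero_sub, abs_neg,
      abs_of_nonneg ht.1] at this
  have hvm : angle v m = θ - t := by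
    have habs : |θ - t| = θ - t := abs_of_nonneg (by linarith [ht.2])
    have := angle_arc (h.norm_map y) hw huw (s := θ) (t := t) (by
      rw [habs]; linarith [ht.1])
    rwa [habs, ← hvw] at this
  obtain ⟨z, hz⟩ := h.surj m hm1 fun j => by
    by_cases hja : j = a
    · rw [hja, ht0]
    · have := inner_sub_angle_le (h.norm_normal j) (h.norm_map y) hm1
      rw [hum] at this
      linarith [hy j hja, ht.2]
  have hzb : z ∈ bd := (h.mem_bd z).2 ⟨a, by rw [hz, ht0]⟩
  have h1 : dist y z = t := by rw [← h.angle_map, hz, hum]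
  have h2 : dist z y' = θ - t := by
    rw [dist_comm, ← h.angle_map, hz, ← angle_isometry (sideIsometry (n a) false), ← hv,
      sideIsometry_of_inner_eq_zero hna ht0, hvm]
  calc dist (side b y) (side (!b) y')
      ≤ dist (side b y) (side b z) + dist (side b z) (side (!b) y') := dist_triangle _ _ _
    _ = dist y z + dist z y' := by
      rw [hD.glue z hzb b (!b), (hD.isometry _).dist_eq, ← hD.glue z hzb b (!b),
        (hD.isometry _).dist_eq]
    _ = θ := by rw [h1, h2]; ring

/-- A nearly optimal crossing point is too close to `y` to lie on another side, so it is on side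
`a`, and reflecting the second half of the path about it preserves its length. -/
theorem angle_le_dist_side (h : IsTriangleModel bd vert n e) (hD : IsDouble bd side) {a : Fin 3}
    {b : Bool} {y y' : X}
    (hy : ∀ j, j ≠ a → dist (side b y) (side (!b) y') < ⟪n j, e y⟫) :
    angle (e y) (sideIsometry (n a) false (e y')) ≤ dist (side b y) (side (!b) y') := by
  have hna := h.norm_normal a
  obtain ⟨r, hr, hrj⟩ := exists_lt_le (fun j => j ≠ a) hy
  refine le_of_forall_gt fun s hs => ?_
  obtain ⟨z, hzb, hz⟩ := hD.exists_bd b y y' (min s r) (lt_min hs hr)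
  obtain ⟨hzs, hzr⟩ := lt_min_iff.1 hz
  obtain ⟨i, hi⟩ := (h.mem_bd z).1 hzb
  have hia : i = a := by
    by_contra hne
    have := h.inner_sub_dist_le y z i
    linarith [hrj i hne, dist_nonneg (x := y') (y := z)]
  rw [hia] at hi
  refine ((angle_le_angle_add_angle _ (e z) _).trans_eq ?_).trans_lt hzs
  rw [h.angle_map, dist_comm y' z, ← h.angle_map z y',
    ← angle_isometry (sideIsometry (n a) false) (e z) (e y'),
    sideIsometry_of_inner_eq_zero hna hi]

theorem exists_chart_double (h : IsTriangleModel bd vert n e) (hD : IsDouble bd side) {a : Fin 3}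
    {x : X} (hx : ∀ j, j ≠ a → 0 < ⟪n j, e x⟫) (b : Bool) :
    ∃ r, IsSphericalChartAt (unfoldChart hD n e a) (side b x) r := by
  have hna := h.norm_normal a
  obtain ⟨r₀, hr₀, hrj⟩ := exists_lt_le (fun j => j ≠ a) hx
  -- Two points of this ball are less than `2 * (r₀ / 3)` apart, and each keeps more than that
  -- margin from the other sides, so the distance comparison across side `a` applies to them.
  have hball : ∀ c y, dist (side c y) (side b x) < r₀ / 3 →
      ∀ j, j ≠ a → 2 * (r₀ / 3) < ⟪n j, e y⟫ := by
    intro c y hy j hj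
    have h1 := hD.dist_le c b y x
    have h2 := h.inner_sub_dist_le x y j
    rw [dist_comm] at h2
    linarith [hrj j hj]
  have hF : ∀ c y, dist (side c y) (side b x) < r₀ / 3 →
      unfoldChart hD n e a (side c y) = sideIsometry (n a) c (e y) := fun c y hy =>
    h.unfoldChart_side hD (fun j hj => by linarith [hball c y hy j hj]) c
  refine ⟨r₀ / 3, by positivity, fun q hq => ?_, fun q hq q' hq' => ?_, fun v hv hvr => ?_⟩
  · obtain ⟨⟨c, y⟩, rfl⟩ := hD.surj q
    rw [hF c y hq, LinearIsometryEquiv.norm_map, h.norm_map]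
  · obtain ⟨⟨c, y⟩, rfl⟩ := hD.surj q
    obtain ⟨⟨c', y'⟩, rfl⟩ := hD.surj q'
    rw [Metric.mem_ball] at hq hq'
    simp only at hq hq' ⊢
    rw [hF c y hq, hF c' y' hq']
    by_cases hc : c' = c
    · rw [hc, angle_isometry, h.angle_map, (hD.isometry c).dist_eq]
    · have hc' : c' = !c := by cases c <;> cases c' <;> simp_all
      subst hc'
      rw [sideIsometry_not, angle_isometry]
      have hlt : dist (side c y) (side (!c) y') < 2 * (r₀ / 3) := by
        have := dist_triangle_right (side c y) (side (!c) y') (side b x)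
        linarith
      have hle := h.angle_le_dist_side hD (a := a)
        fun j hj => hlt.trans (hball c y hq j hj)
      exact le_antisymm hle (h.dist_side_le_angle hD
        (fun j hj => (hle.trans_lt hlt).trans (hball c y hq j hj)) c)
  · rw [h.unfoldChart_side hD hx] at hvr
    set v' := sideIsometry (n a) b v with hv'
    have hv1 : ‖v'‖ = 1 := by rw [hv', LinearIsometryEquiv.norm_map, hv]
    have hvv : sideIsometry (n a) b v' = v := sideIsometry_sideIsometry _ _ _
    rw [← hvv, angle_isometry] at hvr
    by_cases hva : 0 ≤ ⟪n a, v'⟫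
    · obtain ⟨y, hy⟩ := h.surj v' hv1 fun j => by
        by_cases hj : j = a
        · rwa [hj]
        · have := inner_sub_angle_le (h.norm_normal j) (h.norm_map x) hv1
          linarith [hrj j hj]
      have hd : dist (side b y) (side b x) < r₀ / 3 := by
        rw [(hD.isometry b).dist_eq, dist_comm, ← h.angle_map, hy]
        exact hvr
      exact ⟨side b y, hd, by rw [hF b y hd, hy, hvv]⟩
    · push Not at hva
      set v'' := sideIsometry (n a) false v' with hv''
      have hv2 : ‖v''‖ = 1 := by rw [hv'', LinearIsometryEquiv.norm_map, hv1]
      -- Reflecting a point into the half-space containing `e x` brings it closer to `e x`, so the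
      -- reflected target still lies in the triangle and is attained in the other copy.
      have hang : angle (e x) v'' ≤ angle (e x) v' := by
        refine (Real.strictAntiOn_cos.le_iff_ge ⟨angle_nonneg _ _, angle_le_pi _ _⟩
          ⟨angle_nonneg _ _, angle_le_pi _ _⟩).1 ?_
        rw [← inner_eq_cos_angle_of_norm_eq_one (h.norm_map x) hv1,
          ← inner_eq_cos_angle_of_norm_eq_one (h.norm_map x) hv2, hv'', sideIsometry_false hna,
          inner_sub_right, real_inner_smul_right, real_inner_comm (n a) (e x)]
        nlinarith [h.nonneg x a]
      obtain ⟨y, hy⟩ := h.surj v'' hv2 fun j => by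
        by_cases hj : j = a
        · rw [hj, hv'', inner_sideIsometry_false hna]
          linarith
        · have := inner_sub_angle_le (h.norm_normal j) (h.norm_map x) hv2
          linarith [hrj j hj]
      have hyv : sideIsometry (n a) false (e y) = v' := by
        rw [hy, hv'', sideIsometry_sideIsometry]
      have hd : dist (side (!b) y) (side b x) < r₀ / 3 := by
        rw [dist_comm]
        refine (h.dist_side_le_angle hD (a := a) (fun j hj => ?_) b).trans_lt ?_
        · rw [hyv]
          linarith [hrj j hj]
        · rwa [hyv]
      exact ⟨side (!b) y, hd, by rw [hF _ y hd, sideIsometry_not, hyv, hvv]⟩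

theorem eventually_side (h : IsTriangleModel bd vert n e) (hD : IsDouble bd side) {x : X}
    (hx : ∀ i, 0 < ⟪n i, e x⟫) (b : Bool) :
    ∀ᶠ q in 𝓝 (side b x), ∃ y, side b y = q ∧ ∀ i, 0 < ⟪n i, e y⟫ := by
  obtain ⟨r, hr, hri⟩ := exists_lt_le (fun _ => True) fun i _ => hx i
  filter_upwards [Metric.ball_mem_nhds _ hr] with q hq
  obtain ⟨⟨c, y⟩, rfl⟩ := hD.surj q
  rw [Metric.mem_ball, dist_comm] at hq
  by_cases hc : c = b
  · refine ⟨y, by rw [hc], fun i => ?_⟩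
    linarith [h.inner_sub_dist_le x y i, hri i trivial, hD.dist_le b c x y]
  · have hc' : c = !b := by cases b <;> cases c <;> simp_all
    subst hc'
    obtain ⟨z, hzb, hz⟩ := hD.exists_bd b x y r hq
    obtain ⟨i, hi⟩ := (h.mem_bd z).1 hzb
    linarith [h.inner_sub_dist_le x z i, hri i trivial, dist_nonneg (x := y) (y := z)]

theorem exists_inner_eq (h : IsTriangleModel bd vert n e) {t : E3} (ht : t ≠ 0)
    (htn : ∀ i, 0 ≤ t i) : ∃ p, ∃ s : ℝ, 0 < s ∧ ∀ i, ⟪n i, e p⟫ = s * t i := by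
  have hn := h.linearIndependent
  have hv := vectorMap_ne_zero hn ht
  have hs : 0 < ‖vectorMap n t‖⁻¹ := inv_pos.2 (norm_pos_iff.2 hv)
  have hi : ∀ i, ⟪n i, ‖vectorMap n t‖⁻¹ • vectorMap n t⟫ = ‖vectorMap n t‖⁻¹ * t i := fun i => by
    rw [real_inner_smul_right, inner_vectorMap hn]
  obtain ⟨p, hp⟩ := h.surj (‖vectorMap n t‖⁻¹ • vectorMap n t) (norm_smul_inv_norm (𝕜 := ℝ) hv)
    fun i => by rw [hi]; exact mul_nonneg hs.le (htn i)
  exact ⟨p, _, hs, fun i => by rw [hp, hi]⟩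

theorem joinedIn (h : IsTriangleModel bd vert n e) {a : Fin 3} {p q : X}
    (hp : ∀ j, j ≠ a → 0 < ⟪n j, e p⟫) (hq : ∀ j, j ≠ a → 0 < ⟪n j, e q⟫) :
    JoinedIn {x | ∀ j, j ≠ a → 0 < ⟪n j, e x⟫} p q := by
  obtain ⟨c, hc0, hc1, hlip, hpos⟩ := h.exists_geodesic p q
  refine ⟨⟨⟨fun t => c t, ?_⟩, by simpa using hc0, by simpa using hc1⟩, fun t j hj => ?_⟩
  · exact hlip.continuousOn.comp_continuous continuous_subtype_val fun t => t.2
  · exact hpos j (hp j hj) (hq j hj) t t.2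

theorem joinedIn_double (h : IsTriangleModel bd vert n e) (hD : IsDouble bd side) {a : Fin 3}
    {p : X} (hp : ∀ j, j ≠ a → 0 < ⟪n j, e p⟫) (b : Bool) :
    JoinedIn {q | ∃ c x, side c x = q ∧ ∀ j, j ≠ a → 0 < ⟪n j, e x⟫} (side b p) (side (!b) p) := by
  classical
  -- A point in the relative interior of side `a`, where the path passes from one copy to the other.
  obtain ⟨m, s, hs, hm⟩ := h.exists_inner_eq
    (t := WithLp.toLp 2 fun i => if i = a then (0 : ℝ) else 1)
    (fun h0 => by
      obtain ⟨j, hj, -⟩ := exists_ne_ne a a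
      have := congrArg (fun v : E3 => v j) h0
      simp [hj] at this)
    (fun i => by
      change 0 ≤ if i = a then (0 : ℝ) else 1
      split_ifs <;> norm_num)
  have hma : m ∈ bd := (h.mem_bd m).2 ⟨a, by rw [hm]; simp⟩
  have hmj : ∀ j, j ≠ a → 0 < ⟪n j, e m⟫ := fun j hj => by
    rw [hm]
    simpa [hj] using hs
  have key : ∀ c, JoinedIn {q | ∃ c x, side c x = q ∧ ∀ j, j ≠ a → 0 < ⟪n j, e x⟫}
      (side c p) (side c m) := fun c => by
    refine ((h.joinedIn hp hmj).map_continuousOn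
      (f := side c) (hD.isometry c).continuous.continuousOn).mono ?_
    rintro _ ⟨x, hx, rfl⟩
    exact ⟨c, x, rfl, hx⟩
  have h1 := key b
  rw [hD.glue m hma b (!b)] at h1
  exact h1.trans (key (!b)).symm

end IsTriangleModel

/-! ### Holonomy of the double -/

/-- One chart serves along each half; agreement near the junction is all that local constancy of
germs requires. -/
theorem isDevelopmentAlong_trans {X : Type*} [MetricSpace X] {p q q' : X} {γ : Path p q}
    {γ' : Path q q'} {f f' : X → E3} (h : ∀ t, ∃ r, IsSphericalChartAt f (γ t) r)
    (h' : ∀ t, ∃ r, IsSphericalChartAt f' (γ' t) r) (hff' : f' =ᶠ[𝓝 q] f) :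
    IsDevelopmentAlong (γ.trans γ') fun t => if (t : ℝ) ≤ 1 / 2 then f else f' := by
  constructor
  · intro t
    rw [Path.trans_apply]
    by_cases ht : (t : ℝ) ≤ 1 / 2
    · simp only [if_pos ht, dif_pos ht]
      exact h _
    · simp only [if_neg ht, dif_neg ht]
      exact h' _
  · intro t
    rcases lt_trichotomy (t : ℝ) (1 / 2) with ht | ht | ht
    · filter_upwards [continuous_subtype_val.continuousAt.eventually_lt
        (continuousAt_const (y := (1 / 2 : ℝ))) ht] with s hs
      rw [if_pos hs.le, if_pos ht.le]
    · have hγ : (γ.trans γ') t = q := by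
        rw [Path.trans_apply, dif_pos ht.le]
        convert γ.target
        simp only [ht]
        norm_num
      have h1 := eventually_eventually_nhds.2 hff'
      rw [← hγ] at h1
      filter_upwards [(γ.trans γ').continuous.continuousAt.eventually h1] with s hs
      rw [if_pos ht.le]
      split_ifs with hs'
      · exact Filter.EventuallyEq.rfl
      · exact hs
    · filter_upwards [(continuousAt_const (y := (1 / 2 : ℝ))).eventually_lt
        continuous_subtype_val.continuousAt ht] with s hs
      rw [if_neg (not_le.2 hs), if_neg (not_le.2 ht)]

namespace IsTriangleModel

theorem nonCoaxial {T : SphericalPolygon 3} {n : Fin 3 → E3} {e : T.metric.Space → E3}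
    (h : IsTriangleModel T.metric.boundary T.vertex n e) : T.NonCoaxial := by
  have hD := isDouble_doubleSide T
  obtain ⟨x, s, hs, hxs⟩ := h.exists_inner_eq (t := WithLp.toLp 2 fun _ => (1 : ℝ))
    (fun h0 => by
      have := congrArg (fun v : E3 => v 0) h0
      simp at this)
    (fun i => zero_le_one)
  have hx : ∀ i, 0 < ⟪n i, e x⟫ := fun i => by
    rw [hxs]
    simpa using hs
  have hsing : ∀ (a : Fin 3) c y, (∀ j, j ≠ a → 0 < ⟪n j, e y⟫) →
      doubleSide T c y ∉ T.doubleSing := by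
    rintro a c y hy ⟨i, hi⟩
    have hyi : T.vertex i = y := by
      have hle := hD.dist_le true c (T.vertex i) y
      have heq : doubleSide T true (T.vertex i) = doubleSide T c y := hi
      rw [heq, dist_self] at hle
      exact dist_le_zero.1 hle
    obtain ⟨j, hja, hji⟩ := exists_ne_ne a i
    exact (hy j hja).ne' (by rw [← hyi]; exact h.inner_vert i j hji)
  have hside : ∀ (a : Fin 3) b, ∀ᶠ q in 𝓝 (doubleSide T b x), ∃ y,
      unfoldChart hD n e a q = sideIsometry (n a) b (e y) ∧ doubleSide T b y = q := fun a b => by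
    filter_upwards [h.eventually_side hD hx b] with q hq
    obtain ⟨y, rfl, hy⟩ := hq
    exact ⟨y, h.unfoldChart_side hD (fun j _ => hy j) b, rfl⟩
  -- On the interior of the unreflected copy all three unfoldings are simply `e`.
  have hfar : ∀ a b : Fin 3, unfoldChart hD n e a =ᶠ[𝓝 (doubleSide T true x)]
      unfoldChart hD n e b := fun a b => by
    filter_upwards [hside a true, hside b true] with q hq hq'
    obtain ⟨y, h1, h2⟩ := hq
    obtain ⟨y', h1', h2'⟩ := hq'
    rw [h1, h1', (hD.isometry true).injective (h2.trans h2'.symm)]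
    rfl
  intro H
  obtain ⟨r, hr⟩ := h.exists_chart_double hD (a := 0) (fun j _ => hx j) true
  obtain ⟨v, hv, hfix⟩ := H _ (hsing 0 true x fun j _ => hx j) _ r hr
  -- The loop leaves the first copy through side `a` and returns through side `b`. In the second
  -- copy the two unfoldings differ by the product of the reflections; continuing with the corrected
  -- chart, the loop ends with this product applied to the initial chart.
  have hhol : ∀ a b : Fin 3,
      ((sideIsometry (n b) false).trans (sideIsometry (n a) false)) ∈
        holonomyImage T.doubleSing (doubleSide T true x) (unfoldChart hD n e 0) := by
    intro a b
    obtain ⟨γ, hγ⟩ := h.joinedIn_double hD (a := a) (fun j _ => hx j) true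
    obtain ⟨γ', hγ'⟩ := h.joinedIn_double hD (a := b) (fun j _ => hx j) false
    refine ⟨γ.trans γ', fun t => ?_, _, isDevelopmentAlong_trans
      (f := unfoldChart hD n e a)
      (f' := fun q => ((sideIsometry (n b) false).trans (sideIsometry (n a) false))
        (unfoldChart hD n e b q)) (fun t => ?_) (fun t => ?_) ?_, ?_, ?_⟩
    · rw [Path.trans_apply]
      split_ifs with ht
      · obtain ⟨c, y, hy, hyj⟩ := hγ ⟨2 * t, _⟩
        rw [← hy]
        exact hsing a c y hyj
      · obtain ⟨c, y, hy, hyj⟩ := hγ' ⟨2 * t - 1, _⟩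
        rw [← hy]
        exact hsing b c y hyj
    · obtain ⟨c, y, hy, hyj⟩ := hγ t
      rw [← hy]
      exact h.exists_chart_double hD hyj c
    · obtain ⟨c, y, hy, hyj⟩ := hγ' t
      rw [← hy]
      obtain ⟨r, hr⟩ := h.exists_chart_double hD hyj c
      exact ⟨r, isSphericalChartAt_comp_isometry hr _⟩
    · filter_upwards [hside a false, hside b false] with q hq hq'
      obtain ⟨y, h1, h2⟩ := hq
      obtain ⟨y', h1', h2'⟩ := hq'
      rw [h1, h1', (hD.isometry false).injective (h2.trans h2'.symm),
        LinearIsometryEquiv.trans_apply, sideIsometry_sideIsometry]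
    · rw [if_pos (by norm_num)]
      exact hfar a 0
    · rw [if_neg (by norm_num)]
      exact (hfar b 0).fun_comp _
  -- A vector fixed by the product of two reflections has the same image under both, so `⟪n b, v⟫ •
  -- n b = ⟪n a, v⟫ • n a`, and independence of the normals makes both coefficients vanish.
  have hzero : ∀ a, ⟪n a, v⟫ = 0 := by
    intro a
    obtain ⟨b, hba, -⟩ := exists_ne_ne a a
    have h1 := hfix _ (hhol a b)
    rw [LinearIsometryEquiv.trans_apply] at h1
    have h2 := congrArg (sideIsometry (n a) false) h1
    rw [sideIsometry_sideIsometry, sideIsometry_false (h.norm_normal a),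
      sideIsometry_false (h.norm_normal b), sub_right_inj] at h2
    have hinj : Function.Injective ![b, a] := by
      rw [Function.Injective]
      simp [Fin.forall_fin_two, hba, hba.symm]
    have hpair : LinearIndependent ℝ ![n b, n a] := by
      convert h.linearIndependent.comp _ hinj using 1
      ext i
      fin_cases i <;> rfl
    have h3 := LinearIndependent.pair_iff.1 hpair (2 * ⟪n b, v⟫) (-(2 * ⟪n a, v⟫))
      (by rw [h2, neg_smul, add_neg_cancel])
    linarith [h3.2]
  have h0 := eq_zero_of_inner_normals h.linearIndependent hzero
  rw [h0, norm_zero] at hv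
  exact zero_ne_one hv

end IsTriangleModel

end SphericalGeometry

theorem mainTheorem7 (ϑ : Fin 3 → ℝ) (hϑ : ∀ i, ϑ i ∈ Set.Ioo (0 : ℝ) 1) :
    ((∃ T : SphericalPolygon 3, T.IsConvex ∧ T.angle = ϑ) ↔
      ((1 - ϑ 0 < (1 - ϑ 1) + (1 - ϑ 2) ∧
        1 - ϑ 1 < (1 - ϑ 2) + (1 - ϑ 0) ∧
        1 - ϑ 2 < (1 - ϑ 0) + (1 - ϑ 1)) ∧
      0 < ϑ 0 + ϑ 1 + ϑ 2 - 1)) ∧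
    ∀ T : SphericalPolygon 3, T.IsConvex → T.angle = ϑ → T.AngleDeformable ∧ T.NonCoaxial := by
  refine ⟨⟨?_, fun hreg => ?_⟩, fun T _ hT => ?_⟩
  · rintro ⟨T, -, rfl⟩
    have hα : ∀ i, T.angle i < 1 := fun i => (hϑ i).2
    obtain ⟨n, e, h⟩ := SphericalGeometry.exists_isTriangleModel T hα
    exact ((h.hasAngles hα).mem_angleRegion hϑ).2
  · obtain ⟨c, z, hc⟩ := SphericalGeometry.exists_isConeCoordinates
    exact ⟨hc.polygon (SphericalGeometry.hasAngles_normals ⟨hϑ, hreg⟩) hϑ, fun i => (hϑ i).2.le, rfl⟩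
  · have hα : ∀ i, T.angle i < 1 := fun i => by rw [hT]; exact (hϑ i).2
    obtain ⟨n, e, h⟩ := SphericalGeometry.exists_isTriangleModel T hα
    exact ⟨SphericalGeometry.angleDeformable_of_angle_lt_one hα, h.nonCoaxial⟩
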